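/- Let $n\ge 2$, let $\Omega\subset\mathbb{R}^n$ be a bounded open set, let $p>1$, and let $p^*$ be the Sobolev exponent of $p$: $p^*=\frac{np}{n-p}$ if $p<n$, and $p^*$ is any fixed number greater than $p$ if $p\ge n$. A map $g(x,u,\xi)$ on $\Omega\times\mathbb{R}\times\mathbb{R}^n$ is called Carathéodory if it is measurable in $x$ for all $(u,\xi)$ and continuous in $(u,\xi)$ for a.e. $x$. **Energy.** Let $f:\Omega\times\mathbb{R}\times\mathbb{R}^n\to[0,+\infty)$ be a Carathéodory function such that, for a.e. $x\in\Omega$ and all $u\in\mathbb{R}$, $\xi\mapsto f(x,u,\xi)$ is convex and differentiable, the gradient $D_\xi f$ being again a Carathéodory map. Assume that there are constants $M\ge m>1$ and $c_5,c_6>0$ such that $$m\,f(x,u,\xi)\le f(x,u,2\xi)\le M\,f(x,u,\xi)\qquad\forall (x,u,\xi)\in\Omega\times\mathbb{R}\times\mathbb{R}^n,$$ and, for a.e. $x\in\Omega$ and all $u,v\in\mathbb{R}$, $\xi\in\mathbb{R}^n$, $$f(x,u,\xi)\ge c_5|\xi|^p,\qquad f(x,v,\xi)\le c_6\,f(x,u,\xi)\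 \text{ whenever } |v|\le|u|,$$ and that $f(\cdot,0,0)\in L^1(\Omega)$. Put $$W^{1,F}(\Omega)=\Big\{u\in W^{1,1}(\Omega):\int_\Omega f(x,u,Du)\,dx<+\infty\Big\},\qquad W^{1,F}_0(\Omega)=W^{1,F}(\Omega)\cap W^{1,p}_0(\Omega).$$ **Vector field.** Let $a:\Omega\times\mathbb{R}\times\mathbb{R}^n\to\mathbb{R}^n$ be a Carathéodory map such that, for some constants $c_1,c_3>0$, $c_2,c_4\ge0$ and functions $b_1\in L^{s_1}(\Omega)$ with $s_1>\max\{1,\frac np\}$ and $b_2\in L^1(\Omega)$, for a.e. $x\in\Omega$ and all $(u,\xi)\in\mathbb{R}\times\mathbb{R}^n$, $$(a(x,u,\xi),\xi)\ge c_1(D_\xi f(x,u,\xi),\xi)-c_2|u|^{p^*}-b_1(x),$$ $$(a(x,u,\xi),\xi)\le c_3(D_\xi f(x,u,\xi),\xi)+c_4|u|^{p^*}+b_2(x).$$ **Right-hand side.** Let $b:\Omega\times\mathbb{R}\times\mathbb{R}^n\to\mathbb{R}$ be a Carathéodory function satisfying at least one of the following two conditions, for a.e. $x\in\Omega$ and all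 $(u,\xi)\in\mathbb{R}\times\mathbb{R}^n$: (i) for some constants $c_7,c_8,\varepsilon>0$ and nonnegative functions $b_3\in L^{\frac np+\varepsilon}(\Omega)$, $b_4\in L^1(\Omega)$, $$\operatorname{sign}(u)\,b(x,u,\xi)\ge -c_7\Big(f(x,u,\xi)^{1-\frac1{p^*}}+|\xi|^{p\left(1-\frac1{p^*}\right)}+|u|^{p^*-1}\Big)-b_3(x),$$ $$u\,b(x,u,\xi)\le c_8\big(f(x,u,\xi)+|u|^{p^*}\big)+b_4(x);$$ (ii) for some constants $c_9\ge0$, $\varepsilon>0$ and a nonnegative function $b_3\in L^{\frac np+\varepsilon}(\Omega)$, $$|b(x,u,\xi)|\le c_9\Big(f(x,u,\xi)^{1-\frac1{p^*}}+|u|^{p^*-1}\Big)+b_3(x).$$ **Weak solutions.** Let $u_0\in L^\infty(\Omega)\cap W^{1,F}(\Omega)$. A weak solution of the Dirichlet problem $$\operatorname{div}a(x,u,Du)=b(x,u,Du)\ \text{ in }\Omega,\qquad u=u_0\ \text{ on }\partial\Omega,$$ is a function $u\in W^{1,F}(\Omega)$ with $u-u_0\in W^{1,F}_0(\Omega)$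 such that $$\int_\Omega\big\{(a(x,u,Du),D\varphi)+b(x,u,Du)\,\varphi\big\}\,dx=0$$ for every $\varphi\in W^{1,F}_0(\Omega)$ for which $(a(x,u,Du),D\varphi)$ and $b(x,u,Du)\,\varphi$ are integrable on $\Omega$. **Theorem.** Under these assumptions every weak solution $u$ of the Dirichlet problem is bounded: $u\in L^\infty(\Omega)$. -/

import Mathlib

open MeasureTheory Filter Topology Set
open scoped ENNReal ContDiff

namespace BoundedSolutions

/-- `φ` is a test function on `Ω`: smooth, with compact support contained in `Ω`. -/
structure IsTestFunction {n : ℕ} (Ω : Set (EuclideanSpace ℝ (Fin n)))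
    (φ : EuclideanSpace ℝ (Fin n) → ℝ) : Prop where
  smooth : ContDiff ℝ ∞ φ
  compact_support : HasCompactSupport φ
  support_subset : tsupport φ ⊆ Ω

/-- `Du` is a weak (distributional) gradient of `u` in `Ω`. -/
structure IsWeakGradient {n : ℕ} (Ω : Set (EuclideanSpace ℝ (Fin n)))
    (u : EuclideanSpace ℝ (Fin n) → ℝ)
    (Du : EuclideanSpace ℝ (Fin n) → EuclideanSpace ℝ (Fin n)) : Prop where
  locallyIntegrable : LocallyIntegrableOn u Ω volume
  locallyIntegrable_grad : LocallyIntegrableOn Du Ω volume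
  integral_by_parts : ∀ φ : EuclideanSpace ℝ (Fin n) → ℝ, IsTestFunction Ω φ →
    ∀ v : EuclideanSpace ℝ (Fin n),
      ∫ x in Ω, u x * fderiv ℝ φ x v = - ∫ x in Ω, inner ℝ (Du x) v * φ x

/-- `u ∈ W^{1,q}(Ω)`, with weak gradient `Du`. -/
structure MemW1 {n : ℕ} (Ω : Set (EuclideanSpace ℝ (Fin n))) (q : ℝ≥0∞)
    (u : EuclideanSpace ℝ (Fin n) → ℝ)
    (Du : EuclideanSpace ℝ (Fin n) → EuclideanSpace ℝ (Fin n)) : Prop where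
  isWeakGradient : IsWeakGradient Ω u Du
  memLp : MemLp u q (volume.restrict Ω)
  memLp_grad : MemLp Du q (volume.restrict Ω)

/-- `u ∈ W₀^{1,q}(Ω)`, with weak gradient `Du`: the closure of the test functions on `Ω` in
`W^{1,q}(Ω)`. -/
structure MemW10 {n : ℕ} (Ω : Set (EuclideanSpace ℝ (Fin n))) (q : ℝ≥0∞)
    (u : EuclideanSpace ℝ (Fin n) → ℝ)
    (Du : EuclideanSpace ℝ (Fin n) → EuclideanSpace ℝ (Fin n)) : Prop where
  memW1 : MemW1 Ω q u Du
  approx : ∃ φ : ℕ → EuclideanSpace ℝ (Fin n) → ℝ, (∀ k, IsTestFunction Ω (φ k)) ∧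
    Tendsto (fun k => eLpNorm (fun x => u x - φ k x) q (volume.restrict Ω)) atTop (𝓝 0) ∧
    Tendsto (fun k => eLpNorm (fun x => Du x - gradient (φ k) x) q (volume.restrict Ω))
      atTop (𝓝 0)

/-- `g = g(x, u, ξ)` is a Carathéodory map on `Ω × ℝ × ℝⁿ`: (Lebesgue) measurable in `x ∈ Ω` and,
for almost every `x ∈ Ω`, continuous in `(u, ξ)`. -/
structure IsCaratheodory {n : ℕ} {F : Type*} [TopologicalSpace F]
    (Ω : Set (EuclideanSpace ℝ (Fin n)))
    (g : EuclideanSpace ℝ (Fin n) → ℝ → EuclideanSpace ℝ (Fin n) → F) : Prop where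
  measurable : ∀ (u : ℝ) (ξ : EuclideanSpace ℝ (Fin n)),
    AEStronglyMeasurable (fun x => g x u ξ) (volume.restrict Ω)
  continuous : ∀ᵐ x ∂(volume.restrict Ω),
    Continuous (fun z : ℝ × EuclideanSpace ℝ (Fin n) => g x z.1 z.2)

/-- The gradient `D_ξ f (x, u, ξ)` with respect to the last variable. -/
noncomputable def gradXi {n : ℕ}
    (f : EuclideanSpace ℝ (Fin n) → ℝ → EuclideanSpace ℝ (Fin n) → ℝ) :
    EuclideanSpace ℝ (Fin n) → ℝ → EuclideanSpace ℝ (Fin n) → EuclideanSpace ℝ (Fin n) :=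
  fun x u ξ => gradient (f x u) ξ

/-- `f ≥ 0` is a Carathéodory integrand on `Ω × ℝ × ℝⁿ`, convex and differentiable in `ξ`, whose
gradient `D_ξ f` is a Carathéodory map. -/
structure IsConvexEnergyIntegrand {n : ℕ} (Ω : Set (EuclideanSpace ℝ (Fin n)))
    (f : EuclideanSpace ℝ (Fin n) → ℝ → EuclideanSpace ℝ (Fin n) → ℝ) : Prop where
  nonneg : ∀ x ∈ Ω, ∀ u ξ, 0 ≤ f x u ξ
  caratheodory : IsCaratheodory Ω f
  convex : ∀ᵐ x ∂(volume.restrict Ω), ∀ u, ConvexOn ℝ Set.univ (f x u)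
  differentiable : ∀ᵐ x ∂(volume.restrict Ω), ∀ u, Differentiable ℝ (f x u)
  caratheodory_grad : IsCaratheodory Ω (gradXi f)

/-- The two-sided `Δ₂` condition in `ξ`. -/
def TwoSidedDeltaTwo {n : ℕ} (Ω : Set (EuclideanSpace ℝ (Fin n)))
    (f : EuclideanSpace ℝ (Fin n) → ℝ → EuclideanSpace ℝ (Fin n) → ℝ) : Prop :=
  ∃ m M : ℝ, 1 < m ∧ m ≤ M ∧ ∀ x ∈ Ω, ∀ u ξ,
    m * f x u ξ ≤ f x u ((2 : ℝ) • ξ) ∧ f x u ((2 : ℝ) • ξ) ≤ M * f x u ξ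

/-- Coercivity of order `p`: `f(x, u, ξ) ≥ c |ξ|^p`. -/
def Coercive {n : ℕ} (Ω : Set (EuclideanSpace ℝ (Fin n))) (p : ℝ)
    (f : EuclideanSpace ℝ (Fin n) → ℝ → EuclideanSpace ℝ (Fin n) → ℝ) : Prop :=
  ∃ c : ℝ, 0 < c ∧ ∀ᵐ x ∂(volume.restrict Ω), ∀ u ξ, c * ‖ξ‖ ^ p ≤ f x u ξ

/-- Quasi-monotonicity in `|u|`: `f(x, v, ξ) ≤ c f(x, u, ξ)` whenever `|v| ≤ |u|`. -/
def QuasiMonotone {n : ℕ} (Ω : Set (EuclideanSpace ℝ (Fin n)))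
    (f : EuclideanSpace ℝ (Fin n) → ℝ → EuclideanSpace ℝ (Fin n) → ℝ) : Prop :=
  ∃ c : ℝ, 0 < c ∧ ∀ᵐ x ∂(volume.restrict Ω), ∀ u v ξ, |v| ≤ |u| → f x v ξ ≤ c * f x u ξ

/-- `ps` is (an admissible choice of) the Sobolev exponent `p*` of `p` in dimension `n`: it is
`np / (n - p)` if `p < n`, and any number greater than `p` if `p ≥ n`. -/
def IsSobolevExponent (n : ℕ) (p ps : ℝ) : Prop :=
  (p < n → ps = n * p / (n - p)) ∧ (n ≤ p → p < ps)

/-- The comparison inequalities between the vector field `a` and `D_ξ f`. -/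
def ComparisonInequalities {n : ℕ} (Ω : Set (EuclideanSpace ℝ (Fin n))) (p ps : ℝ)
    (f : EuclideanSpace ℝ (Fin n) → ℝ → EuclideanSpace ℝ (Fin n) → ℝ)
    (a : EuclideanSpace ℝ (Fin n) → ℝ → EuclideanSpace ℝ (Fin n) → EuclideanSpace ℝ (Fin n)) :
    Prop :=
  ∃ (c₁ c₂ c₃ c₄ s₁ : ℝ) (b₁ b₂ : EuclideanSpace ℝ (Fin n) → ℝ),
    0 < c₁ ∧ 0 ≤ c₂ ∧ 0 < c₃ ∧ 0 ≤ c₄ ∧ 1 < s₁ ∧ n / p < s₁ ∧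
    MemLp b₁ (ENNReal.ofReal s₁) (volume.restrict Ω) ∧
    IntegrableOn b₂ Ω volume ∧
    ∀ᵐ x ∂(volume.restrict Ω), ∀ u ξ,
      c₁ * inner ℝ (gradXi f x u ξ) ξ - c₂ * |u| ^ ps - b₁ x ≤ inner ℝ (a x u ξ) ξ ∧
      inner ℝ (a x u ξ) ξ ≤ c₃ * inner ℝ (gradXi f x u ξ) ξ + c₄ * |u| ^ ps + b₂ x

/-- The unilateral growth conditions on the right-hand side `b`. -/
def UnilateralGrowth {n : ℕ} (Ω : Set (EuclideanSpace ℝ (Fin n))) (p ps : ℝ)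
    (f b : EuclideanSpace ℝ (Fin n) → ℝ → EuclideanSpace ℝ (Fin n) → ℝ) : Prop :=
  ∃ (c₇ c₈ ε : ℝ) (b₃ b₄ : EuclideanSpace ℝ (Fin n) → ℝ),
    0 < c₇ ∧ 0 < c₈ ∧ 0 < ε ∧
    (∀ᵐ x ∂(volume.restrict Ω), 0 ≤ b₃ x) ∧ (∀ᵐ x ∂(volume.restrict Ω), 0 ≤ b₄ x) ∧
    MemLp b₃ (ENNReal.ofReal (n / p + ε)) (volume.restrict Ω) ∧
    IntegrableOn b₄ Ω volume ∧
    ∀ᵐ x ∂(volume.restrict Ω), ∀ u ξ,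
      -c₇ * (f x u ξ ^ (1 - 1 / ps) + ‖ξ‖ ^ (p * (1 - 1 / ps)) + |u| ^ (ps - 1)) - b₃ x
          ≤ Real.sign u * b x u ξ ∧
      u * b x u ξ ≤ c₈ * (f x u ξ + |u| ^ ps) + b₄ x

/-- The growth condition on `|b|`. -/
def AbsGrowth {n : ℕ} (Ω : Set (EuclideanSpace ℝ (Fin n))) (p ps : ℝ)
    (f b : EuclideanSpace ℝ (Fin n) → ℝ → EuclideanSpace ℝ (Fin n) → ℝ) : Prop :=
  ∃ (c₉ ε : ℝ) (b₃ : EuclideanSpace ℝ (Fin n) → ℝ),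
    0 ≤ c₉ ∧ 0 < ε ∧
    (∀ᵐ x ∂(volume.restrict Ω), 0 ≤ b₃ x) ∧
    MemLp b₃ (ENNReal.ofReal (n / p + ε)) (volume.restrict Ω) ∧
    ∀ᵐ x ∂(volume.restrict Ω), ∀ u ξ,
      |b x u ξ| ≤ c₉ * (f x u ξ ^ (1 - 1 / ps) + |u| ^ (ps - 1)) + b₃ x

/-- The energy `F(u) = ∫_Ω f(x, u, Du) dx ∈ [0, ∞]` of a nonnegative integrand. -/
noncomputable def energy {n : ℕ} (Ω : Set (EuclideanSpace ℝ (Fin n)))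
    (f : EuclideanSpace ℝ (Fin n) → ℝ → EuclideanSpace ℝ (Fin n) → ℝ)
    (u : EuclideanSpace ℝ (Fin n) → ℝ)
    (Du : EuclideanSpace ℝ (Fin n) → EuclideanSpace ℝ (Fin n)) : ℝ≥0∞ :=
  ∫⁻ x in Ω, ENNReal.ofReal (f x (u x) (Du x))

/-- `u ∈ W^{1,F}(Ω)`, with weak gradient `Du`: `u ∈ W^{1,1}(Ω)` with finite energy. -/
structure MemW1F {n : ℕ} (Ω : Set (EuclideanSpace ℝ (Fin n)))
    (f : EuclideanSpace ℝ (Fin n) → ℝ → EuclideanSpace ℝ (Fin n) → ℝ)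
    (u : EuclideanSpace ℝ (Fin n) → ℝ)
    (Du : EuclideanSpace ℝ (Fin n) → EuclideanSpace ℝ (Fin n)) : Prop where
  memW11 : MemW1 Ω 1 u Du
  finite_energy : energy Ω f u Du < ⊤

/-- `u ∈ W₀^{1,F}(Ω) = W^{1,F}(Ω) ∩ W₀^{1,p}(Ω)`, with weak gradient `Du`. -/
structure MemW1F0 {n : ℕ} (Ω : Set (EuclideanSpace ℝ (Fin n))) (p : ℝ)
    (f : EuclideanSpace ℝ (Fin n) → ℝ → EuclideanSpace ℝ (Fin n) → ℝ)
    (u : EuclideanSpace ℝ (Fin n) → ℝ)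
    (Du : EuclideanSpace ℝ (Fin n) → EuclideanSpace ℝ (Fin n)) : Prop where
  memW1F : MemW1F Ω f u Du
  memW10 : MemW10 Ω (ENNReal.ofReal p) u Du

/-- `u` (with weak gradient `Du`) is a weak solution with finite energy of the Dirichlet problem
`div a(x, u, Du) = b(x, u, Du)` in `Ω`, `u = u₀` on `∂Ω`.

No growth condition makes the two pairings converge for every `φ ∈ W₀^{1,F}(Ω)`, so the integral
identity is required for exactly those `φ ∈ W₀^{1,F}(Ω)` for which both of them converge.
In particular every `u` for which all the pairings converge and vanish is a weak solution. -/
structure IsWeakSolution {n : ℕ} (Ω : Set (EuclideanSpace ℝ (Fin n))) (p : ℝ)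
    (f : EuclideanSpace ℝ (Fin n) → ℝ → EuclideanSpace ℝ (Fin n) → ℝ)
    (a : EuclideanSpace ℝ (Fin n) → ℝ → EuclideanSpace ℝ (Fin n) → EuclideanSpace ℝ (Fin n))
    (b : EuclideanSpace ℝ (Fin n) → ℝ → EuclideanSpace ℝ (Fin n) → ℝ)
    (u₀ : EuclideanSpace ℝ (Fin n) → ℝ)
    (Du₀ : EuclideanSpace ℝ (Fin n) → EuclideanSpace ℝ (Fin n))
    (u : EuclideanSpace ℝ (Fin n) → ℝ)
    (Du : EuclideanSpace ℝ (Fin n) → EuclideanSpace ℝ (Fin n)) : Prop where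
  memW1F : MemW1F Ω f u Du
  boundary : MemW1F0 Ω p f (fun x => u x - u₀ x) (fun x => Du x - Du₀ x)
  equation : ∀ (φ : EuclideanSpace ℝ (Fin n) → ℝ)
    (Dφ : EuclideanSpace ℝ (Fin n) → EuclideanSpace ℝ (Fin n)),
    MemW1F0 Ω p f φ Dφ →
    IntegrableOn (fun x => inner ℝ (a x (u x) (Du x)) (Dφ x)) Ω volume →
    IntegrableOn (fun x => b x (u x) (Du x) * φ x) Ω volume →
    ∫ x in Ω, (inner ℝ (a x (u x) (Du x)) (Dφ x) + b x (u x) (Du x) * φ x) = 0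

end BoundedSolutions

/-! The proof is De Giorgi's method on the superlevel sets A_k = {|u| > k}, for k at least the sup
norm of u₀. The test function is the truncation sign(u)(|u| - k)⁺, called `excess`, with gradient Du
on A_k and 0 elsewhere. It is admissible for three reasons. It lies in W₀^{1,p} because it vanishes
where |u| ≤ k (`memW10_excess`). It has finite energy because f is quasi-monotone in |u| and f(x, u,
0) = 0, the latter forced by the lower Δ₂ bound with m > 1 (`memW1F0_excess`). Both pairings
converge because a is only paired with a multiple of Du, and b only with a function of the sign of
u, which is what the comparison and growth conditions control.

Convexity and the upper Δ₂ bound make (D_ξ f, ξ) comparable to f. The equation therefore yields a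
Caccioppoli inequality with no cutoff (`IsWeakSolution.exists_caccioppoli`): the energy on A_k is
bounded by the integrals over A_k of |u|^{p*}, B and B(|u| - k), where B = |b₁| + b₃. In the other
direction, Sobolev's inequality for the truncation and coercivity bound the integral of (|u| - k)^Q
over A_k by a power Q/p of the energy on A_k.

The term |u|^{p*} has critical growth, so it cannot be treated as a lower order term. Since p* > p,
its part coming from |u| - k is the energy times a positive power of the integral of (|u| - k)^Q
over A_k. That integral tends to 0 as k → ∞, so this part is absorbed for large k. What remains is a
power of |A_k|, and s > max(1, n/p) makes the resulting recursion for |A_k| superlinear.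
Stampacchia's lemma (`exists_threshold_eq_zero`), applied between the levels K and 2K, then gives
|A_{2K}| = 0 (`exists_measure_superlevel_eq_zero_of_caccioppoli`).

For p > n the equation is not needed beyond the membership of the truncations in W₀^{1,p}: Du ∈ L^p
and the Sobolev inequality from L¹ already give a superlinear recursion (`memLp_top_of_lt`). -/

namespace BoundedSolutions

/-! ### Mollification and interior approximation of Sobolev functions. -/

section Mollification

open ContinuousLinearMap
open scoped Convolution

variable {n : ℕ} {F : Type*} [NormedAddCommGroup F] [NormedSpace ℝ F]

/-- The convolution of `g` with the normalized bump function `ρ`. -/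
noncomputable def mollify (ρ : ContDiffBump (0 : EuclideanSpace ℝ (Fin n)))
    (g : EuclideanSpace ℝ (Fin n) → F) : EuclideanSpace ℝ (Fin n) → F :=
  ρ.normed volume ⋆[lsmul ℝ ℝ, volume] g

theorem mollify_apply (ρ : ContDiffBump (0 : EuclideanSpace ℝ (Fin n)))
    (g : EuclideanSpace ℝ (Fin n) → F) (x : EuclideanSpace ℝ (Fin n)) :
    mollify ρ g x = ∫ t, ρ.normed volume t • g (x - t) := rfl

theorem mollify_apply' (ρ : ContDiffBump (0 : EuclideanSpace ℝ (Fin n)))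
    (g : EuclideanSpace ℝ (Fin n) → F) (x : EuclideanSpace ℝ (Fin n)) :
    mollify ρ g x = ∫ t, ρ.normed volume (x - t) • g t :=
  convolution_lsmul_swap

theorem convolutionExists_mollify (ρ : ContDiffBump (0 : EuclideanSpace ℝ (Fin n)))
    {g : EuclideanSpace ℝ (Fin n) → F} (hg : LocallyIntegrable g) :
    ConvolutionExists (ρ.normed volume) g (lsmul ℝ ℝ) volume :=
  ρ.hasCompactSupport_normed.convolutionExists_left _ ρ.continuous_normed hg

theorem contDiff_mollify [CompleteSpace F] (ρ : ContDiffBump (0 : EuclideanSpace ℝ (Fin n)))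
    {g : EuclideanSpace ℝ (Fin n) → F} (hg : LocallyIntegrable g) :
    ContDiff ℝ ∞ (mollify ρ g) :=
  ρ.hasCompactSupport_normed.contDiff_convolution_left _ ρ.contDiff_normed hg

theorem enorm_mollify_le (ρ : ContDiffBump (0 : EuclideanSpace ℝ (Fin n)))
    (g : EuclideanSpace ℝ (Fin n) → F) (x : EuclideanSpace ℝ (Fin n)) :
    ‖mollify ρ g x‖ₑ ≤ ∫⁻ t, ENNReal.ofReal (ρ.normed volume t) * ‖g (x - t)‖ₑ := by
  rw [mollify_apply]
  refine (enorm_integral_le_lintegral_enorm _).trans (le_of_eq ?_)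
  refine lintegral_congr fun t => ?_
  rw [enorm_smul, Real.enorm_of_nonneg (ρ.nonneg_normed t)]

theorem lintegral_ofReal_normed (ρ : ContDiffBump (0 : EuclideanSpace ℝ (Fin n))) :
    ∫⁻ t, ENNReal.ofReal (ρ.normed volume t) = 1 := by
  rw [← ofReal_integral_eq_lintegral_ofReal (ρ.integrable_normed)
    (Eventually.of_forall ρ.nonneg_normed), ρ.integral_normed, ENNReal.ofReal_one]

/-- Young's inequality for a probability kernel. -/
theorem eLpNorm_mollify_le (ρ : ContDiffBump (0 : EuclideanSpace ℝ (Fin n)))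
    {g : EuclideanSpace ℝ (Fin n) → F} (hg : AEStronglyMeasurable g) {p : ℝ≥0∞} (hp : 1 ≤ p)
    (hp' : p ≠ ⊤) : eLpNorm (mollify ρ g) p volume ≤ eLpNorm g p volume := by
  have hp0 : p ≠ 0 := (zero_lt_one.trans_le hp).ne'
  have hpr : 1 ≤ p.toReal := by
    rw [← ENNReal.toReal_one]; exact ENNReal.toReal_mono hp' hp
  have hpr0 : 0 < p.toReal := by linarith
  -- Jensen's inequality is obtained as the monotonicity of L^p norms in the exponent for the
  -- probability measure with density ρ. Tonelli's theorem and translation invariance then finish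
  -- the estimate.
  set ν : Measure (EuclideanSpace ℝ (Fin n)) :=
    volume.withDensity fun t => ENNReal.ofReal (ρ.normed volume t) with hν
  have hρm : Measurable fun t => ENNReal.ofReal (ρ.normed volume t) :=
    ρ.continuous_normed.measurable.ennreal_ofReal
  have hprob : IsProbabilityMeasure ν :=
    ⟨by rw [hν, withDensity_apply _ MeasurableSet.univ]; simpa using lintegral_ofReal_normed ρ⟩
  rw [eLpNorm_eq_lintegral_rpow_enorm_toReal hp0 hp', eLpNorm_eq_lintegral_rpow_enorm_toReal hp0 hp']
  gcongr ?_ ^ _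
  have hmeas2 : AEMeasurable
      (fun z : EuclideanSpace ℝ (Fin n) × EuclideanSpace ℝ (Fin n) => ‖g (z.1 - z.2)‖ₑ)
      (volume.prod volume) :=
    (hg.comp_quasiMeasurePreserving (quasiMeasurePreserving_sub volume volume)).enorm
  have hmeas1 : ∀ x, AEMeasurable (fun t => ‖g (x - t)‖ₑ) volume := fun x =>
    (hg.comp_quasiMeasurePreserving
      (quasiMeasurePreserving_sub_left volume x)).enorm
  calc ∫⁻ x, ‖mollify ρ g x‖ₑ ^ p.toReal
      ≤ ∫⁻ x, ∫⁻ t, ENNReal.ofReal (ρ.normed volume t) * ‖g (x - t)‖ₑ ^ p.toReal := by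
        refine lintegral_mono fun x => ?_
        have hac : ν ≪ volume := withDensity_absolutelyContinuous _ _
        have h1 : eLpNorm (fun t => g (x - t)) 1 ν ≤ eLpNorm (fun t => g (x - t)) p ν :=
          eLpNorm_le_eLpNorm_of_exponent_le hp
            ((hg.comp_quasiMeasurePreserving
              (quasiMeasurePreserving_sub_left volume x)).mono_ac hac)
        rw [eLpNorm_one_eq_lintegral_enorm, eLpNorm_eq_lintegral_rpow_enorm_toReal hp0 hp', hν,
          lintegral_withDensity_eq_lintegral_mul₀ hρm.aemeasurable (hmeas1 x),
          lintegral_withDensity_eq_lintegral_mul₀ hρm.aemeasurable ((hmeas1 x).pow_const _)] at h1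
        have h2 := ENNReal.rpow_le_rpow ((enorm_mollify_le ρ g x).trans h1) hpr0.le
        rwa [← ENNReal.rpow_mul, one_div, inv_mul_cancel₀ hpr0.ne', ENNReal.rpow_one] at h2
    _ = ∫⁻ t, ∫⁻ x, ENNReal.ofReal (ρ.normed volume t) * ‖g (x - t)‖ₑ ^ p.toReal := by
        apply lintegral_lintegral_swap
        exact (hρm.comp measurable_snd).aemeasurable.mul (hmeas2.pow_const _)
    _ = ∫⁻ t, ENNReal.ofReal (ρ.normed volume t) * ∫⁻ x, ‖g x‖ₑ ^ p.toReal := by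
        refine lintegral_congr fun t => ?_
        rw [lintegral_const_mul' _ _ ENNReal.ofReal_ne_top,
          lintegral_sub_right_eq_self (fun x => ‖g x‖ₑ ^ p.toReal) t]
    _ = ∫⁻ x, ‖g x‖ₑ ^ p.toReal := by
        rw [lintegral_mul_const _ hρm, lintegral_ofReal_normed, one_mul]

theorem mollify_sub (ρ : ContDiffBump (0 : EuclideanSpace ℝ (Fin n)))
    {g h : EuclideanSpace ℝ (Fin n) → F} (hg : LocallyIntegrable g) (hh : LocallyIntegrable h) :
    mollify ρ (g - h) = mollify ρ g - mollify ρ h := by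
  funext x
  rw [Pi.sub_apply, mollify_apply, mollify_apply, mollify_apply]
  refine Eq.trans ?_
    (integral_sub (convolutionExists_mollify ρ hg x) (convolutionExists_mollify ρ hh x))
  simp only [Pi.sub_apply, smul_sub]

theorem norm_mollify_le (ρ : ContDiffBump (0 : EuclideanSpace ℝ (Fin n)))
    {g : EuclideanSpace ℝ (Fin n) → F} {k : ℝ} (hk : ∀ᵐ x, ‖g x‖ ≤ k)
    (x : EuclideanSpace ℝ (Fin n)) : ‖mollify ρ g x‖ ≤ k := by
  rw [mollify_apply]
  have h1 : ∀ᵐ t, ‖g (x - t)‖ ≤ k :=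
    (quasiMeasurePreserving_sub_left volume x).ae hk
  have h2 : ∫ t, ρ.normed volume t * k = k := by
    rw [integral_mul_const, ρ.integral_normed, one_mul]
  rw [← h2]
  refine norm_integral_le_of_norm_le (ρ.integrable_normed.mul_const k) ?_
  filter_upwards [h1] with t ht
  rw [norm_smul, Real.norm_of_nonneg (ρ.nonneg_normed t)]
  exact mul_le_mul_of_nonneg_left ht (ρ.nonneg_normed t)

/-- Uniform continuity makes the difference uniformly small. For radius below 1 it is supported in
the closed 1-thickening of the support of h, a compact set of finite measure independent of ρ. -/
theorem exists_eLpNorm_mollify_sub_le_of_continuous [CompleteSpace F]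
    {h : EuclideanSpace ℝ (Fin n) → F}
    (hh : Continuous h) (hs : HasCompactSupport h) {p : ℝ≥0∞} {ε : ℝ≥0∞} (hε : ε ≠ 0) :
    ∃ δ > 0, ∀ ρ : ContDiffBump (0 : EuclideanSpace ℝ (Fin n)), ρ.rOut < δ →
      eLpNorm (mollify ρ h - h) p volume ≤ ε := by
  set K := Metric.cthickening 1 (tsupport h) with hK
  have hKc : IsCompact K := hs.isCompact.cthickening
  have hKm : volume K ≠ ⊤ := hKc.measure_lt_top.ne
  have hexp : 0 ≤ 1 / p.toReal := by positivity
  have hM : volume K ^ (1 / p.toReal) ≠ ⊤ := ENNReal.rpow_ne_top_of_nonneg hexp hKm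
  obtain ⟨η, hη0, hη⟩ : ∃ η : ℝ, 0 < η ∧ volume K ^ (1 / p.toReal) * ENNReal.ofReal η ≤ ε := by
    have : Tendsto (fun η : ℝ => volume K ^ (1 / p.toReal) * ENNReal.ofReal η) (𝓝[>] 0) (𝓝 0) := by
      have h1 : Tendsto (fun η : ℝ => ENNReal.ofReal η) (𝓝[>] 0) (𝓝 0) := by
        have := (ENNReal.continuous_ofReal.tendsto 0).mono_left
          (nhdsWithin_le_nhds (s := Ioi (0 : ℝ)))
        simpa using this
      simpa using ENNReal.Tendsto.const_mul h1 (Or.inr hM)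
    have h2 := (this.eventually (ge_mem_nhds (pos_iff_ne_zero.2 hε))).and self_mem_nhdsWithin
    obtain ⟨η, h3, h4⟩ := h2.exists
    exact ⟨η, h4, h3⟩
  have hu := hs.uniformContinuous_of_continuous hh
  obtain ⟨δ, hδ, hδ'⟩ := Metric.uniformContinuous_iff.1 hu η hη0
  refine ⟨min δ 1, lt_min hδ one_pos, fun ρ hρ => ?_⟩
  have hb : ∀ x, ‖(mollify ρ h - h) x‖ ≤ η := by
    intro x
    rw [Pi.sub_apply, ← dist_eq_norm]
    refine ρ.dist_normed_convolution_le hh.aestronglyMeasurable fun y hy => ?_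
    exact (hδ' ((Metric.mem_ball.1 hy).trans (hρ.trans_le (min_le_left _ _)))).le
  have hsupp : ∀ x, x ∉ K → (mollify ρ h - h) x = 0 := by
    intro x hx
    have h0 : ∀ y, dist y x < 1 → h y = 0 := by
      intro y hy
      by_contra hne
      exact hx (Metric.mem_cthickening_of_dist_le x y 1 _ (subset_tsupport _ hne)
        (by rw [dist_comm]; exact hy.le))
    have h1 : mollify ρ h x = h x := by
      refine ρ.normed_convolution_eq_right fun y hy => ?_
      rw [h0 y ((Metric.mem_ball.1 hy).trans (hρ.trans_le (min_le_right _ _))),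
        h0 x (by simp)]
    rw [Pi.sub_apply, h1, sub_self]
  have h3 : mollify ρ h - h = K.indicator (mollify ρ h - h) := by
    rw [eq_comm, Set.indicator_eq_self]
    intro x hx
    by_contra hne
    exact hx (hsupp x hne)
  rw [h3, eLpNorm_indicator_eq_eLpNorm_restrict hKc.measurableSet]
  refine (eLpNorm_le_of_ae_bound (Eventually.of_forall hb)).trans ?_
  rw [Measure.restrict_apply_univ, ← one_div]
  exact hη

/-- Compactly supported continuous functions are dense in L^p and mollification is a contraction
there, so the continuous case suffices, with three errors of ε/3. -/
theorem exists_eLpNorm_mollify_sub_le [CompleteSpace F] {g : EuclideanSpace ℝ (Fin n) → F} {p : ℝ≥0∞}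
    (hp : 1 ≤ p) (hp' : p ≠ ⊤) (hg : MemLp g p volume) {ε : ℝ≥0∞} (hε : ε ≠ 0) :
    ∃ δ > 0, ∀ ρ : ContDiffBump (0 : EuclideanSpace ℝ (Fin n)), ρ.rOut < δ →
      eLpNorm (mollify ρ g - g) p volume ≤ ε := by
  have hε3 : ε / 3 ≠ 0 := (ENNReal.div_pos hε (by norm_num)).ne'
  obtain ⟨h, hs, hgh, hc, hm⟩ := hg.exists_hasCompactSupport_eLpNorm_sub_le hp' hε3
  obtain ⟨δ, hδ, hδ'⟩ := exists_eLpNorm_mollify_sub_le_of_continuous hc hs (p := p) hε3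
  refine ⟨δ, hδ, fun ρ hρ => ?_⟩
  have hgl := hg.locallyIntegrable hp
  have hhl := hm.locallyIntegrable hp
  have e : mollify ρ g - g = mollify ρ (g - h) + (mollify ρ h - h) + (h - g) := by
    rw [mollify_sub ρ hgl hhl]; abel
  have m1 : AEStronglyMeasurable (mollify ρ (g - h)) volume :=
    (contDiff_mollify ρ (hgl.sub hhl)).continuous.aestronglyMeasurable
  have m2 : AEStronglyMeasurable (mollify ρ h - h) volume :=
    (contDiff_mollify ρ hhl).continuous.aestronglyMeasurable.sub hc.aestronglyMeasurable
  have m3 := hm.1.sub hg.1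
  rw [e]
  refine (eLpNorm_add_le (m1.add m2) m3 hp).trans ?_
  refine (add_le_add_left (eLpNorm_add_le m1 m2 hp) _).trans ?_
  have h1 := (eLpNorm_mollify_le ρ (hg.1.sub hm.1) hp hp').trans hgh
  have h2 := hδ' ρ hρ
  have h3 : eLpNorm (h - g) p volume ≤ ε / 3 := by
    rw [eLpNorm_sub_comm]; exact hgh
  calc _ ≤ ε / 3 + ε / 3 + ε / 3 := by gcongr
    _ = ε := ENNReal.add_thirds ε

/-- The kernel y ↦ ρ(x - y) is a test function on Ω as soon as the closed ball about x lies in Ω,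
and its y-derivative is minus the derivative of ρ at x - y. The identity is then the definition of
the weak gradient. It can fail near ∂Ω, since the extension by zero need not be weakly
differentiable there. -/
theorem gradient_mollify_of_isWeakGradient {Ω : Set (EuclideanSpace ℝ (Fin n))} (hΩ : IsOpen Ω)
    {w : EuclideanSpace ℝ (Fin n) → ℝ}
    {Dw : EuclideanSpace ℝ (Fin n) → EuclideanSpace ℝ (Fin n)} (hw : IsWeakGradient Ω w Dw)
    (hwl : LocallyIntegrable (Ω.indicator w)) (hDwl : LocallyIntegrable (Ω.indicator Dw))
    (ρ : ContDiffBump (0 : EuclideanSpace ℝ (Fin n))) {x : EuclideanSpace ℝ (Fin n)}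
    (hx : Metric.closedBall x ρ.rOut ⊆ Ω) :
    gradient (mollify ρ (Ω.indicator w)) x = mollify ρ (Ω.indicator Dw) x := by
  have hd := ρ.hasCompactSupport_normed.hasFDerivAt_convolution_left (lsmul ℝ ℝ)
    (ρ.contDiff_normed (μ := volume)) hwl x
  refine ext_inner_right ℝ fun v => ?_
  have hψ : IsTestFunction Ω fun y => ρ.normed volume (x - y) := by
    refine ⟨ρ.contDiff_normed.comp (contDiff_const.sub contDiff_id),
      ρ.hasCompactSupport_normed.comp_homeomorph (Homeomorph.subLeft x), ?_⟩
    refine Subset.trans ?_ hx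
    refine closure_minimal (fun y hy => ?_) Metric.isClosed_closedBall
    have h1 : x - y ∈ Function.support (ρ.normed volume) := hy
    rw [ρ.support_normed_eq, mem_ball_zero_iff] at h1
    rw [Metric.mem_closedBall, dist_comm, dist_eq_norm]
    exact h1.le
  have hfd : ∀ y, fderiv ℝ (fun y => ρ.normed volume (x - y)) y v
      = - fderiv ℝ (ρ.normed volume) (x - y) v := by
    intro y
    have h1 : HasFDerivAt (ρ.normed volume) (fderiv ℝ (ρ.normed volume) (x - y)) (x - y) :=
      ((ρ.contDiff_normed (n := 1)).differentiable (by norm_num) _).hasFDerivAt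
    have h2 := h1.comp y ((hasFDerivAt_const x y).sub (hasFDerivAt_id y))
    have h3 := h2.fderiv
    simp only [Function.comp_def] at h3
    erw [h3]
    simp
  have key := hw.integral_by_parts _ hψ v
  have e1 : inner ℝ (gradient (mollify ρ (Ω.indicator w)) x) v
      = ∫ y in Ω, fderiv ℝ (ρ.normed volume) (x - y) v * w y := by
    rw [gradient, InnerProductSpace.toDual_symm_apply]
    have h1 : fderiv ℝ (mollify ρ (Ω.indicator w)) x = _ := hd.fderiv
    have hex : ConvolutionExists (fderiv ℝ (ρ.normed volume)) (Ω.indicator w)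
        ((lsmul ℝ ℝ : ℝ →L[ℝ] ℝ →L[ℝ] ℝ).precompL (EuclideanSpace ℝ (Fin n))) volume :=
      (ρ.hasCompactSupport_normed.fderiv ℝ).convolutionExists_left _
        ((ρ.contDiff_normed (n := 1)).continuous_fderiv (by norm_num)) hwl
    rw [h1, convolution_eq_swap, ContinuousLinearMap.integral_apply (hex x).integrable_swap,
      ← integral_indicator hΩ.measurableSet]
    refine integral_congr_ae (Eventually.of_forall fun y => ?_)
    by_cases hy : y ∈ Ω <;> simp [hy]
  have e2 : inner ℝ (mollify ρ (Ω.indicator Dw) x) v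
      = ∫ y in Ω, inner ℝ (Dw y) v * ρ.normed volume (x - y) := by
    rw [mollify_apply', real_inner_comm, ← integral_inner, ← integral_indicator hΩ.measurableSet]
    · refine integral_congr_ae (Eventually.of_forall fun y => ?_)
      by_cases hy : y ∈ Ω <;> simp [hy, inner_smul_right, real_inner_comm, mul_comm]
    · exact (convolutionExists_mollify ρ hDwl x).integrable_swap
  rw [e1, e2]
  have := congrArg Neg.neg key
  rw [neg_neg, ← integral_neg] at this
  rw [← this]
  refine integral_congr_ae (Eventually.of_forall fun y => ?_)
  simp only [hfd]
  ring

/-- Interior approximation of a bounded Sobolev function by smooth functions with the same bound. -/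
theorem MemW1.exists_smooth_approx {Ω : Set (EuclideanSpace ℝ (Fin n))} (hΩ : IsOpen Ω)
    {q : ℝ≥0∞} (hq : 1 ≤ q) (hq' : q ≠ ⊤) {w : EuclideanSpace ℝ (Fin n) → ℝ}
    {Dw : EuclideanSpace ℝ (Fin n) → EuclideanSpace ℝ (Fin n)} (hw : MemW1 Ω q w Dw) {k : ℝ}
    (hk0 : 0 ≤ k) (hk : ∀ᵐ x ∂(volume.restrict Ω), |w x| ≤ k)
    {K : Set (EuclideanSpace ℝ (Fin n))} (hK : IsCompact K) (hKΩ : K ⊆ Ω) {ε : ℝ≥0∞}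
    (hε : ε ≠ 0) :
    ∃ g : EuclideanSpace ℝ (Fin n) → ℝ, ContDiff ℝ ∞ g ∧ (∀ x, |g x| ≤ k) ∧
      eLpNorm (fun x => g x - w x) q (volume.restrict K) ≤ ε ∧
      eLpNorm (fun x => gradient g x - Dw x) q (volume.restrict K) ≤ ε := by
  have hΩm := hΩ.measurableSet
  have m1 : MemLp (Ω.indicator w) q volume := (memLp_indicator_iff_restrict hΩm).2 hw.memLp
  have m2 : MemLp (Ω.indicator Dw) q volume := (memLp_indicator_iff_restrict hΩm).2 hw.memLp_grad
  obtain ⟨δ₁, hδ₁, h₁⟩ := exists_eLpNorm_mollify_sub_le hq hq' m1 hε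
  obtain ⟨δ₂, hδ₂, h₂⟩ := exists_eLpNorm_mollify_sub_le hq hq' m2 hε
  obtain ⟨δ₃, hδ₃, h₃⟩ := hK.exists_cthickening_subset_open hΩ hKΩ
  -- Staying below δ₃ keeps every ball centred in K inside Ω, where the gradient commutes with
  -- mollification. Only the outer radius of the bump matters; the inner radius r / 2 is arbitrary.
  set r := min (min δ₁ δ₂) δ₃ / 2 with hr
  have hr0 : 0 < r := by positivity
  have hrδ : r < min (min δ₁ δ₂) δ₃ := half_lt_self (by positivity)
  let ρ : ContDiffBump (0 : EuclideanSpace ℝ (Fin n)) := ⟨r / 2, r, by positivity, by linarith⟩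
  have hρ : ρ.rOut = r := rfl
  have hl1 := m1.locallyIntegrable hq
  have hl2 := m2.locallyIntegrable hq
  refine ⟨mollify ρ (Ω.indicator w), contDiff_mollify ρ hl1, ?_, ?_, ?_⟩
  · refine norm_mollify_le (F := ℝ) ρ ?_
    filter_upwards [(ae_restrict_iff' hΩm).1 hk] with x hx
    by_cases hxΩ : x ∈ Ω
    · simpa [hxΩ] using hx hxΩ
    · simpa [hxΩ] using hk0
  · refine le_trans ?_ (h₁ ρ (hrδ.trans_le ((min_le_left _ _).trans (min_le_left _ _))))
    refine le_trans (le_of_eq (eLpNorm_congr_ae ?_)) (eLpNorm_restrict_le _ _ _ K)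
    filter_upwards [ae_restrict_mem hK.measurableSet] with x hx
    simp [hKΩ hx]
  · refine le_trans ?_ (h₂ ρ (hrδ.trans_le ((min_le_left _ _).trans (min_le_right _ _))))
    refine le_trans (le_of_eq (eLpNorm_congr_ae ?_)) (eLpNorm_restrict_le _ _ _ K)
    filter_upwards [ae_restrict_mem hK.measurableSet] with x hx
    rw [gradient_mollify_of_isWeakGradient hΩ hw.isWeakGradient hl1 hl2 ρ]
    · simp [hKΩ hx]
    · refine Subset.trans (Metric.closedBall_subset_cthickening hx _) (Subset.trans ?_ h₃)
      exact Metric.cthickening_mono (hrδ.le.trans (min_le_right _ _)) _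

end Mollification

/-! ### The space W₀^{1,q}: closedness and the Sobolev inequality. -/

section ZeroBoundaryValues

variable {n : ℕ}

theorem norm_gradient_eq (φ : EuclideanSpace ℝ (Fin n) → ℝ) (x : EuclideanSpace ℝ (Fin n)) :
    ‖gradient φ x‖ = ‖fderiv ℝ φ x‖ := by
  rw [gradient, LinearIsometryEquiv.norm_map]

theorem inner_gradient_left (φ : EuclideanSpace ℝ (Fin n) → ℝ) (x v : EuclideanSpace ℝ (Fin n)) :
    inner ℝ (gradient φ x) v = fderiv ℝ φ x v := by
  rw [gradient, InnerProductSpace.toDual_symm_apply]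

theorem continuous_gradient {φ : EuclideanSpace ℝ (Fin n) → ℝ} (hφ : ContDiff ℝ ∞ φ) :
    Continuous (gradient φ) := by
  unfold gradient
  exact (LinearIsometryEquiv.continuous _).comp (hφ.continuous_fderiv (by norm_num))

theorem gradient_eq_zero_of_notMem_tsupport {φ : EuclideanSpace ℝ (Fin n) → ℝ}
    {x : EuclideanSpace ℝ (Fin n)} (hx : x ∉ tsupport φ) : gradient φ x = 0 := by
  have : fderiv ℝ φ x = 0 := by
    by_contra h
    exact hx (support_fderiv_subset ℝ h)
  rw [gradient, this, map_zero]

namespace IsTestFunction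

variable {Ω : Set (EuclideanSpace ℝ (Fin n))} {φ : EuclideanSpace ℝ (Fin n) → ℝ}

theorem memLp (hφ : IsTestFunction Ω φ) (q : ℝ≥0∞) : MemLp φ q volume :=
  hφ.smooth.continuous.memLp_of_hasCompactSupport hφ.compact_support

theorem hasCompactSupport_gradient (hφ : IsTestFunction Ω φ) : HasCompactSupport (gradient φ) :=
  HasCompactSupport.intro hφ.compact_support fun _ hx => gradient_eq_zero_of_notMem_tsupport hx

theorem memLp_gradient (hφ : IsTestFunction Ω φ) (q : ℝ≥0∞) : MemLp (gradient φ) q volume :=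
  (continuous_gradient hφ.smooth).memLp_of_hasCompactSupport hφ.hasCompactSupport_gradient

theorem eLpNorm_restrict (hφ : IsTestFunction Ω φ) (q : ℝ≥0∞) (hΩ : MeasurableSet Ω) :
    eLpNorm φ q (volume.restrict Ω) = eLpNorm φ q volume := by
  rw [← eLpNorm_indicator_eq_eLpNorm_restrict hΩ, Set.indicator_eq_self.2
    ((subset_tsupport φ).trans hφ.support_subset)]

theorem integral_by_parts (hφ : IsTestFunction Ω φ) {ψ : EuclideanSpace ℝ (Fin n) → ℝ}
    (hψ : IsTestFunction Ω ψ) (v : EuclideanSpace ℝ (Fin n)) :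
    ∫ x in Ω, φ x * fderiv ℝ ψ x v = - ∫ x in Ω, inner ℝ (gradient φ x) v * ψ x := by
  have hs : ∀ x, x ∉ Ω → ψ x = 0 := fun x hx =>
    image_eq_zero_of_notMem_tsupport fun h => hx (hψ.support_subset h)
  have hs' : ∀ x, x ∉ Ω → φ x = 0 := fun x hx =>
    image_eq_zero_of_notMem_tsupport fun h => hx (hφ.support_subset h)
  rw [setIntegral_eq_integral_of_forall_compl_eq_zero fun x hx => by rw [hs' x hx, zero_mul],
    setIntegral_eq_integral_of_forall_compl_eq_zero fun x hx => by rw [hs x hx, mul_zero]]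
  simp only [inner_gradient_left]
  have c1 : Continuous fun x => fderiv ℝ φ x v :=
    (hφ.smooth.continuous_fderiv (by norm_num)).clm_apply continuous_const
  have c2 : Continuous fun x => fderiv ℝ ψ x v :=
    (hψ.smooth.continuous_fderiv (by norm_num)).clm_apply continuous_const
  refine integral_mul_fderiv_eq_neg_fderiv_mul_of_integrable ?_ ?_ ?_ ?_ ?_
  · exact (c1.mul hψ.smooth.continuous).integrable_of_hasCompactSupport
      hψ.compact_support.mul_left
  · exact (hφ.smooth.continuous.mul c2).integrable_of_hasCompactSupport
      hφ.compact_support.mul_right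
  · exact (hφ.smooth.continuous.mul hψ.smooth.continuous).integrable_of_hasCompactSupport
      hφ.compact_support.mul_right
  · exact fun x _ => hφ.smooth.differentiable (by norm_num) x
  · exact fun x _ => hψ.smooth.differentiable (by norm_num) x

end IsTestFunction

theorem tendsto_eLpNorm_of_exponent_le {X F : Type*} [MeasurableSpace X] [NormedAddCommGroup F]
    {μ : Measure X} [IsFiniteMeasure μ] {q r : ℝ≥0∞} (hqr : q ≤ r) {g : ℕ → X → F}
    (hg : ∀ k, AEStronglyMeasurable (g k) μ)
    (h : Tendsto (fun k => eLpNorm (g k) r μ) atTop (𝓝 0)) :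
    Tendsto (fun k => eLpNorm (g k) q μ) atTop (𝓝 0) := by
  by_cases hq0 : q = 0
  · simp [hq0]
  by_cases hμ : μ = 0
  · simp [hμ]
  have hexp : 0 ≤ 1 / q.toReal - 1 / r.toReal := by
    by_cases hr : r = ⊤
    · simp [hr]
    · have hq : q ≠ ⊤ := ne_top_of_le_ne_top hr hqr
      rw [sub_nonneg]
      exact one_div_le_one_div_of_le (ENNReal.toReal_pos hq0 hq) (ENNReal.toReal_mono hr hqr)
  have hc : μ Set.univ ^ (1 / q.toReal - 1 / r.toReal) ≠ ⊤ :=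
    ENNReal.rpow_ne_top_of_nonneg hexp (measure_ne_top _ _)
  have h0 := ENNReal.Tendsto.mul_const h (Or.inr hc)
  rw [zero_mul] at h0
  exact tendsto_of_tendsto_of_tendsto_of_le_of_le tendsto_const_nhds h0 (fun _ => zero_le)
    fun k => eLpNorm_le_eLpNorm_mul_rpow_measure_univ hqr (hg k)

theorem tendsto_integral_mul_of_tendsto_eLpNorm {X : Type*} [MeasurableSpace X] {μ : Measure X}
    {g : ℕ → X → ℝ} {g₀ h : X → ℝ} (hg : ∀ k, Integrable (g k) μ) (hg₀ : Integrable g₀ μ)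
    (hh : AEStronglyMeasurable h μ) {C : ℝ} (hC : ∀ x, ‖h x‖ ≤ C)
    (ht : Tendsto (fun k => eLpNorm (fun x => g k x - g₀ x) 1 μ) atTop (𝓝 0)) :
    Tendsto (fun k => ∫ x, g k x * h x ∂μ) atTop (𝓝 (∫ x, g₀ x * h x ∂μ)) := by
  have hb : ∀ᵐ x ∂μ, ‖h x‖ ≤ C := Eventually.of_forall hC
  refine tendsto_integral_of_L1' _ (hg₀.mul_bdd hh hb).1
    (Eventually.of_forall fun k => (hg k).mul_bdd hh hb) ?_
  have h0 := ENNReal.Tendsto.const_mul ht (a := ENNReal.ofReal C) (Or.inr ENNReal.ofReal_ne_top)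
  rw [mul_zero] at h0
  refine tendsto_of_tendsto_of_tendsto_of_le_of_le tendsto_const_nhds h0 (fun _ => zero_le)
    fun k => ?_
  refine eLpNorm_le_mul_eLpNorm_of_ae_le_mul (Eventually.of_forall fun x => ?_) 1
  rw [Pi.sub_apply, ← sub_mul, norm_mul, mul_comm]
  exact mul_le_mul_of_nonneg_right (hC x) (norm_nonneg _)

/-- Limits of test functions in `W^{1,q}(Ω)` lie in `W₀^{1,q}(Ω)`. -/
theorem memW10_of_forall_exists {Ω : Set (EuclideanSpace ℝ (Fin n))}
    [IsFiniteMeasure (volume.restrict Ω)] {q : ℝ≥0∞} (hq : 1 ≤ q)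
    {w : EuclideanSpace ℝ (Fin n) → ℝ}
    {Dw : EuclideanSpace ℝ (Fin n) → EuclideanSpace ℝ (Fin n)}
    (hwm : AEStronglyMeasurable w (volume.restrict Ω))
    (hDwm : AEStronglyMeasurable Dw (volume.restrict Ω))
    (h : ∀ ε : ℝ≥0∞, ε ≠ 0 → ∃ φ, IsTestFunction Ω φ ∧
      eLpNorm (fun x => w x - φ x) q (volume.restrict Ω) ≤ ε ∧
      eLpNorm (fun x => Dw x - gradient φ x) q (volume.restrict Ω) ≤ ε) :
    MemW10 Ω q w Dw := by
  have hpos : ∀ k : ℕ, ((k : ℝ≥0∞) + 1)⁻¹ ≠ 0 := fun k => by simp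
  choose φ hφ h1 h2 using fun k : ℕ => h _ (hpos k)
  have ht0 : Tendsto (fun k : ℕ => ((k : ℝ≥0∞) + 1)⁻¹) atTop (𝓝 0) := by
    have := (tendsto_add_atTop_iff_nat 1).2 ENNReal.tendsto_inv_nat_nhds_zero
    simpa using this
  have t1 : Tendsto (fun k => eLpNorm (fun x => w x - φ k x) q (volume.restrict Ω)) atTop (𝓝 0) :=
    tendsto_of_tendsto_of_tendsto_of_le_of_le tendsto_const_nhds ht0 (fun _ => zero_le) h1
  have t2 : Tendsto (fun k => eLpNorm (fun x => Dw x - gradient (φ k) x) q (volume.restrict Ω))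
      atTop (𝓝 0) :=
    tendsto_of_tendsto_of_tendsto_of_le_of_le tendsto_const_nhds ht0 (fun _ => zero_le) h2
  have a1 : ∀ k, MemLp (φ k) q (volume.restrict Ω) := fun k => ((hφ k).memLp q).restrict Ω
  have a2 : ∀ k, MemLp (gradient (φ k)) q (volume.restrict Ω) :=
    fun k => ((hφ k).memLp_gradient q).restrict Ω
  have hw : MemLp w q (volume.restrict Ω) := by
    have h3 : MemLp (fun x => w x - φ 0 x) q (volume.restrict Ω) :=
      ⟨hwm.sub (a1 0).1, (h1 0).trans_lt (by simp)⟩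
    exact (memLp_congr_ae (Eventually.of_forall fun x => by simp)).1 (h3.add (a1 0))
  have hDw : MemLp Dw q (volume.restrict Ω) := by
    have h3 : MemLp (fun x => Dw x - gradient (φ 0) x) q (volume.restrict Ω) :=
      ⟨hDwm.sub (a2 0).1, (h2 0).trans_lt (by simp)⟩
    exact (memLp_congr_ae (Eventually.of_forall fun x => by simp)).1 (h3.add (a2 0))
  refine ⟨⟨⟨?_, ?_, fun ψ hψ v => ?_⟩, hw, hDw⟩, φ, hφ, t1, t2⟩
  · exact IntegrableOn.locallyIntegrableOn (hw.integrable hq)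
  · exact IntegrableOn.locallyIntegrableOn (hDw.integrable hq)
  · have c2 : Continuous fun x => fderiv ℝ ψ x v :=
      (hψ.smooth.continuous_fderiv (by norm_num)).clm_apply continuous_const
    have hs2 : HasCompactSupport fun x => fderiv ℝ ψ x v := hψ.compact_support.fderiv_apply ℝ v
    obtain ⟨C1, hC1⟩ := hs2.exists_bound_of_continuous c2
    obtain ⟨C2, hC2⟩ := hψ.compact_support.exists_bound_of_continuous hψ.smooth.continuous
    -- Integration by parts passes to the limit from the test functions φ k: on a finite measure L^q
    -- convergence gives L¹ convergence, and ψ and its derivatives are bounded.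
    have l1 := tendsto_integral_mul_of_tendsto_eLpNorm (fun k => (a1 k).integrable hq)
      (hw.integrable hq) c2.aestronglyMeasurable hC1
      ((tendsto_eLpNorm_of_exponent_le hq (fun k => hwm.sub (a1 k).1) t1).congr
        fun k => by rw [← Pi.sub_def, eLpNorm_sub_comm])
    have i2 : ∀ k, Integrable (fun x => inner ℝ (gradient (φ k) x) v) (volume.restrict Ω) :=
      fun k => ((a2 k).integrable hq).inner_const v
    have l2 := tendsto_integral_mul_of_tendsto_eLpNorm (g₀ := fun x => inner ℝ (Dw x) v) i2
      ((hDw.integrable hq).inner_const v)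
      hψ.smooth.continuous.aestronglyMeasurable hC2 (by
        have h0 := ENNReal.Tendsto.const_mul
          (tendsto_eLpNorm_of_exponent_le hq (fun k => hDwm.sub (a2 k).1) t2)
          (a := ENNReal.ofReal ‖v‖) (Or.inr ENNReal.ofReal_ne_top)
        rw [mul_zero] at h0
        refine tendsto_of_tendsto_of_tendsto_of_le_of_le tendsto_const_nhds h0 (fun _ => zero_le)
          fun k => ?_
        refine eLpNorm_le_mul_eLpNorm_of_ae_le_mul (Eventually.of_forall fun x => ?_) 1
        rw [← inner_sub_left, mul_comm, Pi.sub_apply, norm_sub_rev (Dw x)]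
        exact norm_inner_le_norm _ _)
    refine tendsto_nhds_unique l1 (l2.neg.congr fun k => ?_)
    exact ((hφ k).integral_by_parts hψ v).symm

/-- `W₀^{1,q}(Ω)` is closed. -/
theorem memW10_of_tendsto {Ω : Set (EuclideanSpace ℝ (Fin n))}
    [IsFiniteMeasure (volume.restrict Ω)] {q : ℝ≥0∞} (hq : 1 ≤ q)
    {w : EuclideanSpace ℝ (Fin n) → ℝ}
    {Dw : EuclideanSpace ℝ (Fin n) → EuclideanSpace ℝ (Fin n)}
    (hwm : AEStronglyMeasurable w (volume.restrict Ω))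
    (hDwm : AEStronglyMeasurable Dw (volume.restrict Ω))
    {w' : ℕ → EuclideanSpace ℝ (Fin n) → ℝ}
    {Dw' : ℕ → EuclideanSpace ℝ (Fin n) → EuclideanSpace ℝ (Fin n)}
    (h : ∀ j, MemW10 Ω q (w' j) (Dw' j))
    (h1 : Tendsto (fun j => eLpNorm (fun x => w x - w' j x) q (volume.restrict Ω)) atTop (𝓝 0))
    (h2 : Tendsto (fun j => eLpNorm (fun x => Dw x - Dw' j x) q (volume.restrict Ω))
      atTop (𝓝 0)) :
    MemW10 Ω q w Dw := by
  refine memW10_of_forall_exists hq hwm hDwm fun ε hε => ?_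
  have hε2 : 0 < ε / 2 := ENNReal.half_pos hε
  obtain ⟨j, hj1, hj2⟩ := ((h1.eventually (ge_mem_nhds hε2)).and
    (h2.eventually (ge_mem_nhds hε2))).exists
  obtain ⟨φ, hφ, t1, t2⟩ := (h j).approx
  obtain ⟨k, hk1, hk2⟩ := ((t1.eventually (ge_mem_nhds hε2)).and
    (t2.eventually (ge_mem_nhds hε2))).exists
  have m1 := (h j).memW1.memLp.1
  have m2 := (h j).memW1.memLp_grad.1
  have a1 := (((hφ k).memLp q).restrict Ω).1
  have a2 := (((hφ k).memLp_gradient q).restrict Ω).1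
  refine ⟨φ k, hφ k, ?_, ?_⟩
  · calc _ ≤ eLpNorm ((fun x => w x - w' j x) + fun x => w' j x - φ k x) q (volume.restrict Ω) :=
        le_of_eq (by congr 1; funext x; simp)
      _ ≤ _ := eLpNorm_add_le (hwm.sub m1) (m1.sub a1) hq
      _ ≤ ε / 2 + ε / 2 := add_le_add hj1 hk1
      _ = ε := ENNReal.add_halves ε
  · calc _ ≤ eLpNorm ((fun x => Dw x - Dw' j x) + fun x => Dw' j x - gradient (φ k) x) q
          (volume.restrict Ω) := le_of_eq (by congr 1; funext x; simp)
      _ ≤ _ := eLpNorm_add_le (hDwm.sub m2) (m2.sub a2) hq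
      _ ≤ ε / 2 + ε / 2 := add_le_add hj2 hk2
      _ = ε := ENNReal.add_halves ε

/-- The Gagliardo–Nirenberg–Sobolev inequality in `W₀^{1,q}(Ω)`. -/
theorem MemW10.exists_eLpNorm_le (hn : 0 < n) {r Q : ℝ} (hr : 1 ≤ r) (hQ : 0 < Q)
    (hrQ : Q⁻¹ = r⁻¹ - (n : ℝ)⁻¹) :
    ∃ C : ℝ, 0 ≤ C ∧ ∀ {Ω : Set (EuclideanSpace ℝ (Fin n))} (_ : MeasurableSet Ω)
      [IsFiniteMeasure (volume.restrict Ω)] {q : ℝ≥0∞} (_ : ENNReal.ofReal r ≤ q)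
      {w : EuclideanSpace ℝ (Fin n) → ℝ}
      {Dw : EuclideanSpace ℝ (Fin n) → EuclideanSpace ℝ (Fin n)} (_ : MemW10 Ω q w Dw),
      eLpNorm w (ENNReal.ofReal Q) (volume.restrict Ω)
        ≤ ENNReal.ofReal C * eLpNorm Dw (ENNReal.ofReal r) (volume.restrict Ω) := by
  refine ⟨SNormLESNormFDerivOfEqConst ℝ (volume : Measure (EuclideanSpace ℝ (Fin n))) r.toNNReal,
    NNReal.coe_nonneg _, ?_⟩
  intro Ω hΩ _ q hq w Dw hw
  rw [ENNReal.ofReal_coe_nnreal]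
  set C := SNormLESNormFDerivOfEqConst ℝ (volume : Measure (EuclideanSpace ℝ (Fin n))) r.toNNReal
  have hr1 : 1 ≤ ENNReal.ofReal r := by simpa using hr
  obtain ⟨φ, hφ, t1, t2⟩ := hw.approx
  have a1 : ∀ k, MemLp (φ k) q (volume.restrict Ω) := fun k => ((hφ k).memLp q).restrict Ω
  have a2 : ∀ k, MemLp (gradient (φ k)) q (volume.restrict Ω) :=
    fun k => ((hφ k).memLp_gradient q).restrict Ω
  have m1 := hw.memW1.memLp.1
  have m2 := hw.memW1.memLp_grad.1
  have t1' := t1.congr fun k => by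
    rw [← Pi.sub_def, eLpNorm_sub_comm]
  have hq0 : q ≠ 0 := (zero_lt_one.trans_le (hr1.trans hq)).ne'
  -- The approximants converge in L^q, not a priori in L^Q. An almost everywhere convergent
  -- subsequence and Fatou's lemma carry the L^Q bound over to w.
  obtain ⟨ns, hns, hae⟩ :=
    (tendstoInMeasure_of_tendsto_eLpNorm hq0 (fun k => (a1 k).1) m1 t1').exists_seq_tendsto_ae
  have s2 := (tendsto_eLpNorm_of_exponent_le hq (fun k => m2.sub (a2 k).1) t2).comp
    hns.tendsto_atTop
  have key : ∀ k, eLpNorm (φ k) (ENNReal.ofReal Q) (volume.restrict Ω) ≤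
      C * (eLpNorm Dw (ENNReal.ofReal r) (volume.restrict Ω) +
        eLpNorm (fun x => Dw x - gradient (φ k) x) (ENNReal.ofReal r) (volume.restrict Ω)) := by
    intro k
    have g1 : eLpNorm (φ k) (ENNReal.ofReal Q) volume
        ≤ C * eLpNorm (fderiv ℝ (φ k)) (ENNReal.ofReal r) volume :=
      eLpNorm_le_eLpNorm_fderiv_of_eq volume ((hφ k).smooth.of_le (by norm_num))
        (hφ k).compact_support (by simpa using hr) (by simpa using hn) (by
          rw [NNReal.coe_inv, Real.coe_toNNReal _ hQ.le, Real.coe_toNNReal _ (by linarith)]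
          simpa using hrQ)
    rw [(hφ k).eLpNorm_restrict _ hΩ]
    refine g1.trans ?_
    gcongr
    have e1 : eLpNorm (fderiv ℝ (φ k)) (ENNReal.ofReal r) volume
        = eLpNorm (gradient (φ k)) (ENNReal.ofReal r) (volume.restrict Ω) := by
      rw [← eLpNorm_indicator_eq_eLpNorm_restrict hΩ, Set.indicator_eq_self.2]
      · exact eLpNorm_congr_norm_ae (Eventually.of_forall fun x => (norm_gradient_eq _ _).symm)
      · intro x hx
        by_contra hxΩ
        exact hx (gradient_eq_zero_of_notMem_tsupport fun h => hxΩ ((hφ k).support_subset h))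
    rw [e1]
    calc _ = eLpNorm (Dw - fun x => Dw x - gradient (φ k) x) (ENNReal.ofReal r)
          (volume.restrict Ω) := by congr 1; funext x; simp
      _ ≤ _ := eLpNorm_sub_le m2 (m2.sub (a2 k).1) hr1
  refine (Lp.eLpNorm_lim_le_liminf_eLpNorm (fun k => (a1 (ns k)).1) w hae).trans ?_
  have lim : Tendsto (fun k => (C : ℝ≥0∞) * (eLpNorm Dw (ENNReal.ofReal r) (volume.restrict Ω) +
        eLpNorm (fun x => Dw x - gradient (φ (ns k)) x) (ENNReal.ofReal r) (volume.restrict Ω)))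
      atTop (𝓝 (C * eLpNorm Dw (ENNReal.ofReal r) (volume.restrict Ω))) := by
    have h3 := ENNReal.Tendsto.const_mul (a := (C : ℝ≥0∞)) ((tendsto_const_nhds
      (x := eLpNorm Dw (ENNReal.ofReal r) (volume.restrict Ω))).add s2)
      (Or.inr ENNReal.coe_ne_top)
    rw [add_zero] at h3
    exact h3
  calc _ ≤ liminf (fun k => (C : ℝ≥0∞) * (eLpNorm Dw (ENNReal.ofReal r) (volume.restrict Ω) +
        eLpNorm (fun x => Dw x - gradient (φ (ns k)) x) (ENNReal.ofReal r) (volume.restrict Ω)))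
        atTop := liminf_le_liminf (Eventually.of_forall fun k => key (ns k))
    _ = _ := lim.liminf_eq

end ZeroBoundaryValues

/-! ### Truncations above the boundary values belong to W₀^{1,q}. -/

section Truncation

variable {n : ℕ}

/-- Dominated convergence with majorant (B‖G‖)^q. This handles gradients of compositions, where a
bounded scalar converges pointwise and the vector field stays fixed. -/
theorem tendsto_eLpNorm_smul_of_tendsto_zero {X F : Type*} [MeasurableSpace X]
    [NormedAddCommGroup F] [NormedSpace ℝ F] {μ : Measure X} {q : ℝ≥0∞} (hq : 1 ≤ q)
    (hq' : q ≠ ⊤) {G : X → F} (hG : MemLp G q μ) {c : ℕ → X → ℝ}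
    (hc : ∀ j, AEStronglyMeasurable (c j) μ) {B : ℝ} (hB : ∀ j, ∀ᵐ x ∂μ, |c j x| ≤ B)
    (ht : ∀ᵐ x ∂μ, Tendsto (fun j => c j x) atTop (𝓝 0)) :
    Tendsto (fun j => eLpNorm (fun x => c j x • G x) q μ) atTop (𝓝 0) := by
  have hq0 : q ≠ 0 := (zero_lt_one.trans_le hq).ne'
  have hr : 0 < q.toReal := ENNReal.toReal_pos hq0 hq'
  have key : Tendsto (fun j => ∫⁻ x, ‖c j x • G x‖ₑ ^ q.toReal ∂μ) atTop (𝓝 0) := by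
    have h0 : ∫⁻ _, (0 : ℝ≥0∞) ∂μ = 0 := by simp
    rw [← h0]
    refine tendsto_lintegral_of_dominated_convergence'
      (fun x => (ENNReal.ofReal B * ‖G x‖ₑ) ^ q.toReal)
      (fun j => ((hc j).smul hG.1).enorm.pow_const _) (fun j => ?_) ?_ ?_
    · filter_upwards [hB j] with x hx
      rw [enorm_smul]
      gcongr
      rw [Real.enorm_eq_ofReal_abs]
      exact ENNReal.ofReal_le_ofReal hx
    · simp only [ENNReal.mul_rpow_of_nonneg _ _ hr.le]
      rw [lintegral_const_mul' _ _ (ENNReal.rpow_ne_top_of_nonneg hr.le ENNReal.ofReal_ne_top)]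
      exact ENNReal.mul_ne_top (ENNReal.rpow_ne_top_of_nonneg hr.le ENNReal.ofReal_ne_top)
        (lintegral_rpow_enorm_lt_top_of_eLpNorm_lt_top hq0 hq' hG.2).ne
    · filter_upwards [ht] with x hx
      have h1 : Tendsto (fun j => ‖c j x • G x‖ₑ) atTop (𝓝 0) := by
        have := (hx.smul_const (G x)).enorm
        simpa using this
      have h2 := h1.ennrpow_const q.toReal
      rwa [ENNReal.zero_rpow_of_pos hr] at h2
  simp only [eLpNorm_eq_lintegral_rpow_enorm_toReal hq0 hq']
  have h2 := key.ennrpow_const (1 / q.toReal)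
  rwa [ENNReal.zero_rpow_of_pos (by positivity)] at h2

/-- Composition of a function with bounded boundary values and a smooth function that vanishes on
the range of the boundary values. -/
theorem memW10_comp_of_contDiff {Ω : Set (EuclideanSpace ℝ (Fin n))} (hΩ : IsOpen Ω)
    [IsFiniteMeasure (volume.restrict Ω)] {q : ℝ≥0∞} (hq : 1 ≤ q) (hq' : q ≠ ⊤)
    {u u₀ : EuclideanSpace ℝ (Fin n) → ℝ}
    {Du Du₀ : EuclideanSpace ℝ (Fin n) → EuclideanSpace ℝ (Fin n)}
    (hu₀ : MemW1 Ω q u₀ Du₀) (hu : MemW10 Ω q (fun x => u x - u₀ x) (fun x => Du x - Du₀ x))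
    {k : ℝ} (hk0 : 0 ≤ k) (hk : ∀ᵐ x ∂(volume.restrict Ω), |u₀ x| ≤ k)
    {H : ℝ → ℝ} (hH : ContDiff ℝ ∞ H) (hH0 : ∀ t, |t| ≤ k → H t = 0)
    (hH'0 : ∀ t, |t| ≤ k → deriv H t = 0) (hH' : ∀ t, |deriv H t| ≤ 1) :
    MemW10 Ω q (fun x => H (u x)) (fun x => deriv H (u x) • Du x) := by
  have hΩm := hΩ.measurableSet
  have hq0 : q ≠ 0 := (zero_lt_one.trans_le hq).ne'
  set μ := volume.restrict Ω with hμ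
  have um : MemLp u q μ :=
    (memLp_congr_ae (Eventually.of_forall fun x => by simp)).1 (hu.memW1.memLp.add hu₀.memLp)
  have Dum : MemLp Du q μ :=
    (memLp_congr_ae (Eventually.of_forall fun x => by simp)).1
      (hu.memW1.memLp_grad.add hu₀.memLp_grad)
  have hHd : Differentiable ℝ H := hH.differentiable (by norm_num)
  have hH'c : Continuous (deriv H) := hH.continuous_deriv (by norm_num)
  have hLip : ∀ s t, |H s - H t| ≤ |s - t| := by
    intro s t
    have := Convex.norm_image_sub_le_of_norm_deriv_le (f := H) (s := Set.univ) (C := 1)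
      (fun x _ => hHd x) (fun x _ => hH' x) convex_univ (Set.mem_univ t) (Set.mem_univ s)
    simpa using this
  obtain ⟨φ, hφ, t1, t2⟩ := hu.approx
  have hpos : ∀ k : ℕ, ((k : ℝ≥0∞) + 1)⁻¹ ≠ 0 := fun k => by simp
  have ht0 : Tendsto (fun k : ℕ => ((k : ℝ≥0∞) + 1)⁻¹) atTop (𝓝 0) := by
    have := (tendsto_add_atTop_iff_nat 1).2 ENNReal.tendsto_inv_nat_nhds_zero
    simpa using this
  -- Near the support of φ j, the boundary datum is replaced by a smooth g j that still satisfies |g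
  -- j| ≤ k, so that H still vanishes on its values.
  choose g hg gb e1 e2 using fun j => hu₀.exists_smooth_approx hΩ hq hq' hk0 hk
    (hφ j).compact_support.isCompact (hφ j).support_subset (hpos j)
  have hKm : ∀ j, MeasurableSet (tsupport (φ j)) := fun j => (isClosed_tsupport _).measurableSet
  classical
  -- The function z j approximates u and Z j approximates Du. The gluing may jump across the edge of
  -- the support, which is harmless: both pieces take values in [-k, k] there, where H vanishes, so
  -- only H of the smooth piece is used as a test function.
  set z : ℕ → EuclideanSpace ℝ (Fin n) → ℝ := fun j =>
    (tsupport (φ j)).piecewise (fun x => φ j x + g j x) u₀ with hz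
  set Z : ℕ → EuclideanSpace ℝ (Fin n) → EuclideanSpace ℝ (Fin n) := fun j =>
    (tsupport (φ j)).piecewise (fun x => gradient (φ j) x + gradient (g j) x) Du₀ with hZ
  have a1 : ∀ k, MemLp (φ k) q μ := fun k => ((hφ k).memLp q).restrict Ω
  have a2 : ∀ k, MemLp (gradient (φ k)) q μ := fun k => ((hφ k).memLp_gradient q).restrict Ω
  have zm : ∀ j, AEStronglyMeasurable (z j) μ := fun j =>
    AEStronglyMeasurable.piecewise (hKm j)
      ((hφ j).smooth.continuous.add (hg j).continuous).aestronglyMeasurable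
      hu₀.memLp.1.restrict
  have Zm : ∀ j, AEStronglyMeasurable (Z j) μ := fun j =>
    AEStronglyMeasurable.piecewise (hKm j)
      ((continuous_gradient (hφ j).smooth).add (continuous_gradient (hg j))).aestronglyMeasurable
      hu₀.memLp_grad.1.restrict
  have bz : ∀ j, eLpNorm (fun x => u x - z j x) q μ ≤
      eLpNorm (fun x => (u x - u₀ x) - φ j x) q μ + ((j : ℝ≥0∞) + 1)⁻¹ := by
    intro j
    have h1 : eLpNorm ((tsupport (φ j)).indicator fun x => g j x - u₀ x) q μ
        ≤ ((j : ℝ≥0∞) + 1)⁻¹ := by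
      rw [eLpNorm_indicator_eq_eLpNorm_restrict (hKm j)]
      exact (eLpNorm_mono_measure _ (Measure.restrict_mono_measure Measure.restrict_le_self _)).trans
        (e1 j)
    refine le_trans (le_trans (le_of_eq ?_) (eLpNorm_sub_le (hu.memW1.memLp.1.sub (a1 j).1)
      (((hg j).continuous.aestronglyMeasurable.sub hu₀.memLp.1).indicator (hKm j)) hq))
      (add_le_add_right h1 _)
    congr 1
    funext x
    by_cases hx : x ∈ tsupport (φ j)
    · simp [hz, hx]; ring
    · simp [hz, hx, image_eq_zero_of_notMem_tsupport hx]
  have bZ : ∀ j, eLpNorm (fun x => Du x - Z j x) q μ ≤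
      eLpNorm (fun x => (Du x - Du₀ x) - gradient (φ j) x) q μ + ((j : ℝ≥0∞) + 1)⁻¹ := by
    intro j
    have h1 : eLpNorm ((tsupport (φ j)).indicator fun x => gradient (g j) x - Du₀ x) q μ
        ≤ ((j : ℝ≥0∞) + 1)⁻¹ := by
      rw [eLpNorm_indicator_eq_eLpNorm_restrict (hKm j)]
      exact (eLpNorm_mono_measure _ (Measure.restrict_mono_measure Measure.restrict_le_self _)).trans
        (e2 j)
    refine le_trans (le_trans (le_of_eq ?_) (eLpNorm_sub_le (hu.memW1.memLp_grad.1.sub (a2 j).1)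
      (((continuous_gradient (hg j)).aestronglyMeasurable.sub hu₀.memLp_grad.1).indicator
        (hKm j)) hq)) (add_le_add_right h1 _)
    congr 1
    funext x
    by_cases hx : x ∈ tsupport (φ j)
    · simp [hZ, hx]; abel
    · simp [hZ, hx, gradient_eq_zero_of_notMem_tsupport hx]
  have tz : Tendsto (fun j => eLpNorm (fun x => u x - z j x) q μ) atTop (𝓝 0) := by
    have h0 := t1.add ht0
    rw [add_zero] at h0
    exact tendsto_of_tendsto_of_tendsto_of_le_of_le tendsto_const_nhds h0 (fun _ => zero_le) bz
  have tZ : Tendsto (fun j => eLpNorm (fun x => Du x - Z j x) q μ) atTop (𝓝 0) := by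
    have h0 := t2.add ht0
    rw [add_zero] at h0
    exact tendsto_of_tendsto_of_tendsto_of_le_of_le tendsto_const_nhds h0 (fun _ => zero_le) bZ
  have tz' := tz.congr fun k => by rw [← Pi.sub_def, eLpNorm_sub_comm]
  obtain ⟨ns, hns, hae⟩ :=
    (tendstoInMeasure_of_tendsto_eLpNorm hq0 zm um.1 tz').exists_seq_tendsto_ae
  -- The gradient error splits as (H'(u) - H'(z))Du + H'(z)(Du - Z). The first term needs pointwise
  -- convergence of z, hence the subsequence; the second uses |H'| ≤ 1.
  have tc : Tendsto (fun j => eLpNorm (fun x => (deriv H (u x) - deriv H (z (ns j) x)) • Du x) q μ)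
      atTop (𝓝 0) := by
    refine tendsto_eLpNorm_smul_of_tendsto_zero hq hq' Dum (fun j => ?_) (B := 2)
      (fun j => Eventually.of_forall fun x => ?_) ?_
    · exact (hH'c.comp_aestronglyMeasurable um.1).sub (hH'c.comp_aestronglyMeasurable (zm _))
    · exact (abs_sub _ _).trans (by linarith [hH' (u x), hH' (z (ns j) x)])
    · filter_upwards [hae] with x hx
      have := ((hH'c.tendsto (u x)).comp hx).const_sub (deriv H (u x))
      simpa using this
  refine memW10_of_forall_exists hq (hH.continuous.comp_aestronglyMeasurable um.1)
    ((hH'c.comp_aestronglyMeasurable um.1).smul Dum.1) fun ε hε => ?_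
  have hε2 : 0 < ε / 2 := ENNReal.half_pos hε
  obtain ⟨j, hj1, hj2, hj3⟩ := (((tz.comp hns.tendsto_atTop).eventually (ge_mem_nhds hε2)).and
    (((tZ.comp hns.tendsto_atTop).eventually (ge_mem_nhds hε2)).and
    (tc.eventually (ge_mem_nhds hε2)))).exists
  set m := ns j with hm
  -- Where φ m vanishes the argument of H is g m x, of absolute value at most k. This is what gives
  -- the composition compact support in Ω.
  have hψ0 : ∀ x, φ m x = 0 → H (φ m x + g m x) = 0 := fun x hx => by
    rw [hx, zero_add]; exact hH0 _ (gb m x)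
  have hψs : tsupport (fun x => H (φ m x + g m x)) ⊆ tsupport (φ m) :=
    closure_mono fun x hx => fun h => hx (hψ0 x h)
  have hψc : ContDiff ℝ ∞ fun x => H (φ m x + g m x) := hH.comp ((hφ m).smooth.add (hg m))
  have hψ : IsTestFunction Ω fun x => H (φ m x + g m x) :=
    ⟨hψc, (hφ m).compact_support.of_isClosed_subset (isClosed_tsupport _) hψs,
      hψs.trans (hφ m).support_subset⟩
  refine ⟨_, hψ, ?_, ?_⟩
  · refine le_trans (eLpNorm_mono_ae ?_) (le_trans hj1 ENNReal.half_le_self)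
    filter_upwards [hk] with x hx
    refine le_trans (le_of_eq ?_) (hLip (u x) (z m x))
    by_cases hxs : x ∈ tsupport (φ m)
    · simp [hz, hxs]
    · simp [hz, hxs, hψ0 x (image_eq_zero_of_notMem_tsupport hxs), hH0 _ hx]
  · have hgrad : ∀ᵐ x ∂μ, gradient (fun x => H (φ m x + g m x)) x = deriv H (z m x) • Z m x := by
      filter_upwards [hk] with x hx
      by_cases hxs : x ∈ tsupport (φ m)
      · have d1 : HasFDerivAt (fun x => φ m x + g m x) (fderiv ℝ (φ m) x + fderiv ℝ (g m) x) x :=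
          (((hφ m).smooth.differentiable (by norm_num) x).hasFDerivAt).add
            (((hg m).differentiable (by norm_num) x).hasFDerivAt)
        have d2 := ((hHd (φ m x + g m x)).hasDerivAt.comp_hasFDerivAt x d1).fderiv
        rw [gradient]
        erw [d2]
        simp [hz, hZ, hxs, gradient]
      · rw [gradient_eq_zero_of_notMem_tsupport fun h => hxs (hψs h)]
        simp [hz, hxs, hH'0 _ hx]
    calc _ = eLpNorm ((fun x => (deriv H (u x) - deriv H (z m x)) • Du x) +
          fun x => deriv H (z m x) • (Du x - Z m x)) q μ := by
          refine eLpNorm_congr_ae ?_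
          filter_upwards [hgrad] with x hx
          rw [hx, Pi.add_apply, sub_smul, smul_sub]
          abel
      _ ≤ _ := eLpNorm_add_le
        (((hH'c.comp_aestronglyMeasurable um.1).sub (hH'c.comp_aestronglyMeasurable (zm _))).smul
          Dum.1) ((hH'c.comp_aestronglyMeasurable (zm _)).smul (Dum.1.sub (Zm _))) hq
      _ ≤ ε / 2 + ε / 2 := by
          refine add_le_add hj3 (le_trans (eLpNorm_mono fun x => ?_) hj2)
          rw [norm_smul]
          exact mul_le_of_le_one_left (norm_nonneg _) (hH' _)
      _ = ε := ENNReal.add_halves ε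

/-- A smooth approximation of the positive part. -/
noncomputable def softPos (r : ℝ) : ℝ := ∫ s in (0 : ℝ)..r, Real.smoothTransition s

theorem hasDerivAt_softPos (r : ℝ) : HasDerivAt softPos (Real.smoothTransition r) r :=
  intervalIntegral.integral_hasDerivAt_right
    (Real.smoothTransition.continuous.intervalIntegrable _ _)
    Real.smoothTransition.continuous.stronglyMeasurable.stronglyMeasurableAtFilter
    Real.smoothTransition.continuousAt

theorem contDiff_softPos : ContDiff ℝ ∞ softPos := by
  rw [contDiff_infty_iff_deriv]
  refine ⟨fun r => (hasDerivAt_softPos r).differentiableAt, ?_⟩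
  have : deriv softPos = Real.smoothTransition := funext fun r => (hasDerivAt_softPos r).deriv
  rw [this]
  exact Real.smoothTransition.contDiff

theorem softPos_of_nonpos {r : ℝ} (hr : r ≤ 0) : softPos r = 0 := by
  refine intervalIntegral.integral_zero_ae (Eventually.of_forall fun s hs => ?_)
  rw [Set.uIoc_of_ge hr] at hs
  exact Real.smoothTransition.zero_of_nonpos hs.2

/-- The integrand lies in [0, 1] and equals 1 beyond 1, so its primitive lags behind the positive
part by at most the length of [0, 1]. -/
theorem abs_softPos_sub_le (r : ℝ) : |max r 0 - softPos r| ≤ 1 := by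
  have hi : ∀ a b : ℝ, IntervalIntegrable Real.smoothTransition volume a b := fun a b =>
    Real.smoothTransition.continuous.intervalIntegrable _ _
  rcases le_total r 0 with hr | hr
  · rw [softPos_of_nonpos hr, max_eq_right hr]; simp
  · rw [max_eq_left hr]
    have h1 : softPos r ≤ r := by
      have := intervalIntegral.integral_mono_on hr (hi 0 r)
        (continuous_const.intervalIntegrable 0 r) fun x _ => Real.smoothTransition.le_one x
      simpa [softPos] using this
    have h2 : r - 1 ≤ softPos r := by
      rcases le_total r 1 with hr1 | hr1
      · have : 0 ≤ softPos r :=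
          intervalIntegral.integral_nonneg hr fun x _ => Real.smoothTransition.nonneg x
        linarith
      · have h3 : ∫ s in (1 : ℝ)..r, Real.smoothTransition s = r - 1 := by
          have : ∫ s in (1 : ℝ)..r, Real.smoothTransition s = ∫ _ in (1 : ℝ)..r, (1 : ℝ) :=
            intervalIntegral.integral_congr fun s hs => by
              rw [Set.uIcc_of_le hr1] at hs
              exact Real.smoothTransition.one_of_one_le hs.1
          simpa using this
        have h4 : 0 ≤ ∫ s in (0 : ℝ)..1, Real.smoothTransition s :=
          intervalIntegral.integral_nonneg zero_le_one fun x _ => Real.smoothTransition.nonneg x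
        rw [softPos, ← intervalIntegral.integral_add_adjacent_intervals (hi 0 1) (hi 1 r), h3]
        linarith
    rw [abs_le]; constructor <;> linarith

/-- The truncation `sign (t) (|t| - k)⁺`. -/
noncomputable def excess (k t : ℝ) : ℝ := max (t - k) 0 - max (-t - k) 0

/-- A smooth approximation of `excess k`. -/
noncomputable def softExcess (k ε t : ℝ) : ℝ :=
  ε * softPos ((t - k) / ε) - ε * softPos ((-t - k) / ε)

theorem hasDerivAt_softExcess (k : ℝ) {ε : ℝ} (hε : 0 < ε) (t : ℝ) :
    HasDerivAt (softExcess k ε)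
      (Real.smoothTransition ((t - k) / ε) + Real.smoothTransition ((-t - k) / ε)) t := by
  have h1 : HasDerivAt (fun t => (t - k) / ε) (1 / ε) t :=
    ((hasDerivAt_id t).sub_const k).div_const ε
  have h2 : HasDerivAt (fun t => (-t - k) / ε) (-1 / ε) t :=
    ((hasDerivAt_id t).neg.sub_const k).div_const ε
  have h3 := (((hasDerivAt_softPos _).comp t h1).const_mul ε).sub
    (((hasDerivAt_softPos _).comp t h2).const_mul ε)
  refine h3.congr_deriv ?_
  field_simp
  ring

theorem contDiff_softExcess (k ε : ℝ) : ContDiff ℝ ∞ (softExcess k ε) :=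
  (contDiff_const.mul (contDiff_softPos.comp ((contDiff_id.sub contDiff_const).div_const ε))).sub
    (contDiff_const.mul (contDiff_softPos.comp ((contDiff_id.neg.sub contDiff_const).div_const ε)))

/-- Rescaling by ε turns the unit error of `softPos` into ε for each of the two one-sided
truncations, uniformly in t. -/
theorem abs_excess_sub_softExcess_le (k : ℝ) {ε : ℝ} (hε : 0 < ε) (t : ℝ) :
    |excess k t - softExcess k ε t| ≤ 2 * ε := by
  have h : ∀ r, |max r 0 - ε * softPos (r / ε)| ≤ ε := by
    intro r
    have e : max r 0 = ε * max (r / ε) 0 := by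
      rw [mul_max_of_nonneg _ _ hε.le, mul_zero, mul_div_cancel₀ _ hε.ne']
    rw [e, ← mul_sub, abs_mul, abs_of_pos hε]
    exact mul_le_of_le_one_right hε.le (abs_softPos_sub_le _)
  have h1 := abs_le.1 (h (t - k))
  have h2 := abs_le.1 (h (-t - k))
  rw [excess, softExcess, abs_le]
  constructor <;> linarith [h1.1, h1.2, h2.1, h2.2]

theorem continuous_excess (k : ℝ) : Continuous (excess k) := by
  unfold excess; fun_prop

theorem excess_of_le {k t : ℝ} (h : |t| ≤ k) : excess k t = 0 := by
  have := abs_le.1 h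
  rw [excess, max_eq_right (by linarith), max_eq_right (by linarith), sub_zero]

theorem abs_excess {k : ℝ} (hk : 0 ≤ k) (t : ℝ) : |excess k t| = max (|t| - k) 0 := by
  rcases le_total 0 t with ht | ht
  · rw [excess, max_eq_right (by linarith : -t - k ≤ 0), sub_zero, abs_of_nonneg ht,
      abs_of_nonneg (le_max_right _ _)]
  · rw [excess, max_eq_right (by linarith : t - k ≤ 0), zero_sub, abs_neg, abs_of_nonpos ht,
      abs_of_nonneg (le_max_right _ _)]

theorem excess_eq_of_lt {k t : ℝ} (hk : 0 ≤ k) (h : k < |t|) :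
    excess k t = Real.sign t * (|t| - k) := by
  rcases le_total 0 t with ht | ht
  · rw [abs_of_nonneg ht] at h ⊢
    rw [excess, max_eq_right (by linarith : -t - k ≤ 0), max_eq_left (by linarith),
      Real.sign_of_pos (by linarith)]
    ring
  · rw [abs_of_nonpos ht] at h ⊢
    rw [excess, max_eq_right (by linarith : t - k ≤ 0), max_eq_left (by linarith),
      Real.sign_of_neg (by linarith)]
    ring

/-- The characteristic function of `{t | k < |t|}`. -/
noncomputable def levelInd (k t : ℝ) : ℝ := {t : ℝ | k < |t|}.indicator 1 t

theorem measurable_levelInd (k : ℝ) : Measurable (levelInd k) :=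
  measurable_one.indicator (measurableSet_lt measurable_const continuous_abs.measurable)

theorem levelInd_of_lt {k t : ℝ} (h : k < |t|) : levelInd k t = 1 := by simp [levelInd, h]

theorem levelInd_of_le {k t : ℝ} (h : |t| ≤ k) : levelInd k t = 0 := by simp [levelInd, h]

theorem abs_levelInd_le (k t : ℝ) : |levelInd k t| ≤ 1 := by
  rcases le_or_gt |t| k with h | h
  · simp [levelInd_of_le h]
  · simp [levelInd_of_lt h]

theorem tendsto_smoothTransition_atTop_div {r : ℝ} {ε : ℕ → ℝ} (hε : ∀ j, 0 < ε j)
    (hε0 : Tendsto ε atTop (𝓝 0)) (hr : 0 < r) :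
    Tendsto (fun j => Real.smoothTransition (r / ε j)) atTop (𝓝 1) := by
  refine tendsto_const_nhds.congr' ?_
  filter_upwards [hε0.eventually (gt_mem_nhds hr)] with j hj
  exact (Real.smoothTransition.one_of_one_le ((one_le_div (hε j)).2 hj.le)).symm

/-- The transition vanishes on (-∞, 0] and equals 1 from 1 on. The derivative is therefore 0 for |t|
≤ k, including |t| = k, and eventually 1 for |t| > k. The one-sided choice makes the limit exactly
the indicator of the open set, with no need to know that Du = 0 almost everywhere on {|u| = k}. -/
theorem tendsto_deriv_softExcess {k : ℝ} (hk : 0 ≤ k) {ε : ℕ → ℝ} (hε : ∀ j, 0 < ε j)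
    (hε0 : Tendsto ε atTop (𝓝 0)) (t : ℝ) :
    Tendsto (fun j => deriv (softExcess k (ε j)) t) atTop (𝓝 (levelInd k t)) := by
  simp only [fun j => (hasDerivAt_softExcess k (hε j) t).deriv]
  have hz : ∀ r ≤ 0, Tendsto (fun j => Real.smoothTransition (r / ε j)) atTop (𝓝 0) := by
    intro r hr
    refine tendsto_const_nhds.congr fun j => ?_
    exact (Real.smoothTransition.zero_of_nonpos
      (div_nonpos_of_nonpos_of_nonneg hr (hε j).le)).symm
  rcases le_or_gt |t| k with h | h
  · rw [levelInd_of_le h]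
    have := abs_le.1 h
    simpa using (hz (t - k) (by linarith)).add (hz (-t - k) (by linarith))
  · rw [levelInd_of_lt h]
    rcases le_total 0 t with ht | ht
    · rw [abs_of_nonneg ht] at h
      simpa using (tendsto_smoothTransition_atTop_div hε hε0 (sub_pos.2 h)).add
        (hz (-t - k) (by linarith))
    · rw [abs_of_nonpos ht] at h
      simpa using (hz (t - k) (by linarith)).add
        (tendsto_smoothTransition_atTop_div hε hε0 (sub_pos.2 h))

/-- For k ≥ 0 at most one of the two transitions is nonzero at a given t, so their sum does not
exceed 1. -/
theorem abs_deriv_softExcess_le {k : ℝ} (hk : 0 ≤ k) {ε : ℝ} (hε : 0 < ε) (t : ℝ) :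
    |deriv (softExcess k ε) t| ≤ 1 := by
  rw [(hasDerivAt_softExcess k hε t).deriv, abs_of_nonneg (add_nonneg
    (Real.smoothTransition.nonneg _) (Real.smoothTransition.nonneg _))]
  rcases le_total 0 t with ht | ht
  · rw [Real.smoothTransition.zero_of_nonpos (x := (-t - k) / ε)
      (div_nonpos_of_nonpos_of_nonneg (by linarith) hε.le), add_zero]
    exact Real.smoothTransition.le_one _
  · rw [Real.smoothTransition.zero_of_nonpos (x := (t - k) / ε)
      (div_nonpos_of_nonpos_of_nonneg (by linarith) hε.le), zero_add]
    exact Real.smoothTransition.le_one _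

/-- Truncations above the boundary values lie in `W₀^{1,q}(Ω)`. -/
theorem memW10_excess {Ω : Set (EuclideanSpace ℝ (Fin n))} (hΩ : IsOpen Ω)
    [IsFiniteMeasure (volume.restrict Ω)] {q : ℝ≥0∞} (hq : 1 ≤ q) (hq' : q ≠ ⊤)
    {u u₀ : EuclideanSpace ℝ (Fin n) → ℝ}
    {Du Du₀ : EuclideanSpace ℝ (Fin n) → EuclideanSpace ℝ (Fin n)}
    (hu₀ : MemW1 Ω q u₀ Du₀) (hu : MemW10 Ω q (fun x => u x - u₀ x) (fun x => Du x - Du₀ x))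
    {k : ℝ} (hk0 : 0 ≤ k) (hk : ∀ᵐ x ∂(volume.restrict Ω), |u₀ x| ≤ k) :
    MemW10 Ω q (fun x => excess k (u x)) (fun x => levelInd k (u x) • Du x) := by
  set μ := volume.restrict Ω with hμ
  have um : MemLp u q μ :=
    (memLp_congr_ae (Eventually.of_forall fun x => by simp)).1 (hu.memW1.memLp.add hu₀.memLp)
  have Dum : MemLp Du q μ :=
    (memLp_congr_ae (Eventually.of_forall fun x => by simp)).1
      (hu.memW1.memLp_grad.add hu₀.memLp_grad)
  set ε : ℕ → ℝ := fun j => 1 / ((j : ℝ) + 1) with hεdef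
  have hε : ∀ j, 0 < ε j := fun j => by positivity
  have hε0 : Tendsto ε atTop (𝓝 0) := tendsto_one_div_add_atTop_nhds_zero_nat
  have lm : AEStronglyMeasurable (fun x => levelInd k (u x)) μ :=
    ((measurable_levelInd k).comp_aemeasurable um.1.aemeasurable).aestronglyMeasurable
  have dm : ∀ j, AEStronglyMeasurable (fun x => deriv (softExcess k (ε j)) (u x)) μ := fun j =>
    ((contDiff_softExcess k (ε j)).continuous_deriv (by norm_num)).comp_aestronglyMeasurable um.1
  refine memW10_of_tendsto hq ((continuous_excess k).comp_aestronglyMeasurable um.1)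
    (lm.smul Dum.1)
    (w' := fun j x => softExcess k (ε j) (u x))
    (Dw' := fun j x => deriv (softExcess k (ε j)) (u x) • Du x) (fun j => ?_) ?_ ?_
  · refine memW10_comp_of_contDiff hΩ hq hq' hu₀ hu hk0 hk (contDiff_softExcess k (ε j))
      (fun t ht => ?_) (fun t ht => ?_) (abs_deriv_softExcess_le hk0 (hε j))
    · have := abs_le.1 ht
      rw [softExcess, softPos_of_nonpos (div_nonpos_of_nonpos_of_nonneg (by linarith) (hε j).le),
        softPos_of_nonpos (div_nonpos_of_nonpos_of_nonneg (by linarith) (hε j).le)]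
      simp
    · have := abs_le.1 ht
      rw [(hasDerivAt_softExcess k (hε j) t).deriv,
        Real.smoothTransition.zero_of_nonpos
          (div_nonpos_of_nonpos_of_nonneg (by linarith) (hε j).le),
        Real.smoothTransition.zero_of_nonpos
          (div_nonpos_of_nonpos_of_nonneg (by linarith) (hε j).le), add_zero]
  · have h1 := tendsto_eLpNorm_smul_of_tendsto_zero (μ := μ) (F := ℝ) hq hq' (memLp_const (1 : ℝ))
      (c := fun j x => excess k (u x) - softExcess k (ε j) (u x)) (B := 2)
      (fun j => ((continuous_excess k).comp_aestronglyMeasurable um.1).sub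
        ((contDiff_softExcess k (ε j)).continuous.comp_aestronglyMeasurable um.1))
      (fun j => Eventually.of_forall fun x =>
        (abs_excess_sub_softExcess_le k (hε j) (u x)).trans ?_)
      (Eventually.of_forall fun x => ?_)
    · simpa using h1
    · have : ε j ≤ 1 := by
        rw [hεdef]; exact div_le_one_of_le₀ (by linarith [j.cast_nonneg (α := ℝ)]) (by positivity)
      linarith
    · refine squeeze_zero_norm (fun j => abs_excess_sub_softExcess_le k (hε j) (u x)) ?_
      simpa using hε0.const_mul 2
  · have h1 := tendsto_eLpNorm_smul_of_tendsto_zero (μ := μ) hq hq' Dum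
      (c := fun j x => levelInd k (u x) - deriv (softExcess k (ε j)) (u x)) (B := 2)
      (fun j => lm.sub (dm j)) (fun j => Eventually.of_forall fun x => (abs_sub _ _).trans ?_)
      (Eventually.of_forall fun x => ?_)
    · simpa only [sub_smul] using h1
    · linarith [abs_levelInd_le k (u x), abs_deriv_softExcess_le hk0 (hε j) (u x)]
    · simpa using (tendsto_deriv_softExcess hk0 hε hε0 (u x)).const_sub (levelInd k (u x))

end Truncation

/-! ### Carathéodory compositions and the convex energy integrand. -/

section Integrands

variable {n : ℕ}

/-- The range of s is finite, and on each of its fibres the composition is one of the measurable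
sections of G. -/
theorem aestronglyMeasurable_comp_simpleFunc {X Y F : Type*} [MeasurableSpace X]
    [MeasurableSpace Y] [TopologicalSpace F] [TopologicalSpace.PseudoMetrizableSpace F]
    {μ : Measure X} {G : X → Y → F}
    (hG : ∀ y, AEStronglyMeasurable (fun x => G x y) μ) (s : SimpleFunc X Y) :
    AEStronglyMeasurable (fun x => G x (s x)) μ := by
  classical
  have hu : ⋃ y : s.range, s ⁻¹' {(y : Y)} = Set.univ := by
    refine Set.eq_univ_of_forall fun x => Set.mem_iUnion.2 ⟨⟨s x, s.mem_range_self x⟩, rfl⟩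
  rw [← Measure.restrict_univ (μ := μ), ← hu, aestronglyMeasurable_iUnion_iff]
  intro y
  refine ((hG y).restrict (s := s ⁻¹' {(y : Y)})).congr ?_
  filter_upwards [ae_restrict_mem (s.measurableSet_preimage _)] with x hx
  rw [mem_preimage, mem_singleton_iff] at hx
  rw [hx]

/-- Compositions with a Carathéodory map are measurable. -/
theorem IsCaratheodory.aestronglyMeasurable_comp {F : Type*} [TopologicalSpace F]
    [TopologicalSpace.PseudoMetrizableSpace F]
    {Ω : Set (EuclideanSpace ℝ (Fin n))}
    {g : EuclideanSpace ℝ (Fin n) → ℝ → EuclideanSpace ℝ (Fin n) → F} (hg : IsCaratheodory Ω g)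
    {u : EuclideanSpace ℝ (Fin n) → ℝ} {Du : EuclideanSpace ℝ (Fin n) → EuclideanSpace ℝ (Fin n)}
    (hu : AEStronglyMeasurable u (volume.restrict Ω))
    (hDu : AEStronglyMeasurable Du (volume.restrict Ω)) :
    AEStronglyMeasurable (fun x => g x (u x) (Du x)) (volume.restrict Ω) := by
  have hz : AEStronglyMeasurable (fun x => (u x, Du x)) (volume.restrict Ω) := hu.prodMk hDu
  have hs := hz.stronglyMeasurable_mk
  -- The pair (u, Du) is a limit of simple functions, and continuity in (u, ξ) passes this limit
  -- through g at almost every x.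
  refine aestronglyMeasurable_of_tendsto_ae atTop
    (f := fun j x => g x (hs.approx j x).1 (hs.approx j x).2) (fun j => ?_) ?_
  · exact aestronglyMeasurable_comp_simpleFunc
      (G := fun x (y : ℝ × EuclideanSpace ℝ (Fin n)) => g x y.1 y.2)
      (fun y => hg.measurable y.1 y.2) (hs.approx j)
  · filter_upwards [hg.continuous, hz.ae_eq_mk] with x hc hx
    have h1 := (hc.tendsto (u x, Du x)).comp (hx ▸ hs.tendsto_approx x)
    exact h1

/-- At ξ = 0 the lower bound reads m f ≤ f with m > 1, which is incompatible with f > 0. -/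
theorem TwoSidedDeltaTwo.apply_zero {Ω : Set (EuclideanSpace ℝ (Fin n))}
    {f : EuclideanSpace ℝ (Fin n) → ℝ → EuclideanSpace ℝ (Fin n) → ℝ}
    (h : TwoSidedDeltaTwo Ω f) {x : EuclideanSpace ℝ (Fin n)} (hx : x ∈ Ω) (u : ℝ)
    (h0 : 0 ≤ f x u 0) : f x u 0 = 0 := by
  obtain ⟨m, M, hm, -, h⟩ := h
  have := (h x hx u 0).1
  rw [smul_zero] at this
  nlinarith

/-- Along the segment from ξ to η the function is convex in one variable, so its derivative at 0 is
at most its slope over [0, 1]. -/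
theorem le_inner_gradient_of_convexOn {φ : EuclideanSpace ℝ (Fin n) → ℝ}
    (hc : ConvexOn ℝ Set.univ φ) (hd : Differentiable ℝ φ) (ξ η : EuclideanSpace ℝ (Fin n)) :
    inner ℝ (gradient φ ξ) (η - ξ) ≤ φ η - φ ξ := by
  set L : ℝ →ᵃ[ℝ] EuclideanSpace ℝ (Fin n) := AffineMap.lineMap ξ η with hL
  have hc1 : ConvexOn ℝ Set.univ (φ ∘ L) := by
    simpa using hc.comp_affineMap L
  have hd1 : HasDerivAt (φ ∘ L) (inner ℝ (gradient φ ξ) (η - ξ)) 0 := by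
    have h1 : HasDerivAt (L : ℝ → EuclideanSpace ℝ (Fin n)) (η - ξ) 0 :=
      AffineMap.hasDerivAt_lineMap
    have h2 : HasFDerivAt φ (fderiv ℝ φ ξ) (L 0) := by
      rw [hL, AffineMap.lineMap_apply_zero]; exact (hd ξ).hasFDerivAt
    rw [inner_gradient_left]
    exact h2.comp_hasDerivAt 0 h1
  have := hc1.le_slope_of_hasDerivAt (Set.mem_univ 0) (Set.mem_univ 1) zero_lt_one hd1
  simpa [slope_def_field, hL] using this

/-- The tangent inequality at ξ is evaluated at 0, where f vanishes, and at 2ξ, where the upper Δ₂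
bound applies; the latter gives the constant M - 1. This replaces (D_ξ f, ξ) by f in the comparison
inequalities. -/
theorem IsConvexEnergyIntegrand.ae_le_inner_gradXi {Ω : Set (EuclideanSpace ℝ (Fin n))}
    (hΩ : MeasurableSet Ω)
    {f : EuclideanSpace ℝ (Fin n) → ℝ → EuclideanSpace ℝ (Fin n) → ℝ}
    (hf : IsConvexEnergyIntegrand Ω f) (hδ : TwoSidedDeltaTwo Ω f) :
    ∃ M : ℝ, 0 ≤ M ∧ ∀ᵐ x ∂(volume.restrict Ω), ∀ u ξ,
      f x u ξ ≤ inner ℝ (gradXi f x u ξ) ξ ∧ inner ℝ (gradXi f x u ξ) ξ ≤ M * f x u ξ := by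
  have hδ' := hδ
  obtain ⟨m, M, hm, hmM, h⟩ := hδ'
  refine ⟨M - 1, by linarith, ?_⟩
  filter_upwards [hf.convex, hf.differentiable, ae_restrict_mem hΩ] with x hc hd hx u ξ
  have h0 := hδ.apply_zero hx u (hf.nonneg x hx u 0)
  have h1 := le_inner_gradient_of_convexOn (hc u) (hd u) ξ 0
  have h2 := le_inner_gradient_of_convexOn (hc u) (hd u) ξ ((2 : ℝ) • ξ)
  have h3 := (h x hx u ξ).2
  rw [h0, zero_sub, zero_sub, inner_neg_right] at h1
  have e : (2 : ℝ) • ξ - ξ = ξ := by rw [two_smul, add_sub_cancel_right]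
  rw [e] at h2
  unfold gradXi
  constructor <;> linarith

end Integrands

/-! ### Decay of superlevel sets and Stampacchia's iteration. -/

section LevelSets

/-- Stampacchia's iteration lemma. -/
theorem exists_threshold_eq_zero {C Q α : ℝ} (hC : 0 < C) (hQ : 0 < Q) (hα : 0 < α) :
    ∃ δ : ℝ, 0 < δ ∧ δ ≤ 1 ∧ ∀ g : ℝ → ℝ, (∀ t, 0 ≤ g t) →
      (∀ s t, 1 ≤ s → s < t → t ≤ 2 → (t - s) ^ Q * g t ≤ C * g s ^ (1 + α)) →
      g 1 ≤ δ → g 2 = 0 := by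
  set D : ℝ := C * 2 ^ (Q + Q / α) with hD
  have hD0 : 0 < D := by positivity
  set δ : ℝ := min 1 (D ^ (-(1 / α))) with hδ
  have hδ0 : 0 < δ := lt_min one_pos (Real.rpow_pos_of_pos hD0 _)
  have hδD : D * δ ^ α ≤ 1 := by
    have h1 : δ ^ α ≤ D⁻¹ := by
      calc δ ^ α ≤ (D ^ (-(1 / α))) ^ α := Real.rpow_le_rpow hδ0.le (min_le_right _ _) hα.le
        _ = D⁻¹ := by
          rw [← Real.rpow_mul hD0.le, neg_mul, one_div, inv_mul_cancel₀ hα.ne', Real.rpow_neg_one]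
    calc D * δ ^ α ≤ D * D⁻¹ := by gcongr
      _ = 1 := mul_inv_cancel₀ hD0.ne'
  refine ⟨δ, hδ0, min_le_left _ _, fun g hg0 hg hg1 => ?_⟩
  -- The levels are 2 - 2^{-j}. Since q^α = 2^{-Q}, the geometric decay g ≤ δ q^j compensates the
  -- shrinking gaps, and D collects the constants so that the induction closes exactly when D δ^α ≤
  -- 1.
  set q : ℝ := 2 ^ (-(Q / α)) with hq
  have hq0 : 0 < q := by positivity
  have hq1 : q < 1 := Real.rpow_lt_one_of_one_lt_of_neg one_lt_two (by
    rw [neg_lt_zero]; positivity)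
  set κ : ℝ := 2 ^ (-Q) with hκ
  have hκ0 : 0 < κ := by positivity
  have hqκ : q ^ α = κ := by
    rw [hq, hκ, ← Real.rpow_mul zero_le_two]; congr 1; field_simp
  have hhalf : ∀ j : ℕ, (((1 : ℝ) / 2) ^ j) ^ Q = κ ^ j := by
    intro j
    rw [hκ, one_div, Real.rpow_neg zero_le_two, ← Real.inv_rpow zero_le_two,
      ← Real.rpow_natCast, ← Real.rpow_natCast, ← Real.rpow_mul (by norm_num),
      ← Real.rpow_mul (by norm_num), mul_comm]
  have hpow : ∀ j : ℕ, (δ * q ^ j) ^ (1 + α) = δ * δ ^ α * (q ^ j * κ ^ j) := by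
    intro j
    rw [Real.rpow_add (by positivity), Real.rpow_one, Real.mul_rpow hδ0.le (by positivity),
      ← Real.rpow_natCast q j, ← Real.rpow_mul hq0.le, mul_comm (j : ℝ) α, Real.rpow_mul hq0.le, hqκ,
      Real.rpow_natCast, Real.rpow_natCast]
    ring
  have hDκ : D * (κ * q) = C := by
    rw [hD, hκ, hq, Real.rpow_add two_pos, Real.rpow_neg zero_le_two, Real.rpow_neg zero_le_two]
    have h1 : (2 : ℝ) ^ Q ≠ 0 := by positivity
    have h2 : (2 : ℝ) ^ (Q / α) ≠ 0 := by positivity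
    field_simp
  have hind : ∀ j : ℕ, g (2 - (1 / 2) ^ j) ≤ δ * q ^ j := by
    intro j
    induction j with
    | zero => simpa [show (2 : ℝ) - 1 = 1 by norm_num] using hg1
    | succ j ih =>
      have hp : (0 : ℝ) < (1 / 2) ^ j := by positivity
      have hp1 : ((1 : ℝ) / 2) ^ j ≤ 1 := pow_le_one₀ (by norm_num) (by norm_num)
      have h1 := hg (2 - (1 / 2) ^ j) (2 - (1 / 2) ^ (j + 1)) (by linarith)
        (by rw [pow_succ]; linarith) (by rw [pow_succ]; linarith)
      have e : (2 - (1 / 2) ^ (j + 1) : ℝ) - (2 - (1 / 2) ^ j) = (1 / 2) ^ (j + 1) := by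
        rw [pow_succ]; ring
      rw [e, hhalf] at h1
      have h2 : g (2 - (1 / 2) ^ j) ^ (1 + α) ≤ (δ * q ^ j) ^ (1 + α) :=
        Real.rpow_le_rpow (hg0 _) ih (by positivity)
      rw [hpow] at h2
      have h3 : κ ^ (j + 1) * g (2 - (1 / 2) ^ (j + 1)) ≤ κ ^ (j + 1) * (δ * q ^ (j + 1)) := by
        calc _ ≤ C * (δ * δ ^ α * (q ^ j * κ ^ j)) := h1.trans (by gcongr)
          _ = (D * δ ^ α) * (δ * (κ ^ (j + 1) * q ^ (j + 1))) := by
            rw [← hDκ]; ring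
          _ ≤ 1 * (δ * (κ ^ (j + 1) * q ^ (j + 1))) := by gcongr
          _ = _ := by ring
      exact le_of_mul_le_mul_left h3 (by positivity)
  -- No monotonicity or continuity of g is assumed, so the value at 2 is reached by applying the
  -- recursion from level 2 - 2^{-j} straight to 2.
  have hlast : ∀ j : ℕ, g 2 ≤ C * (δ * δ ^ α) * q ^ j := by
    intro j
    have hp : (0 : ℝ) < (1 / 2) ^ j := by positivity
    have hp1 : ((1 : ℝ) / 2) ^ j ≤ 1 := pow_le_one₀ (by norm_num) (by norm_num)
    have h1 := hg (2 - (1 / 2) ^ j) 2 (by linarith) (by linarith) le_rfl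
    rw [sub_sub_cancel, hhalf] at h1
    have h2 : g (2 - (1 / 2) ^ j) ^ (1 + α) ≤ (δ * q ^ j) ^ (1 + α) :=
      Real.rpow_le_rpow (hg0 _) (hind j) (by positivity)
    rw [hpow] at h2
    refine le_of_mul_le_mul_left (a := κ ^ j) ?_ (by positivity)
    calc _ ≤ C * (δ * δ ^ α * (q ^ j * κ ^ j)) := h1.trans (by gcongr)
      _ = _ := by ring
  have hlim : Tendsto (fun j : ℕ => C * (δ * δ ^ α) * q ^ j) atTop (𝓝 0) := by
    simpa using (tendsto_pow_atTop_nhds_zero_of_lt_one hq0.le hq1).const_mul (C * (δ * δ ^ α))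
  exact le_antisymm (ge_of_tendsto' hlim hlast) (hg0 2)

variable {X : Type*} [MeasurableSpace X] {μ : Measure X}

/-- Dominated convergence: for each x the indicator of {k < U} is 0 as soon as k ≥ U x. -/
theorem tendsto_setIntegral_superlevel {U G : X → ℝ} (hU : AEMeasurable U μ)
    (hG : Integrable G μ) :
    Tendsto (fun k : ℝ => ∫ x in {x | k < U x}, G x ∂μ) atTop (𝓝 0) := by
  have hn : ∀ k : ℝ, NullMeasurableSet {x | k < U x} μ := fun k =>
    nullMeasurableSet_lt aemeasurable_const hU
  have h0 : ∫ _, (0 : ℝ) ∂μ = 0 := integral_zero _ _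
  have e : ∀ k : ℝ, ∫ x in {x | k < U x}, G x ∂μ = ∫ x, {x | k < U x}.indicator G x ∂μ :=
    fun k => (integral_indicator₀ (hn k)).symm
  simp only [e]
  rw [← h0]
  refine tendsto_integral_filter_of_dominated_convergence (fun x => ‖G x‖)
    (Eventually.of_forall fun k => hG.1.indicator₀ (hn k))
    (Eventually.of_forall fun k => Eventually.of_forall fun x => norm_indicator_le_norm_self _ _)
    hG.norm (Eventually.of_forall fun x => ?_)
  refine tendsto_const_nhds.congr' ?_
  filter_upwards [eventually_ge_atTop (U x)] with k hk
  simp [hk]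

variable [IsFiniteMeasure μ]

/-- Chebyshev's inequality: U - k exceeds h - k on the smaller superlevel set. -/
theorem rpow_mul_measureReal_superlevel_le {U : X → ℝ} (hU : AEMeasurable U μ) {Q k h : ℝ}
    (hQ : 0 < Q) (hkh : k < h) (hi : IntegrableOn (fun x => (U x - k) ^ Q) {x | k < U x} μ) :
    (h - k) ^ Q * μ.real {x | h < U x} ≤ ∫ x in {x | k < U x}, (U x - k) ^ Q ∂μ := by
  have hn : ∀ k : ℝ, NullMeasurableSet {x | k < U x} μ := fun k =>
    nullMeasurableSet_lt aemeasurable_const hU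
  have hsub : {x | h < U x} ⊆ {x | k < U x} := fun x hx => hkh.trans hx
  calc (h - k) ^ Q * μ.real {x | h < U x} = ∫ _ in {x | h < U x}, (h - k) ^ Q ∂μ := by
        rw [setIntegral_const, smul_eq_mul, mul_comm]
    _ ≤ ∫ x in {x | h < U x}, (U x - k) ^ Q ∂μ := by
        refine integral_mono_ae (integrable_const _) (hi.mono_set hsub) ?_
        filter_upwards [ae_restrict_mem₀ (hn h)] with x hx
        have : h < U x := hx
        exact Real.rpow_le_rpow (by linarith) (by linarith) hQ.le
    _ ≤ _ := by
        refine setIntegral_mono_set hi ?_ (Eventually.of_forall hsub)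
        filter_upwards [ae_restrict_mem₀ (hn k)] with x hx
        have : k < U x := hx
        exact Real.rpow_nonneg (by linarith) _

/-- De Giorgi's criterion for boundedness in terms of the decay of the level sets. -/
theorem exists_measure_superlevel_eq_zero {U : X → ℝ} (hU : AEMeasurable U μ)
    {C Q α k₀ : ℝ} (hC : 0 < C) (hQ : 0 < Q) (hα : 0 < α)
    (hUQ : Integrable (fun x => U x ^ Q) μ)
    (h : ∀ K, k₀ ≤ K → 1 ≤ K → ∀ k h, K ≤ k → k < h → h ≤ 2 * K →
      K ^ Q * μ.real {x | k < U x} ≤ 1 →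
      (h - k) ^ Q * μ.real {x | h < U x} ≤ C * (K ^ Q * μ.real {x | k < U x}) ^ (1 + α)) :
    ∃ K : ℝ, μ {x | K < U x} = 0 := by
  obtain ⟨δ, hδ0, hδ1, hδ⟩ := exists_threshold_eq_zero hC hQ hα
  -- The threshold δ depends only on C, Q and α, not on K. Hence K can be chosen afterwards, so
  -- large that the tail of the integral of U^Q is at most δ.
  obtain ⟨K, hK0, hK1, hK⟩ := ((eventually_ge_atTop k₀).and ((eventually_ge_atTop 1).and
    ((tendsto_setIntegral_superlevel hU hUQ).eventually (ge_mem_nhds hδ0)))).exists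
  have hKpos : 0 < K := by linarith
  have hn : ∀ k : ℝ, NullMeasurableSet {x | k < U x} μ := fun k =>
    nullMeasurableSet_lt aemeasurable_const hU
  have hy : K ^ Q * μ.real {x | K < U x} ≤ δ := by
    refine le_trans ?_ hK
    calc K ^ Q * μ.real {x | K < U x} = ∫ _ in {x | K < U x}, K ^ Q ∂μ := by
          rw [setIntegral_const, smul_eq_mul, mul_comm]
      _ ≤ _ := by
        refine integral_mono_ae (integrable_const _) hUQ.integrableOn ?_
        filter_upwards [ae_restrict_mem₀ (hn K)] with x hx
        have : K < U x := hx
        exact Real.rpow_le_rpow hKpos.le this.le hQ.le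
  -- Measuring levels in units of K and weighting the measure by K^Q turns the assumed recursion on
  -- [K, 2K] into the normalised one on [1, 2], with the same constant C.
  have key := hδ (fun t => K ^ Q * μ.real {x | t * K < U x}) (fun t => by positivity) ?_
    (by simpa using hy)
  · refine ⟨2 * K, ?_⟩
    have h1 : μ.real {x | 2 * K < U x} = 0 := by
      have h2 : K ^ Q ≠ 0 := by positivity
      simpa [h2] using key
    exact (measureReal_eq_zero_iff).1 h1
  · intro s t hs hst ht
    have hle : K ≤ s * K := le_mul_of_one_le_left hKpos.le hs
    have h1 : K ^ Q * μ.real {x | s * K < U x} ≤ 1 := by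
      refine le_trans ?_ (hy.trans hδ1)
      exact mul_le_mul_of_nonneg_left
        (measureReal_mono fun x (hx : s * K < U x) => hle.trans_lt hx) (by positivity)
    have h2 := h K hK0 hK1 (s * K) (t * K) hle (by gcongr) (by gcongr) h1
    rw [← sub_mul, Real.mul_rpow (by linarith) hKpos.le] at h2
    linarith

/-- Hölder's inequality for two powers of a nonnegative function. -/
theorem integral_rpow_le_rpow_integral_rpow {g : X → ℝ} (hg : AEStronglyMeasurable g μ)
    (hg0 : ∀ᵐ x ∂μ, 0 ≤ g x) {r s : ℝ} (hr : 0 < r) (hrs : r ≤ s)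
    (hi : Integrable (fun x => g x ^ s) μ) :
    ∫ x, g x ^ r ∂μ ≤ (∫ x, g x ^ s ∂μ) ^ (r / s) * μ.real Set.univ ^ (1 - r / s) := by
  have hs : 0 < s := hr.trans_le hrs
  rcases hrs.eq_or_lt with rfl | hlt
  · simp [div_self hr.ne']
  have hc : (s / r).HolderConjugate (s / (s - r)) := by
    have h1 : s - r ≠ 0 := (sub_pos.2 hlt).ne'
    refine Real.holderConjugate_iff.2 ⟨(one_lt_div hr).2 hlt, ?_⟩
    field_simp
    ring
  have e : (fun x => (g x ^ r) ^ (s / r)) =ᵐ[μ] fun x => g x ^ s := by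
    filter_upwards [hg0] with x hx
    rw [← Real.rpow_mul hx, mul_div_cancel₀ _ hr.ne']
  have hgr : AEStronglyMeasurable (fun x => g x ^ r) μ :=
    (hg.aemeasurable.pow_const r).aestronglyMeasurable
  have m1 : MemLp (fun x => g x ^ r) (ENNReal.ofReal (s / r)) μ := by
    rw [← integrable_norm_rpow_iff hgr (by simpa using div_pos hs hr) ENNReal.ofReal_ne_top,
      ENNReal.toReal_ofReal (div_pos hs hr).le]
    refine hi.congr ?_
    filter_upwards [hg0, e] with x hx hex
    rw [Real.norm_of_nonneg (Real.rpow_nonneg hx _), ← hex]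
  have key := integral_mul_le_Lp_mul_Lq_of_nonneg hc (f := fun x => g x ^ r) (g := fun _ => 1)
    (hg0.mono fun x hx => Real.rpow_nonneg hx _) (Eventually.of_forall fun _ => zero_le_one)
    m1 (memLp_const 1)
  rw [integral_congr_ae e] at key
  simp only [mul_one, Real.one_rpow, integral_const, smul_eq_mul] at key
  have e1 : 1 / (s / r) = r / s := by rw [one_div_div]
  have e2 : 1 / (s / (s - r)) = 1 - r / s := by rw [one_div_div, sub_div, div_self hs.ne']
  rwa [e1, e2] at key

end LevelSets

/-! ### From Caccioppoli and Sobolev inequalities to boundedness. -/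

section DeGiorgi

theorem add_rpow_le_two_rpow_mul {a b r : ℝ} (ha : 0 ≤ a) (hb : 0 ≤ b) (hr : 0 ≤ r) :
    (a + b) ^ r ≤ 2 ^ r * (a ^ r + b ^ r) := by
  have h1 : a + b ≤ 2 * max a b := by linarith [le_max_left a b, le_max_right a b]
  calc (a + b) ^ r ≤ (2 * max a b) ^ r := Real.rpow_le_rpow (by positivity) h1 hr
    _ = 2 ^ r * max a b ^ r := Real.mul_rpow zero_le_two (ha.trans (le_max_left _ _))
    _ ≤ 2 ^ r * (a ^ r + b ^ r) := by
      gcongr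
      rcases max_choice a b with h | h <;> rw [h]
      · linarith [Real.rpow_nonneg hb r]
      · linarith [Real.rpow_nonneg ha r]

variable {X : Type*} [MeasurableSpace X] {μ : Measure X} [IsFiniteMeasure μ]

/-- Write U = (U - k) + k and use Hölder's inequality on the first part. It is applied to the
measure restricted to {k < U}, so that the total mass is the measure of the superlevel set. -/
theorem integral_rpow_le_of_split {U : X → ℝ} (hU : AEMeasurable U μ) {r Q k : ℝ} (hk : 0 ≤ k)
    (hr : 0 < r) (hrQ : r ≤ Q) (hkU : ∀ᵐ x ∂μ, k < U x)
    (hi : Integrable (fun x => (U x - k) ^ Q) μ) (hir : Integrable (fun x => U x ^ r) μ) :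
    ∫ x, U x ^ r ∂μ ≤ 2 ^ r * ((∫ x, (U x - k) ^ Q ∂μ) ^ (r / Q) * μ.real Set.univ ^ (1 - r / Q)
      + k ^ r * μ.real Set.univ) := by
  have hm : AEStronglyMeasurable (fun x => U x - k) μ := (hU.sub_const k).aestronglyMeasurable
  have h0 : ∀ᵐ x ∂μ, 0 ≤ U x - k := hkU.mono fun x hx => by linarith
  have hir' : Integrable (fun x => (U x - k) ^ r) μ := by
    refine hir.mono' (hm.aemeasurable.pow_const r).aestronglyMeasurable ?_
    filter_upwards [h0] with x hx
    rw [Real.norm_of_nonneg (Real.rpow_nonneg hx _)]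
    exact Real.rpow_le_rpow hx (by linarith) hr.le
  calc ∫ x, U x ^ r ∂μ ≤ ∫ x, 2 ^ r * ((U x - k) ^ r + k ^ r) ∂μ := by
        refine integral_mono_ae hir ((hir'.add (integrable_const _)).const_mul _) ?_
        filter_upwards [h0] with x hx
        have := add_rpow_le_two_rpow_mul hx hk hr.le
        rwa [sub_add_cancel] at this
    _ = 2 ^ r * (∫ x, (U x - k) ^ r ∂μ + k ^ r * μ.real Set.univ) := by
        rw [integral_const_mul, integral_add hir' (integrable_const _), integral_const, smul_eq_mul,
          mul_comm (μ.real _)]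
    _ ≤ _ := by
        gcongr
        exact integral_rpow_le_rpow_integral_rpow hm h0 hr hrQ hi

/-- Hölder's inequality with exponents Q and Q', followed by the passage from L^{Q'} to L^s for B;
the condition on s and Q says Q' ≤ s. The unused integrability becomes a positive power of the mass.
-/
theorem integral_mul_le_of_holder {B V : X → ℝ} (hB : AEStronglyMeasurable B μ)
    (hV : AEStronglyMeasurable V μ) (hB0 : ∀ᵐ x ∂μ, 0 ≤ B x) (hV0 : ∀ᵐ x ∂μ, 0 ≤ V x) {s Q : ℝ}
    (hs : 0 < s) (hQ : 1 < Q) (hsQ : 1 / s + 1 / Q ≤ 1)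
    (hBi : Integrable (fun x => B x ^ s) μ) (hVi : Integrable (fun x => V x ^ Q) μ) :
    ∫ x, B x * V x ∂μ ≤ (∫ x, V x ^ Q ∂μ) ^ (1 / Q) *
      ((∫ x, B x ^ s ∂μ) ^ (1 / s) * μ.real Set.univ ^ (1 - 1 / s - 1 / Q)) := by
  have hc : Q.HolderConjugate (Real.conjExponent Q) := Real.HolderConjugate.conjExponent hQ
  set Q' := Real.conjExponent Q with hQ'
  have hQ'0 : 0 < Q' := hc.symm.pos
  have hinv : 1 / Q' = 1 - 1 / Q := by
    have := hc.inv_add_inv_eq_one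
    rw [one_div, one_div]; linarith
  have hle : Q' ≤ s := by
    have : 1 / s ≤ 1 / Q' := by rw [hinv]; linarith
    exact (one_div_le_one_div hs hQ'0).1 this
  have hBQ := integral_rpow_le_rpow_integral_rpow hB hB0 hQ'0 hle hBi
  have m1 : MemLp V (ENNReal.ofReal Q) μ := by
    rw [← integrable_norm_rpow_iff hV (by simpa using hc.pos) ENNReal.ofReal_ne_top,
      ENNReal.toReal_ofReal hc.pos.le]
    refine hVi.congr ?_
    filter_upwards [hV0] with x hx
    rw [Real.norm_of_nonneg hx]
  have m2 : MemLp B (ENNReal.ofReal Q') μ := by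
    have : MemLp B (ENNReal.ofReal s) μ := by
      rw [← integrable_norm_rpow_iff hB (by simpa using hs) ENNReal.ofReal_ne_top,
        ENNReal.toReal_ofReal hs.le]
      refine hBi.congr ?_
      filter_upwards [hB0] with x hx
      rw [Real.norm_of_nonneg hx]
    exact this.mono_exponent (ENNReal.ofReal_le_ofReal hle)
  have key := integral_mul_le_Lp_mul_Lq_of_nonneg hc hV0 hB0 m1 m2
  have e : ∫ x, B x * V x ∂μ = ∫ x, V x * B x ∂μ := by simp only [mul_comm]
  rw [e]
  refine key.trans ?_
  have hVn : 0 ≤ ∫ x, V x ^ Q ∂μ :=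
    integral_nonneg_of_ae (hV0.mono fun x hx => Real.rpow_nonneg hx _)
  have hBn : 0 ≤ ∫ x, B x ^ s ∂μ :=
    integral_nonneg_of_ae (hB0.mono fun x hx => Real.rpow_nonneg hx _)
  have hBn' : 0 ≤ ∫ x, B x ^ Q' ∂μ :=
    integral_nonneg_of_ae (hB0.mono fun x hx => Real.rpow_nonneg hx _)
  refine mul_le_mul_of_nonneg_left ?_ (Real.rpow_nonneg hVn _)
  calc _ ≤ ((∫ x, B x ^ s ∂μ) ^ (Q' / s) * μ.real Set.univ ^ (1 - Q' / s)) ^ (1 / Q') :=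
        Real.rpow_le_rpow hBn' hBQ (by positivity)
    _ = _ := by
      rw [Real.mul_rpow (Real.rpow_nonneg hBn _) (by positivity), ← Real.rpow_mul hBn,
        ← Real.rpow_mul measureReal_nonneg]
      congr 2
      · field_simp
      · rw [sub_mul, one_mul, hinv]
        have : Q' / s * (1 / Q') = 1 / s := by field_simp
        rw [← hinv, this, hinv]; ring

/-- Young's inequality for the factors a^{1/p}/4 and 4b. Since (1/4)^p ≤ 1/4, the term in a is small
enough to be absorbed. -/
theorem young_absorb {a b p : ℝ} (hp : 1 < p) (ha : 0 ≤ a) (hb : 0 ≤ b) :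
    a ^ (1 / p) * b ≤ 1 / 4 * a + (4 * b) ^ (p / (p - 1)) := by
  have hc : p.HolderConjugate (p / (p - 1)) := Real.HolderConjugate.conjExponent hp
  have hp0 : 0 < p := hc.pos
  have h := Real.young_inequality_of_nonneg (a := 1 / 4 * a ^ (1 / p)) (b := 4 * b)
    (by positivity) (by positivity) hc
  have e : 1 / 4 * a ^ (1 / p) * (4 * b) = a ^ (1 / p) * b := by ring
  rw [e] at h
  refine h.trans (add_le_add ?_ ?_)
  · have h1 : (1 / 4 * a ^ (1 / p)) ^ p ≤ 1 / 4 * a := by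
      rw [Real.mul_rpow (by norm_num) (by positivity), ← Real.rpow_mul ha, one_div_mul_cancel hp0.ne',
        Real.rpow_one]
      gcongr
      exact Real.rpow_le_self_of_le_one (by norm_num) (by norm_num) hp.le
    exact (div_le_self (by positivity) hp.le).trans h1
  · exact div_le_self (by positivity) hc.symm.lt.le

/-- De Giorgi's boundedness theorem: a Caccioppoli inequality on the superlevel sets, of critical
growth, and a Sobolev inequality for the truncations imply boundedness. -/
theorem exists_measure_superlevel_eq_zero_of_caccioppoli {U F B : X → ℝ} (hU : AEMeasurable U μ)
    {p ps Q s C₁ C₂ k₀ : ℝ} (hp : 1 < p) (hps : p < ps) (hQ : ps ≤ Q)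
    (hs : 1 < s) (hsQ : p < (1 - 1 / s) * Q) (hC₁ : 0 < C₁) (hC₂ : 0 < C₂)
    (hUQ : Integrable (fun x => U x ^ Q) μ) (hUps : Integrable (fun x => U x ^ ps) μ)
    (hF0 : ∀ᵐ x ∂μ, 0 ≤ F x)
    (hBm : AEStronglyMeasurable B μ) (hB0 : ∀ᵐ x ∂μ, 0 ≤ B x)
    (hB : Integrable (fun x => B x ^ s) μ)
    (hCacc : ∀ k, k₀ ≤ k → ∫ x in {x | k < U x}, F x ∂μ ≤
      C₁ * (∫ x in {x | k < U x}, U x ^ ps ∂μ + ∫ x in {x | k < U x}, B x ∂μ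
        + ∫ x in {x | k < U x}, B x * (U x - k) ∂μ))
    (hSob : ∀ k, k₀ ≤ k → ∫ x in {x | k < U x}, (U x - k) ^ Q ∂μ ≤
      C₂ * (∫ x in {x | k < U x}, F x ∂μ) ^ (Q / p)) :
    ∃ K : ℝ, μ {x | K < U x} = 0 := by
  have hn : ∀ k : ℝ, NullMeasurableSet {x | k < U x} μ := fun k =>
    nullMeasurableSet_lt aemeasurable_const hU
  have hp0 : 0 < p := by linarith
  have hps0 : 0 < ps := by linarith
  have hQ0 : 0 < Q := by linarith
  have hs0 : 0 < s := by linarith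
  have hQ1 : 1 < Q := by linarith
  -- This is the power of the measure left over by Hölder's inequality in the term B(U - k). The
  -- hypothesis `hsQ` becomes σQ > p - 1, and in particular σ > 0.
  set σ : ℝ := 1 - 1 / s - 1 / Q with hσ
  have hσQ : p < (σ + 1 / Q) * Q := by rw [hσ]; convert hsQ using 2; ring
  have hσQ' : p - 1 < σ * Q := by
    rw [add_mul, one_div_mul_cancel hQ0.ne'] at hσQ; linarith
  have hσ0 : 0 < σ := by
    by_contra h
    nlinarith
  set p' : ℝ := p / (p - 1) with hp'
  have hp'0 : 0 < p' := div_pos hp0 (by linarith)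
  set T : ℝ → ℝ := fun k => ∫ x in {x | k < U x}, (U x - k) ^ Q ∂μ with hT
  set Φ : ℝ → ℝ := fun k => ∫ x in {x | k < U x}, F x ∂μ with hΦ
  set m : ℝ → ℝ := fun k => μ.real {x | k < U x} with hm
  have hT0 : ∀ k, 0 ≤ T k := fun k => by
    refine integral_nonneg_of_ae ?_
    filter_upwards [ae_restrict_mem₀ (hn k)] with x hx
    have : k < U x := hx
    exact Real.rpow_nonneg (by linarith) _
  have hΦ0 : ∀ k, 0 ≤ Φ k := fun k => integral_nonneg_of_ae (ae_restrict_of_ae hF0)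
  have hm0 : ∀ k, 0 ≤ m k := fun k => measureReal_nonneg
  have hTi : ∀ k, 0 ≤ k → IntegrableOn (fun x => (U x - k) ^ Q) {x | k < U x} μ := by
    intro k hk
    refine hUQ.integrableOn.mono' (((hU.sub_const k).pow_const Q).aestronglyMeasurable.restrict) ?_
    filter_upwards [ae_restrict_mem₀ (hn k)] with x hx
    have : k < U x := hx
    rw [Real.norm_of_nonneg (Real.rpow_nonneg (by linarith) _)]
    exact Real.rpow_le_rpow (by linarith) (by linarith) hQ0.le
  set D : ℝ := μ.real Set.univ ^ (1 - ps / Q) with hD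
  set N : ℝ := (∫ x, B x ^ s ∂μ) ^ (1 / s) with hN
  have hBn : ∀ᵐ x ∂μ, 0 ≤ B x ^ s := hB0.mono fun x hx => Real.rpow_nonneg hx _
  have hN0 : 0 ≤ N := Real.rpow_nonneg (integral_nonneg_of_ae hBn) _
  have hNk : ∀ k, (∫ x in {x | k < U x}, B x ^ s ∂μ) ^ (1 / s) ≤ N := fun k =>
    Real.rpow_le_rpow (integral_nonneg_of_ae (ae_restrict_of_ae hBn))
      (setIntegral_le_integral hB hBn) (by positivity)
  have huniv : ∀ k, (μ.restrict {x | k < U x}).real Set.univ = m k := fun k => by simp [hm]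
  have hps1 : ps / Q ≤ 1 := (div_le_one hQ0).2 hQ
  have I1 : ∀ k, 0 ≤ k → ∫ x in {x | k < U x}, U x ^ ps ∂μ ≤
      2 ^ ps * (T k ^ (ps / Q) * D + k ^ ps * m k) := by
    intro k hk
    refine (integral_rpow_le_of_split (μ := μ.restrict {x | k < U x}) hU.restrict hk hps0 hQ (ae_restrict_mem₀ (hn k)) (hTi k hk)
      hUps.integrableOn).trans ?_
    rw [huniv]
    have h1 : m k ^ (1 - ps / Q) ≤ D :=
      Real.rpow_le_rpow (hm0 k) (measureReal_mono (subset_univ _)) (by linarith)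
    have h2 : 0 ≤ T k ^ (ps / Q) := Real.rpow_nonneg (hT0 k) _
    exact mul_le_mul_of_nonneg_left (add_le_add_left (mul_le_mul_of_nonneg_left h1 h2) _)
      (by positivity)
  have I2 : ∀ k, ∫ x in {x | k < U x}, B x ∂μ ≤ N * m k ^ (1 - 1 / s) := by
    intro k
    have h1 := integral_rpow_le_rpow_integral_rpow hBm.restrict (ae_restrict_of_ae hB0) one_pos hs.le
      (hB.integrableOn (s := {x | k < U x}))
    simp only [Real.rpow_one] at h1
    rw [huniv] at h1
    exact h1.trans (mul_le_mul_of_nonneg_right (hNk k) (Real.rpow_nonneg (hm0 k) _))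
  have I3 : ∀ k, 0 ≤ k → ∫ x in {x | k < U x}, B x * (U x - k) ∂μ ≤
      T k ^ (1 / Q) * (N * m k ^ σ) := by
    intro k hk
    have h1 := integral_mul_le_of_holder (V := fun x => U x - k) hBm.restrict
      (hU.sub_const k).aestronglyMeasurable.restrict (ae_restrict_of_ae hB0)
      (s := s) (Q := Q) (by
        filter_upwards [ae_restrict_mem₀ (hn k)] with x hx
        have : k < U x := hx
        linarith) hs0 hQ1 (by linarith) (hB.integrableOn (s := {x | k < U x})) (hTi k hk)
    rw [huniv] at h1
    exact h1.trans (mul_le_mul_of_nonneg_left (mul_le_mul_of_nonneg_right (hNk k)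
      (Real.rpow_nonneg (hm0 k) _)) (Real.rpow_nonneg (hT0 k) _))
  have hTroot : ∀ k, k₀ ≤ k → ∀ r, 0 < r → T k ^ (r / Q) ≤ C₂ ^ (r / Q) * Φ k ^ (r / p) := by
    intro k hk r hr
    refine (Real.rpow_le_rpow (hT0 k) (hSob k hk) (by positivity)).trans (le_of_eq ?_)
    rw [Real.mul_rpow hC₂.le (Real.rpow_nonneg (hΦ0 k) _), ← Real.rpow_mul (hΦ0 k)]
    congr 2
    field_simp
  -- Splitting T^{ps/Q} as T^{(ps-p)/Q} T^{p/Q}, the second factor is bounded by the energy through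
  -- Sobolev and the first tends to 0. From k₁ on, the critical term is thus at most a quarter of
  -- the energy.
  have hTlim : Tendsto (fun k => C₁ * (2 ^ ps * (D * C₂ ^ (p / Q))) * T k ^ ((ps - p) / Q)) atTop
      (𝓝 0) := by
    have h1 : Tendsto T atTop (𝓝 0) := by
      refine tendsto_of_tendsto_of_tendsto_of_le_of_le' tendsto_const_nhds
        (tendsto_setIntegral_superlevel hU hUQ) (Eventually.of_forall hT0) ?_
      filter_upwards [eventually_ge_atTop 0] with k hk
      refine integral_mono_ae (hTi k hk) hUQ.integrableOn ?_
      filter_upwards [ae_restrict_mem₀ (hn k)] with x hx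
      have : k < U x := hx
      exact Real.rpow_le_rpow (by linarith) (by linarith) hQ0.le
    have h2 : 0 < (ps - p) / Q := div_pos (by linarith) hQ0
    have h3 := (h1.rpow_const (p := (ps - p) / Q) (Or.inr h2.le)).const_mul
      (C₁ * (2 ^ ps * (D * C₂ ^ (p / Q))))
    rwa [Real.zero_rpow h2.ne', mul_zero] at h3
  obtain ⟨k₁, hk₁⟩ := eventually_atTop.1
    (hTlim.eventually (ge_mem_nhds (show (0 : ℝ) < 1 / 4 by norm_num)))
  set E : ℝ := (4 * (C₁ * (C₂ ^ (1 / Q) * N))) ^ p' with hE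
  have hE0 : 0 ≤ E := Real.rpow_nonneg (by positivity) _
  -- `J1` and `J3` each cost a quarter of Φ k; absorbing both produces the factor 2.
  have main : ∀ k, k₀ ≤ k → k₁ ≤ k → 0 ≤ k → Φ k ≤
      2 * (C₁ * 2 ^ ps * (k ^ ps * m k) + C₁ * N * m k ^ (1 - 1 / s) + E * m k ^ (σ * p')) := by
    intro k hk hkk₁ hk0
    have hmσ : 0 ≤ m k ^ σ := Real.rpow_nonneg (hm0 k) _
    have J1 : C₁ * (2 ^ ps * (T k ^ (ps / Q) * D)) ≤ 1 / 4 * Φ k := by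
      have e : T k ^ (ps / Q) = T k ^ ((ps - p) / Q) * T k ^ (p / Q) := by
        rw [← Real.rpow_add_of_nonneg (hT0 k) (div_nonneg (by linarith) hQ0.le) (by positivity)]
        congr 1; ring
      have h1 := hTroot k hk p hp0
      rw [div_self hp0.ne', Real.rpow_one] at h1
      have hTn : 0 ≤ T k ^ ((ps - p) / Q) := Real.rpow_nonneg (hT0 k) _
      calc C₁ * (2 ^ ps * (T k ^ (ps / Q) * D))
          = C₁ * (2 ^ ps * (T k ^ ((ps - p) / Q) * T k ^ (p / Q) * D)) := by rw [e]
        _ ≤ C₁ * (2 ^ ps * (T k ^ ((ps - p) / Q) * (C₂ ^ (p / Q) * Φ k) * D)) := by gcongr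
        _ = (C₁ * (2 ^ ps * (D * C₂ ^ (p / Q))) * T k ^ ((ps - p) / Q)) * Φ k := by ring
        _ ≤ _ := mul_le_mul_of_nonneg_right (hk₁ k hkk₁) (hΦ0 k)
    have J3 : C₁ * (T k ^ (1 / Q) * (N * m k ^ σ)) ≤ 1 / 4 * Φ k + E * m k ^ (σ * p') := by
      have h1 := hTroot k hk 1 one_pos
      calc C₁ * (T k ^ (1 / Q) * (N * m k ^ σ))
          ≤ C₁ * (C₂ ^ (1 / Q) * Φ k ^ (1 / p) * (N * m k ^ σ)) := by gcongr
        _ = Φ k ^ (1 / p) * (C₁ * (C₂ ^ (1 / Q) * N) * m k ^ σ) := by ring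
        _ ≤ 1 / 4 * Φ k + (4 * (C₁ * (C₂ ^ (1 / Q) * N) * m k ^ σ)) ^ p' :=
          young_absorb hp (hΦ0 k) (by positivity)
        _ = _ := by
          rw [← mul_assoc, Real.mul_rpow (by positivity) hmσ, ← Real.rpow_mul (hm0 k)]
    have h1 := hCacc k hk
    have h2 : C₁ * (∫ x in {x | k < U x}, U x ^ ps ∂μ + ∫ x in {x | k < U x}, B x ∂μ
        + ∫ x in {x | k < U x}, B x * (U x - k) ∂μ) ≤
        C₁ * (2 ^ ps * (T k ^ (ps / Q) * D + k ^ ps * m k) + N * m k ^ (1 - 1 / s)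
          + T k ^ (1 / Q) * (N * m k ^ σ)) :=
      mul_le_mul_of_nonneg_left (add_le_add (add_le_add (I1 k hk0) (I2 k)) (I3 k hk0)) hC₁.le
    have h3 : Φ k ≤ _ := h1.trans h2
    linarith
  -- This is the smallest power of the measure on the right of `main`. That θQ/p > 1, i.e. that the
  -- recursion is superlinear, follows from `hsQ` for both members of the minimum.
  set θ : ℝ := min (1 - 1 / s) (σ * p') with hθ
  have h1s : 0 < 1 - 1 / s := by
    have : 1 / s < 1 := (div_lt_one hs0).2 hs
    linarith
  have hθ0 : 0 < θ := lt_min h1s (by positivity)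
  have hθ1 : θ ≤ 1 := (min_le_left _ _).trans (by
    have : 0 < 1 / s := by positivity
    linarith)
  have hθQ : 1 < θ * (Q / p) := by
    rw [hθ, min_mul_of_nonneg _ _ (by positivity), lt_min_iff]
    constructor
    · rw [← mul_div_assoc, one_lt_div hp0]; exact hsQ
    · have e : σ * p' * (Q / p) = σ * Q / (p - 1) := by
        rw [hp']
        have : p - 1 ≠ 0 := by linarith
        field_simp
      rw [e, one_lt_div (by linarith)]; exact hσQ'
  set G : ℝ := 2 * (C₁ * 2 ^ ps * 2 ^ ps + C₁ * N + E) with hG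
  have hG0 : 0 < G := by positivity
  refine exists_measure_superlevel_eq_zero hU (C := C₂ * G ^ (Q / p)) (Q := Q)
    (α := θ * (Q / p) - 1) (k₀ := max k₀ k₁) (by positivity) hQ0 (by linarith) hUQ ?_
  intro K hK hK1 k h hKk hkh hh hy1
  have hKk₀ : k₀ ≤ k := (le_max_left _ _).trans (hK.trans hKk)
  have hKk₁ : k₁ ≤ k := (le_max_right _ _).trans (hK.trans hKk)
  have hk0 : 0 ≤ k := by linarith
  have hK0 : 0 < K := by linarith
  change K ^ Q * m k ≤ 1 at hy1
  change _ ≤ _ * (K ^ Q * m k) ^ _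
  -- The factor k^ps forbids a bound by m k alone with a constant independent of K. As k ≤ 2K, K ≥ 1
  -- and ps ≤ Q, it is absorbed in the weight K^Q, and y ≤ 1 lets θ dominate all the exponents.
  set y : ℝ := K ^ Q * m k with hy
  have hy0 : 0 ≤ y := mul_nonneg (by positivity) (hm0 k)
  have hmy : m k ≤ y := le_mul_of_one_le_left (hm0 k) (Real.one_le_rpow hK1 hQ0.le)
  have hyθ : ∀ r, θ ≤ r → y ^ r ≤ y ^ θ := fun r hr =>
    Real.rpow_le_rpow_of_exponent_ge' hy0 hy1 hθ0.le hr
  have hΦy : Φ k ≤ G * y ^ θ := by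
    have e1 : k ^ ps * m k ≤ 2 ^ ps * y ^ θ := by
      calc k ^ ps * m k ≤ (2 * K) ^ ps * m k := by
            have := Real.rpow_le_rpow hk0 (hkh.le.trans hh) hps0.le
            exact mul_le_mul_of_nonneg_right this (hm0 k)
        _ = 2 ^ ps * (K ^ ps * m k) := by rw [Real.mul_rpow zero_le_two hK0.le]; ring
        _ ≤ 2 ^ ps * y := by
            have := Real.rpow_le_rpow_of_exponent_le hK1 hQ
            exact mul_le_mul_of_nonneg_left (mul_le_mul_of_nonneg_right this (hm0 k)) (by positivity)
        _ ≤ 2 ^ ps * y ^ θ := by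
            have := hyθ 1 hθ1
            rw [Real.rpow_one] at this
            gcongr
    have e2 : m k ^ (1 - 1 / s) ≤ y ^ θ :=
      (Real.rpow_le_rpow (hm0 k) hmy h1s.le).trans (hyθ _ (min_le_left _ _))
    have e3 : m k ^ (σ * p') ≤ y ^ θ :=
      (Real.rpow_le_rpow (hm0 k) hmy (by positivity)).trans (hyθ _ (min_le_right _ _))
    calc Φ k ≤ 2 * (C₁ * 2 ^ ps * (k ^ ps * m k) + C₁ * N * m k ^ (1 - 1 / s)
          + E * m k ^ (σ * p')) := main k hKk₀ hKk₁ hk0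
      _ ≤ 2 * (C₁ * 2 ^ ps * (2 ^ ps * y ^ θ) + C₁ * N * y ^ θ + E * y ^ θ) := by gcongr
      _ = G * y ^ θ := by rw [hG]; ring
  calc (h - k) ^ Q * μ.real {x | h < U x} ≤ T k :=
        rpow_mul_measureReal_superlevel_le hU hQ0 hkh (hTi k hk0)
    _ ≤ C₂ * Φ k ^ (Q / p) := hSob k hKk₀
    _ ≤ C₂ * (G * y ^ θ) ^ (Q / p) := by
        have := Real.rpow_le_rpow (hΦ0 k) hΦy (by positivity : 0 ≤ Q / p)
        gcongr
    _ = C₂ * G ^ (Q / p) * y ^ (1 + (θ * (Q / p) - 1)) := by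
        rw [Real.mul_rpow hG0.le (Real.rpow_nonneg hy0 _), ← Real.rpow_mul hy0, add_sub_cancel]
        ring

end DeGiorgi

/-! ### Finite energy, Sobolev on superlevel sets, and growth of b. -/

section Energy

variable {n : ℕ} {Ω : Set (EuclideanSpace ℝ (Fin n))}
  {f : EuclideanSpace ℝ (Fin n) → ℝ → EuclideanSpace ℝ (Fin n) → ℝ}
  {u : EuclideanSpace ℝ (Fin n) → ℝ} {Du : EuclideanSpace ℝ (Fin n) → EuclideanSpace ℝ (Fin n)}

theorem MemW1F.integrable_energy (hΩ : MeasurableSet Ω) (hf : IsConvexEnergyIntegrand Ω f)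
    (hu : MemW1F Ω f u Du) :
    Integrable (fun x => f x (u x) (Du x)) (volume.restrict Ω) := by
  have hm := hf.caratheodory.aestronglyMeasurable_comp hu.memW11.memLp.1 hu.memW11.memLp_grad.1
  refine (lintegral_ofReal_ne_top_iff_integrable hm ?_).1 hu.finite_energy.ne
  filter_upwards [ae_restrict_mem hΩ] with x hx using hf.nonneg x hx _ _

/-- Coercivity upgrades the L¹ gradient of a function of finite energy to L^p. -/
theorem MemW1F.memLp_grad (hΩ : MeasurableSet Ω) (hf : IsConvexEnergyIntegrand Ω f) {p : ℝ}
    (hp : 0 < p) (hc : Coercive Ω p f) (hu : MemW1F Ω f u Du) :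
    MemLp Du (ENNReal.ofReal p) (volume.restrict Ω) := by
  obtain ⟨c, hc0, hc⟩ := hc
  have hDm := hu.memW11.memLp_grad.1
  rw [← integrable_norm_rpow_iff hDm (by simpa using hp) ENNReal.ofReal_ne_top,
    ENNReal.toReal_ofReal hp.le]
  refine ((hu.integrable_energy hΩ hf).const_mul c⁻¹).mono'
    (hDm.norm.aemeasurable.pow_const p).aestronglyMeasurable ?_
  filter_upwards [hc] with x hx
  rw [Real.norm_of_nonneg (by positivity), inv_mul_eq_div, le_div_iff₀' hc0]
  exact hx _ _

/-- The Sobolev inequality for truncations in terms of the superlevel sets. -/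
theorem exists_setIntegral_superlevel_le (hn : 0 < n) (hΩ : MeasurableSet Ω)
    [IsFiniteMeasure (volume.restrict Ω)] {p r Q k₀ : ℝ} (hr : 1 ≤ r) (hrp : r ≤ p) (hQ : 0 < Q)
    (hrQ : Q⁻¹ = r⁻¹ - (n : ℝ)⁻¹) (hk₀ : 0 ≤ k₀)
    (hum : AEStronglyMeasurable u (volume.restrict Ω))
    (hDu : MemLp Du (ENNReal.ofReal p) (volume.restrict Ω))
    (h : ∀ k, k₀ ≤ k →
      MemW10 Ω (ENNReal.ofReal p) (fun x => excess k (u x)) (fun x => levelInd k (u x) • Du x)) :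
    Integrable (fun x => |u x| ^ Q) (volume.restrict Ω) ∧
    ∃ C : ℝ, 0 < C ∧ ∀ k, k₀ ≤ k →
      ∫ x in {x | k < |u x|}, (|u x| - k) ^ Q ∂(volume.restrict Ω) ≤
        C * ((∫ x in {x | k < |u x|}, ‖Du x‖ ^ p ∂(volume.restrict Ω)) ^ (Q / p) *
          (volume.restrict Ω).real {x | k < |u x|} ^ ((1 - r / p) * (Q / r))) := by
  set μ := volume.restrict Ω with hμ
  have hr0 : 0 < r := by linarith
  have hp0 : 0 < p := by linarith
  have hU : AEMeasurable (fun x => |u x|) μ := hum.norm.aemeasurable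
  have hn' : ∀ k : ℝ, NullMeasurableSet {x | k < |u x|} μ := fun k =>
    nullMeasurableSet_lt aemeasurable_const hU
  obtain ⟨C, hC0, hC⟩ := MemW10.exists_eLpNorm_le hn hr hQ hrQ
  have hDr : ∀ k, MemLp (fun x => levelInd k (u x) • Du x) (ENNReal.ofReal r) μ := fun k => by
    refine MemLp.mono (hDu.mono_exponent (ENNReal.ofReal_le_ofReal hrp)) ?_
      (Eventually.of_forall fun x => ?_)
    · exact ((measurable_levelInd k).comp_aemeasurable hum.aemeasurable).aestronglyMeasurable.smul
        hDu.1
    · rw [norm_smul]; exact mul_le_of_le_one_left (norm_nonneg _) (abs_levelInd_le _ _)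
  have hle : ∀ k, k₀ ≤ k → eLpNorm (fun x => excess k (u x)) (ENNReal.ofReal Q) μ
      ≤ ENNReal.ofReal C * eLpNorm (fun x => levelInd k (u x) • Du x) (ENNReal.ofReal r) μ :=
    fun k hk => hC hΩ (ENNReal.ofReal_le_ofReal hrp) (h k hk)
  have hex : ∀ k, k₀ ≤ k → MemLp (fun x => excess k (u x)) (ENNReal.ofReal Q) μ := fun k hk =>
    ⟨(continuous_excess k).comp_aestronglyMeasurable hum,
      (hle k hk).trans_lt (ENNReal.mul_lt_top ENNReal.ofReal_lt_top (hDr k).2)⟩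
  have hQ' : ENNReal.ofReal Q ≠ 0 := by simpa using hQ
  have hr' : ENNReal.ofReal r ≠ 0 := by simpa using hr0
  constructor
  · have h1 : MemLp u (ENNReal.ofReal Q) μ := by
      -- Sobolev's inequality controls the truncation only; u itself follows from |u| ≤ (|u| - k₀)⁺
      -- + k₀ on a finite measure.
      refine ((hex k₀ le_rfl).norm.add (memLp_const k₀)).mono hum (Eventually.of_forall fun x => ?_)
      have h2 := abs_excess hk₀ (u x)
      have h3 := le_max_left (|u x| - k₀) 0
      rw [Pi.add_apply, Real.norm_eq_abs, Real.norm_eq_abs, Real.norm_eq_abs, h2]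
      exact le_trans (by linarith) (le_abs_self _)
    have h2 := (integrable_norm_rpow_iff hum hQ' ENNReal.ofReal_ne_top).2 h1
    simpa [ENNReal.toReal_ofReal hQ.le] using h2
  · refine ⟨C ^ Q + 1, by positivity, fun k hk => ?_⟩
    have hk0 : 0 ≤ k := hk₀.trans hk
    have e1 : ∫ x, ‖excess k (u x)‖ ^ Q ∂μ = ∫ x in {x | k < |u x|}, (|u x| - k) ^ Q ∂μ := by
      rw [← integral_indicator₀ (hn' k)]
      refine integral_congr_ae (Eventually.of_forall fun x => ?_)
      simp only [Real.norm_eq_abs, abs_excess hk0]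
      by_cases hx : k < |u x|
      · simp [hx, max_eq_left (sub_nonneg.2 hx.le)]
      · simp [hx, max_eq_right (sub_nonpos.2 (not_lt.1 hx)), Real.zero_rpow hQ.ne']
    have e2 : ∫ x, ‖levelInd k (u x) • Du x‖ ^ r ∂μ = ∫ x in {x | k < |u x|}, ‖Du x‖ ^ r ∂μ := by
      rw [← integral_indicator₀ (hn' k)]
      refine integral_congr_ae (Eventually.of_forall fun x => ?_)
      by_cases hx : k < |u x|
      · simp [hx, levelInd_of_lt hx]
      · simp [hx, levelInd_of_le (not_lt.1 hx), Real.zero_rpow hr0.ne']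
    have hI1 : 0 ≤ ∫ x in {x | k < |u x|}, (|u x| - k) ^ Q ∂μ := by
      rw [← e1]; positivity
    have hI2 : 0 ≤ ∫ x in {x | k < |u x|}, ‖Du x‖ ^ r ∂μ := by positivity
    have hI3 : 0 ≤ ∫ x in {x | k < |u x|}, ‖Du x‖ ^ p ∂μ := by positivity
    have h1 := hle k hk
    rw [(hex k hk).eLpNorm_eq_integral_rpow_norm hQ' ENNReal.ofReal_ne_top,
      (hDr k).eLpNorm_eq_integral_rpow_norm hr' ENNReal.ofReal_ne_top,
      ENNReal.toReal_ofReal hQ.le, ENNReal.toReal_ofReal hr0.le, ← ENNReal.ofReal_mul hC0,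
      ENNReal.ofReal_le_ofReal_iff (by positivity), e1, e2] at h1
    have h2 := Real.rpow_le_rpow (by positivity) h1 hQ.le
    rw [← Real.rpow_mul hI1, inv_mul_cancel₀ hQ.ne', Real.rpow_one,
      Real.mul_rpow hC0 (by positivity), ← Real.rpow_mul hI2] at h2
    -- Passing from the L^r to the L^p norm of Du on the superlevel set produces the extra power of
    -- its measure. That power is trivial when r = p and carries the whole decay when p > n.
    have h3 := integral_rpow_le_rpow_integral_rpow (μ := μ.restrict {x | k < |u x|})
      (g := fun x => ‖Du x‖) hDu.1.norm.restrict (Eventually.of_forall fun x => norm_nonneg _)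
      hr0 hrp (by
        have := ((integrable_norm_rpow_iff hDu.1 (by simpa using hp0) ENNReal.ofReal_ne_top).2 hDu)
        rw [ENNReal.toReal_ofReal hp0.le] at this
        exact this.integrableOn)
    have e3 : (μ.restrict {x | k < |u x|}).real Set.univ = μ.real {x | k < |u x|} := by simp
    rw [e3] at h3
    have h4 := Real.rpow_le_rpow hI2 h3 (show 0 ≤ r⁻¹ * Q by positivity)
    rw [Real.mul_rpow (by positivity) (by positivity), ← Real.rpow_mul hI3,
      ← Real.rpow_mul measureReal_nonneg] at h4
    have e4 : r / p * (r⁻¹ * Q) = Q / p := by field_simp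
    have e5 : r⁻¹ * Q = Q / r := by rw [inv_mul_eq_div]
    rw [e4, e5] at h4
    rw [e5] at h2
    refine h2.trans ?_
    refine (mul_le_mul_of_nonneg_left h4 (by positivity)).trans ?_
    gcongr
    linarith

/-- Young's inequality with exponents P' and P, where (1 - 1/P)P' = 1. It matches the exponent 1 -
1/p* in the growth conditions, so that f^{1-1/p*}|u| is controlled by f + |u|^{p*}. -/
theorem rpow_mul_le_add {a v P : ℝ} (ha : 0 ≤ a) (hv : 0 ≤ v) (hP : 1 < P) :
    a ^ (1 - 1 / P) * v ≤ a + v ^ P := by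
  have hc : P.HolderConjugate (Real.conjExponent P) := Real.HolderConjugate.conjExponent hP
  have h := Real.young_inequality_of_nonneg (Real.rpow_nonneg ha (1 - 1 / P)) hv hc.symm
  have e : (1 - 1 / P) * Real.conjExponent P = 1 := by
    have := hc.inv_add_inv_eq_one
    have h1 : Real.conjExponent P ≠ 0 := hc.symm.ne_zero
    have h2 : 1 - 1 / P = (Real.conjExponent P)⁻¹ := by rw [one_div]; linarith
    rw [h2, inv_mul_cancel₀ h1]
  rw [← Real.rpow_mul ha, e, Real.rpow_one] at h
  refine h.trans (add_le_add ?_ ?_)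
  · exact div_le_self ha hc.symm.lt.le
  · exact div_le_self (by positivity) hP.le

/-- This is `young_absorb` at the exponent P', whose conjugate is P. The small coefficient allows
the energy term to be absorbed. -/
theorem rpow_mul_le_quarter_add {a v P : ℝ} (ha : 0 ≤ a) (hv : 0 ≤ v) (hP : 1 < P) :
    a ^ (1 - 1 / P) * v ≤ 1 / 4 * a + (4 * v) ^ P := by
  have hc : P.HolderConjugate (P / (P - 1)) := Real.HolderConjugate.conjExponent hP
  have h := young_absorb hc.symm.lt ha hv
  have hP1 : P - 1 ≠ 0 := by linarith
  have hP0 : P ≠ 0 := by linarith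
  have e1 : 1 / (P / (P - 1)) = 1 - 1 / P := by field_simp
  have e2 : P / (P - 1) / (P / (P - 1) - 1) = P := by field_simp; ring
  rwa [e1, e2] at h

theorem abs_rpow_sub_one_mul_abs {t P : ℝ} (hP : 1 < P) : |t| ^ (P - 1) * |t| = |t| ^ P := by
  rw [← Real.rpow_add_one' (abs_nonneg t) (by linarith), sub_add_cancel]

/-- The unilateral bounds shared by the two growth conditions on the right-hand side. -/
theorem exists_growth_bounds {p ps : ℝ} (hps : 1 < ps)
    {b : EuclideanSpace ℝ (Fin n) → ℝ → EuclideanSpace ℝ (Fin n) → ℝ} (hΩ : MeasurableSet Ω)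
    (hf : IsConvexEnergyIntegrand Ω f) (hc : Coercive Ω p f)
    (hb : UnilateralGrowth Ω p ps f b ∨ AbsGrowth Ω p ps f b) :
    ∃ (c ε : ℝ) (b₃ b₄ : EuclideanSpace ℝ (Fin n) → ℝ), 0 ≤ c ∧ 0 < ε ∧
      (∀ᵐ x ∂(volume.restrict Ω), 0 ≤ b₃ x) ∧ (∀ᵐ x ∂(volume.restrict Ω), 0 ≤ b₄ x) ∧
      MemLp b₃ (ENNReal.ofReal (n / p + ε)) (volume.restrict Ω) ∧
      IntegrableOn b₄ Ω volume ∧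
      ∀ᵐ x ∂(volume.restrict Ω), ∀ u ξ,
        -(c * (f x u ξ ^ (1 - 1 / ps) + |u| ^ (ps - 1)) + b₃ x) ≤ Real.sign u * b x u ξ ∧
        u * b x u ξ ≤ c * (f x u ξ + 2 * |u| ^ ps) + b₄ x + b₃ x * |u| := by
  have h1ps : 0 ≤ 1 - 1 / ps := by
    have : 1 / ps ≤ 1 := (div_le_one (by linarith)).2 hps.le
    linarith
  rcases hb with ⟨c₇, c₈, ε, b₃, b₄, hc₇, hc₈, hε, hb₃, hb₄, hb₃m, hb₄i, h⟩ |
    ⟨c₉, ε, b₃, hc₉, hε, hb₃, hb₃m, h⟩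
  · obtain ⟨c₅, hc₅, hco⟩ := hc
    set d : ℝ := (c₅⁻¹) ^ (1 - 1 / ps) with hd
    have hd0 : 0 ≤ d := by positivity
    refine ⟨c₇ * (1 + d) + c₈, ε, b₃, b₄, by positivity, hε, hb₃, hb₄, hb₃m, hb₄i, ?_⟩
    filter_upwards [h, hco, hb₃, ae_restrict_mem hΩ] with x hx hcx hbx hxΩ u ξ
    obtain ⟨h1, h2⟩ := hx u ξ
    have hF := hf.nonneg x hxΩ u ξ
    have hfp : 0 ≤ f x u ξ ^ (1 - 1 / ps) := Real.rpow_nonneg hF _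
    have hup : 0 ≤ |u| ^ (ps - 1) := by positivity
    have hup' : 0 ≤ |u| ^ ps := by positivity
    -- Coercivity makes the explicit power of ξ in the unilateral condition redundant: it is
    -- dominated by f^{1-1/p*}.
    have h3 : ‖ξ‖ ^ (p * (1 - 1 / ps)) ≤ d * f x u ξ ^ (1 - 1 / ps) := by
      rw [Real.rpow_mul (norm_nonneg _), hd, ← Real.mul_rpow (by positivity) hF]
      refine Real.rpow_le_rpow (by positivity) ?_ h1ps
      rw [inv_mul_eq_div, le_div_iff₀' hc₅]
      exact hcx u ξ
    constructor
    · refine le_trans ?_ h1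
      have h4 := mul_le_mul_of_nonneg_left h3 hc₇.le
      have h5 : 0 ≤ c₇ * d * |u| ^ (ps - 1) := by positivity
      have h6 : 0 ≤ c₈ * (f x u ξ ^ (1 - 1 / ps) + |u| ^ (ps - 1)) := by positivity
      linarith
    · refine h2.trans ?_
      have h4 : 0 ≤ c₇ * (1 + d) * (f x u ξ + 2 * |u| ^ ps) := by positivity
      have h5 : 0 ≤ b₃ x * |u| := by positivity
      have h6 : 0 ≤ c₈ * |u| ^ ps := by positivity
      linarith
  · refine ⟨c₉, ε, b₃, fun _ => 0, hc₉, hε, hb₃, Eventually.of_forall fun _ => le_rfl, hb₃m,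
      integrable_zero _ _ _, ?_⟩
    filter_upwards [h, hb₃, ae_restrict_mem hΩ] with x hx hbx hxΩ u ξ
    have h1 := hx u ξ
    have hF := hf.nonneg x hxΩ u ξ
    constructor
    · have h2 : |Real.sign u * b x u ξ| ≤ |b x u ξ| := by
        rw [abs_mul]
        refine mul_le_of_le_one_left (abs_nonneg _) ?_
        rcases Real.sign_apply_eq u with h | h | h <;> simp [h]
      exact (abs_le.1 (h2.trans h1)).1
    · have h2 := mul_le_mul_of_nonneg_right h1 (abs_nonneg u)
      -- Under the two-sided condition the upper bound on u b comes from Young's inequality. This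
      -- accounts for the coefficient 2 and the term b₃|u| in the common form.
      have h3 := rpow_mul_le_add hF (abs_nonneg u) hps
      have h4 := abs_rpow_sub_one_mul_abs (t := u) hps
      calc u * b x u ξ ≤ |b x u ξ| * |u| := by
            rw [← abs_mul, mul_comm]; exact le_abs_self _
        _ ≤ (c₉ * (f x u ξ ^ (1 - 1 / ps) + |u| ^ (ps - 1)) + b₃ x) * |u| := h2
        _ = c₉ * (f x u ξ ^ (1 - 1 / ps) * |u| + |u| ^ (ps - 1) * |u|) + b₃ x * |u| := by ring
        _ ≤ c₉ * ((f x u ξ + |u| ^ ps) + |u| ^ ps) + b₃ x * |u| := by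
            rw [h4]; gcongr
        _ = _ := by ring

end Energy

/-! ### Truncations as test functions and the Caccioppoli inequality. -/

section WeakSolutions

variable {n : ℕ} {Ω : Set (EuclideanSpace ℝ (Fin n))}
  {f : EuclideanSpace ℝ (Fin n) → ℝ → EuclideanSpace ℝ (Fin n) → ℝ}
  {a : EuclideanSpace ℝ (Fin n) → ℝ → EuclideanSpace ℝ (Fin n) → EuclideanSpace ℝ (Fin n)}
  {b : EuclideanSpace ℝ (Fin n) → ℝ → EuclideanSpace ℝ (Fin n) → ℝ}
  {u u₀ : EuclideanSpace ℝ (Fin n) → ℝ}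
  {Du Du₀ : EuclideanSpace ℝ (Fin n) → EuclideanSpace ℝ (Fin n)}

/-- Truncations of a function of finite energy have finite energy. -/
theorem memW1F0_excess (hΩ : MeasurableSet Ω) [IsFiniteMeasure (volume.restrict Ω)] {p : ℝ}
    (hp : 1 ≤ p) (hf : IsConvexEnergyIntegrand Ω f) (hδ : TwoSidedDeltaTwo Ω f)
    (hmono : QuasiMonotone Ω f) (hu : MemW1F Ω f u Du) {k : ℝ} (hk : 0 ≤ k)
    (h : MemW10 Ω (ENNReal.ofReal p) (fun x => excess k (u x))
      (fun x => levelInd k (u x) • Du x)) :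
    MemW1F0 Ω p f (fun x => excess k (u x)) (fun x => levelInd k (u x) • Du x) := by
  have hp1 : 1 ≤ ENNReal.ofReal p := by simpa using hp
  refine ⟨⟨⟨h.memW1.isWeakGradient, h.memW1.memLp.mono_exponent hp1,
    h.memW1.memLp_grad.mono_exponent hp1⟩, ?_⟩, h⟩
  obtain ⟨c, hc, hmono⟩ := hmono
  have hi := (hu.integrable_energy hΩ hf).const_mul c
  refine lt_of_le_of_lt (lintegral_mono_ae ?_) hi.lintegral_lt_top
  filter_upwards [hmono, ae_restrict_mem hΩ] with x hx hxΩ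
  refine ENNReal.ofReal_le_ofReal ?_
  -- Where |u| ≤ k the gradient is 0 and so is f. Elsewhere the gradient is unchanged and |excess| ≤
  -- |u|, so quasi-monotonicity applies.
  rcases le_or_gt |u x| k with hux | hux
  · rw [levelInd_of_le hux, zero_smul, hδ.apply_zero hxΩ _ (hf.nonneg x hxΩ _ _)]
    exact mul_nonneg hc.le (hf.nonneg x hxΩ _ _)
  · rw [levelInd_of_lt hux, one_smul]
    refine hx _ _ _ ?_
    rw [abs_excess hk]
    exact max_le (by linarith) (abs_nonneg _)

/-- The Caccioppoli inequality on the superlevel sets of a weak solution. -/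
theorem IsWeakSolution.exists_caccioppoli (hΩ : MeasurableSet Ω) [IsFiniteMeasure (volume.restrict Ω)]
    {p ps k₀ : ℝ} (hp : 1 < p) (hps : 1 < ps)
    (hf : IsConvexEnergyIntegrand Ω f) (hδ : TwoSidedDeltaTwo Ω f)
    (hmono : QuasiMonotone Ω f) (ha : IsCaratheodory Ω a) (hb : IsCaratheodory Ω b)
    {c₁ c₂ c₃ c₄ c : ℝ} {b₁ b₂ b₃ b₄ : EuclideanSpace ℝ (Fin n) → ℝ}
    (hc₁ : 0 < c₁) (hc₂ : 0 ≤ c₂) (hc₃ : 0 < c₃) (hc₄ : 0 ≤ c₄) (hc : 0 ≤ c)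
    (hb₁ : IntegrableOn b₁ Ω volume) (hb₂ : IntegrableOn b₂ Ω volume)
    (hb₃ : IntegrableOn b₃ Ω volume) (hb₄ : IntegrableOn b₄ Ω volume)
    (hb₃0 : ∀ᵐ x ∂(volume.restrict Ω), 0 ≤ b₃ x) (hb₄0 : ∀ᵐ x ∂(volume.restrict Ω), 0 ≤ b₄ x)
    (hcomp : ∀ᵐ x ∂(volume.restrict Ω), ∀ u ξ,
      c₁ * inner ℝ (gradXi f x u ξ) ξ - c₂ * |u| ^ ps - b₁ x ≤ inner ℝ (a x u ξ) ξ ∧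
      inner ℝ (a x u ξ) ξ ≤ c₃ * inner ℝ (gradXi f x u ξ) ξ + c₄ * |u| ^ ps + b₂ x)
    (hgrowth : ∀ᵐ x ∂(volume.restrict Ω), ∀ u ξ,
        -(c * (f x u ξ ^ (1 - 1 / ps) + |u| ^ (ps - 1)) + b₃ x) ≤ Real.sign u * b x u ξ ∧
        u * b x u ξ ≤ c * (f x u ξ + 2 * |u| ^ ps) + b₄ x + b₃ x * |u|)
    (hu : IsWeakSolution Ω p f a b u₀ Du₀ u Du)
    (hups : Integrable (fun x => |u x| ^ ps) (volume.restrict Ω))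
    (hBu : Integrable (fun x => (|b₁ x| + b₃ x) * |u x|) (volume.restrict Ω)) (hk₀ : 0 ≤ k₀)
    (h : ∀ k, k₀ ≤ k →
      MemW10 Ω (ENNReal.ofReal p) (fun x => excess k (u x)) (fun x => levelInd k (u x) • Du x)) :
    ∃ C : ℝ, 0 < C ∧ ∀ k, k₀ ≤ k →
      ∫ x in {x | k < |u x|}, f x (u x) (Du x) ∂(volume.restrict Ω) ≤
        C * (∫ x in {x | k < |u x|}, |u x| ^ ps ∂(volume.restrict Ω)
          + ∫ x in {x | k < |u x|}, (|b₁ x| + b₃ x) ∂(volume.restrict Ω)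
          + ∫ x in {x | k < |u x|}, (|b₁ x| + b₃ x) * (|u x| - k) ∂(volume.restrict Ω)) := by
  obtain ⟨M, hM, hgrad⟩ := hf.ae_le_inner_gradXi hΩ hδ
  set μ := volume.restrict Ω with hμ
  have um := hu.memW1F.memW11.memLp.1
  have Dum := hu.memW1F.memW11.memLp_grad.1
  have hFi := hu.memW1F.integrable_energy hΩ hf
  have hU : AEMeasurable (fun x => |u x|) μ := um.norm.aemeasurable
  have hn' : ∀ k : ℝ, NullMeasurableSet {x | k < |u x|} μ := fun k =>
    nullMeasurableSet_lt aemeasurable_const hU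
  have hBi : Integrable (fun x => |b₁ x| + b₃ x) μ := hb₁.norm.add hb₃
  have hb₃u : Integrable (fun x => b₃ x * |u x|) μ := by
    refine hBu.mono' (hb₃.1.mul um.norm) ?_
    filter_upwards [hb₃0] with x hx
    rw [Real.norm_of_nonneg (by positivity)]
    gcongr
    linarith [abs_nonneg (b₁ x)]
  set d : ℝ := (4 * (c / c₁)) ^ ps with hd
  have hd0 : 0 ≤ d := by positivity
  refine ⟨4 / (3 * c₁) * (c₂ + c₁ * d + c + 1), by positivity, fun k hk => ?_⟩
  have hk0 : 0 ≤ k := hk₀.trans hk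
  have hmem := memW1F0_excess hΩ hp.le hf hδ hmono hu.memW1F hk0 (h k hk)
  -- There is no bound on |a|, but the test gradient is Du times 0 or 1, and (a, Du) is bounded on
  -- both sides by integrable functions.
  have i1 : Integrable (fun x => inner ℝ (a x (u x) (Du x)) (levelInd k (u x) • Du x)) μ := by
    refine (((((hFi.const_mul (c₃ * M)).add (hups.const_mul (c₂ + c₄))).add hb₁.norm).add
      hb₂.norm)).mono' ((ha.aestronglyMeasurable_comp um Dum).inner
        hmem.memW1F.memW11.memLp_grad.1) ?_
    filter_upwards [hcomp, hgrad, ae_restrict_mem hΩ] with x hx hgx hxΩ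
    obtain ⟨h1, h2⟩ := hx (u x) (Du x)
    obtain ⟨h3, h4⟩ := hgx (u x) (Du x)
    have hF := hf.nonneg x hxΩ (u x) (Du x)
    have hup : 0 ≤ |u x| ^ ps := by positivity
    have h5 := neg_abs_le (b₁ x)
    have h6 := le_abs_self (b₂ x)
    have h6' := abs_nonneg (b₂ x)
    have h5' := le_abs_self (b₁ x)
    have h5'' := abs_nonneg (b₁ x)
    have h7 : 0 ≤ c₁ * inner ℝ (gradXi f x (u x) (Du x)) (Du x) :=
      mul_nonneg hc₁.le (hF.trans h3)
    have h8 := mul_le_mul_of_nonneg_left h4 hc₃.le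
    have h9 : 0 ≤ c₃ * M * f x (u x) (Du x) := by positivity
    have h10 : 0 ≤ c₂ * |u x| ^ ps := by positivity
    have h11 : 0 ≤ c₄ * |u x| ^ ps := by positivity
    simp only [Pi.add_apply, Real.norm_eq_abs]
    rw [inner_smul_right, abs_mul]
    refine (mul_le_of_le_one_left (abs_nonneg _) (abs_levelInd_le _ _)).trans ?_
    rw [abs_le]
    constructor <;> linarith
  have hbφ : ∀ x, k < |u x| → b x (u x) (Du x) * excess k (u x) =
      Real.sign (u x) * b x (u x) (Du x) * (|u x| - k) := by
    intro x hx
    rw [excess_eq_of_lt hk0 hx]; ring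
  have i2 : Integrable (fun x => b x (u x) (Du x) * excess k (u x)) μ := by
    refine (((hFi.add (hups.const_mul 2)).const_mul c).add hb₄ |>.add hb₃u).mono'
      ((hb.aestronglyMeasurable_comp um Dum).mul hmem.memW1F.memW11.memLp.1) ?_
    filter_upwards [hgrowth, hb₃0, hb₄0, ae_restrict_mem hΩ] with x hx hx3 hx4 hxΩ
    obtain ⟨h1, h2⟩ := hx (u x) (Du x)
    have hF := hf.nonneg x hxΩ (u x) (Du x)
    have hup : 0 ≤ |u x| ^ ps := by positivity
    have h3 : 0 ≤ c * (f x (u x) (Du x) + 2 * |u x| ^ ps) := by positivity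
    have h4 : 0 ≤ b₃ x * |u x| := by positivity
    simp only [Pi.add_apply, Real.norm_eq_abs]
    rcases le_or_gt |u x| k with hux | hux
    · rw [excess_of_le hux, mul_zero, abs_zero]; linarith
    rw [hbφ x hux, abs_le]
    have hw0 : 0 ≤ |u x| - k := by linarith
    have hwu : |u x| - k ≤ |u x| := by linarith
    have hFp : 0 ≤ f x (u x) (Du x) ^ (1 - 1 / ps) := Real.rpow_nonneg hF _
    have hup1 : 0 ≤ |u x| ^ (ps - 1) := by positivity
    constructor
    · have h5 := rpow_mul_le_add hF (abs_nonneg (u x)) hps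
      have h6 := abs_rpow_sub_one_mul_abs (t := u x) hps
      have h7 : (c * (f x (u x) (Du x) ^ (1 - 1 / ps) + |u x| ^ (ps - 1)) + b₃ x) * (|u x| - k) ≤
          c * (f x (u x) (Du x) + 2 * |u x| ^ ps) + b₃ x * |u x| := by
        calc _ ≤ (c * (f x (u x) (Du x) ^ (1 - 1 / ps) + |u x| ^ (ps - 1)) + b₃ x) * |u x| := by
              gcongr
          _ = c * (f x (u x) (Du x) ^ (1 - 1 / ps) * |u x| + |u x| ^ (ps - 1) * |u x|)
              + b₃ x * |u x| := by ring
          _ ≤ c * ((f x (u x) (Du x) + |u x| ^ ps) + |u x| ^ ps) + b₃ x * |u x| := by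
              rw [h6]; gcongr
          _ = _ := by ring
      have h8 := mul_le_mul_of_nonneg_right h1 hw0
      linarith
    -- The upper bound is only known for u b. If sign(u) b is positive, enlarging |u| - k to |u|
    -- reduces to it; otherwise the product is nonpositive.
    · rcases le_or_gt (Real.sign (u x) * b x (u x) (Du x)) 0 with hneg | hpos
      · have := mul_nonpos_of_nonpos_of_nonneg hneg hw0
        linarith
      · have h5 : Real.sign (u x) * b x (u x) (Du x) * (|u x| - k) ≤ u x * b x (u x) (Du x) := by
          refine (mul_le_mul_of_nonneg_left hwu hpos.le).trans (le_of_eq ?_)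
          have : Real.sign (u x) * |u x| = u x := by
            rcases lt_trichotomy (u x) 0 with h | h | h
            · rw [Real.sign_of_neg h, abs_of_neg h]; ring
            · rw [h]; simp
            · rw [Real.sign_of_pos h, abs_of_pos h]; ring
          calc _ = Real.sign (u x) * |u x| * b x (u x) (Du x) := by ring
            _ = _ := by rw [this]
        linarith
  have heq := hu.equation _ _ hmem i1 i2
  have hA : ∫ x in {x | k < |u x|}, (inner ℝ (a x (u x) (Du x)) (levelInd k (u x) • Du x)
      + b x (u x) (Du x) * excess k (u x)) ∂μ = 0 := by
    rw [← heq, ← integral_indicator₀ (hn' k)]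
    refine integral_congr_ae (Eventually.of_forall fun x => ?_)
    by_cases hx : k < |u x|
    · simp [hx]
    · simp [hx, levelInd_of_le (not_lt.1 hx), excess_of_le (not_lt.1 hx)]
  have hBk : IntegrableOn (fun x => (|b₁ x| + b₃ x) * (|u x| - k)) {x | k < |u x|} μ := by
    have h1 := hBu.sub (hBi.const_mul k)
    refine Integrable.integrableOn (h1.congr (Eventually.of_forall fun x => ?_))
    simp only [Pi.sub_apply]
    ring
  -- The integrand of the equation is added on the right at no cost, since its integral over the
  -- level set vanishes by `hA`. The estimate then becomes pointwise: ellipticity gives c₁ f, and a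
  -- quarter of it pays for the term f^{1-1/p*}.
  have hint : ∫ x in {x | k < |u x|}, (3 / 4 * c₁) * f x (u x) (Du x) ∂μ ≤
      ∫ x in {x | k < |u x|}, ((c₂ + c₁ * d + c + 1) * (|u x| ^ ps + (|b₁ x| + b₃ x)
        + (|b₁ x| + b₃ x) * (|u x| - k)) + (inner ℝ (a x (u x) (Du x)) (levelInd k (u x) • Du x)
        + b x (u x) (Du x) * excess k (u x))) ∂μ := by
    refine integral_mono_ae (hFi.integrableOn.const_mul _)
      ((((hups.integrableOn.add hBi.integrableOn).add hBk).const_mul _).add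
        (i1.add i2).integrableOn) ?_
    filter_upwards [ae_restrict_mem₀ (hn' k), ae_restrict_of_ae hcomp, ae_restrict_of_ae hgrowth,
      ae_restrict_of_ae hgrad, ae_restrict_of_ae hb₃0,
      ae_restrict_of_ae (ae_restrict_mem hΩ)] with x hux hx hgx hgr hx3 hxΩ
    replace hux : k < |u x| := hux
    have h1 := (hx (u x) (Du x)).1
    have h2 := (hgx (u x) (Du x)).1
    have h3 := (hgr (u x) (Du x)).1
    have hF := hf.nonneg x hxΩ (u x) (Du x)
    have hup : 0 ≤ |u x| ^ ps := by positivity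
    have hw0 : 0 ≤ |u x| - k := by linarith
    have hwu : |u x| - k ≤ |u x| := by linarith
    rw [hbφ x hux, levelInd_of_lt hux, one_smul]
    have h4 := mul_le_mul_of_nonneg_right h2 hw0
    have h5 : c * f x (u x) (Du x) ^ (1 - 1 / ps) * (|u x| - k) ≤
        1 / 4 * c₁ * f x (u x) (Du x) + c₁ * d * |u x| ^ ps := by
      -- Scaling by c / c₁ makes the absorbed term exactly a quarter of c₁ f; this is the origin of
      -- d.
      have h6 := rpow_mul_le_quarter_add hF (v := c / c₁ * (|u x| - k)) (by positivity) hps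
      have h7 : (4 * (c / c₁ * (|u x| - k))) ^ ps ≤ d * |u x| ^ ps := by
        rw [hd, ← Real.mul_rpow (by positivity) (abs_nonneg _)]
        refine Real.rpow_le_rpow (by positivity) ?_ (by linarith)
        rw [← mul_assoc]
        gcongr
      calc c * f x (u x) (Du x) ^ (1 - 1 / ps) * (|u x| - k)
          = c₁ * (f x (u x) (Du x) ^ (1 - 1 / ps) * (c / c₁ * (|u x| - k))) := by field_simp
        _ ≤ c₁ * (1 / 4 * f x (u x) (Du x) + d * |u x| ^ ps) := by
            gcongr
            exact h6.trans (by linarith)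
        _ = _ := by ring
    have h6 : c * |u x| ^ (ps - 1) * (|u x| - k) ≤ c * |u x| ^ ps := by
      rw [← abs_rpow_sub_one_mul_abs (t := u x) hps, ← mul_assoc]
      exact mul_le_mul_of_nonneg_left hwu (by positivity)
    have h7 := mul_le_mul_of_nonneg_left h3 hc₁.le
    have h8 := le_abs_self (b₁ x)
    have h9 : 0 ≤ |b₁ x| * (|u x| - k) := mul_nonneg (abs_nonneg _) hw0
    have h10 : 0 ≤ b₃ x * (|u x| - k) := mul_nonneg hx3 hw0
    have h11 : 0 ≤ (c₂ + c₁ * d + c) * ((|b₁ x| + b₃ x) + (|b₁ x| + b₃ x) * (|u x| - k)) := by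
      positivity
    linarith
  have j1 : IntegrableOn (fun x => |u x| ^ ps + (|b₁ x| + b₃ x)) {x | k < |u x|} μ :=
    hups.integrableOn.add hBi.integrableOn
  have j2 : IntegrableOn (fun x => |u x| ^ ps + (|b₁ x| + b₃ x) + (|b₁ x| + b₃ x) * (|u x| - k))
    {x | k < |u x|} μ := j1.add hBk
  have j3 : IntegrableOn (fun x => inner ℝ (a x (u x) (Du x)) (levelInd k (u x) • Du x)
      + b x (u x) (Du x) * excess k (u x)) {x | k < |u x|} μ := (i1.add i2).integrableOn
  rw [integral_const_mul, integral_add (j2.const_mul _) j3, hA, add_zero, integral_const_mul,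
    integral_add j1 hBk, integral_add hups.integrableOn hBi.integrableOn] at hint
  rw [div_mul_eq_mul_div, div_mul_eq_mul_div, le_div_iff₀ (by positivity)]
  linarith

end WeakSolutions

/-! ### Choice of exponents and the case p > n. -/

theorem exists_ae_abs_le_of_memLp_top {X : Type*} [MeasurableSpace X] {μ : Measure X} {g : X → ℝ}
    (hg : MemLp g ⊤ μ) : ∃ k : ℝ, 0 ≤ k ∧ ∀ᵐ x ∂μ, |g x| ≤ k := by
  refine ⟨(eLpNormEssSup g μ).toReal, ENNReal.toReal_nonneg, ?_⟩
  have hlt : eLpNormEssSup g μ < ⊤ := by simpa using hg.2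
  filter_upwards [enorm_ae_le_eLpNormEssSup g μ] with x hx
  have := ENNReal.toReal_mono hlt.ne hx
  rwa [toReal_enorm, Real.norm_eq_abs] at this

theorem memLp_top_of_measure_superlevel_eq_zero {X : Type*} [MeasurableSpace X] {μ : Measure X}
    {g : X → ℝ} (hg : AEStronglyMeasurable g μ) {K : ℝ} (hK : μ {x | K < |g x|} = 0) :
    MemLp g ⊤ μ := by
  refine memLp_top_of_bound hg K ?_
  rw [ae_iff]
  simpa using hK

/-- The choice of the exponents in the Sobolev inequality. -/
theorem exists_sobolev_exponents {n : ℕ} (hn : 2 ≤ n) {p ps s : ℝ} (hp : 1 < p) (hpn : p ≤ n)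
    (hps : IsSobolevExponent n p ps) (hs : 1 < s) (hs' : n / p < s) :
    p < ps ∧ ∃ r Q : ℝ, 1 ≤ r ∧ r ≤ p ∧ Q⁻¹ = r⁻¹ - (n : ℝ)⁻¹ ∧ ps ≤ Q ∧ p < (1 - 1 / s) * Q := by
  have hn2 : (2 : ℝ) ≤ n := by exact_mod_cast hn
  have hn0 : (0 : ℝ) < n := by linarith
  have hp0 : 0 < p := by linarith
  have hs0 : 0 < s := by linarith
  rcases hpn.lt_or_eq with hlt | heq
  -- Below the dimension r = p and Q = p*, and the condition p < (1 - 1/s)Q is a rewriting of s >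
  -- n/p.
  · have hps' := hps.1 hlt
    have hnp : 0 < n - p := by linarith
    have hinv : ps⁻¹ = p⁻¹ - (n : ℝ)⁻¹ := by rw [hps']; field_simp
    have hps0 : 0 < ps := by rw [hps']; positivity
    refine ⟨?_, p, ps, hp.le, le_rfl, hinv, le_rfl, ?_⟩
    · rw [hps', lt_div_iff₀ hnp]; nlinarith
    · have h1 : 1 / s < p / n := by
        rw [div_lt_div_iff₀ hs0 hn0]
        rw [div_lt_iff₀ hp0] at hs'
        linarith
      have h2 : (1 - p / n) * ps = p := by rw [hps']; field_simp
      calc p = (1 - p / n) * ps := h2.symm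
        _ < (1 - 1 / s) * ps := by gcongr
  · have hps' := hps.2 heq.ge
    refine ⟨hps', ?_⟩
    have h1s : 0 < 1 - 1 / s := by
      have : 1 / s < 1 := (div_lt_one hs0).2 hs
      linarith
    -- For p = n any finite Q is available, so it is taken large enough for both requirements, and r
    -- < n is read off from the Sobolev relation. Then r ≥ 1 because Q and n are at least 2.
    set Q : ℝ := max ps ((p + 1) / (1 - 1 / s)) with hQ
    have hQps : ps ≤ Q := le_max_left _ _
    have hQ0 : 0 < Q := by linarith
    have hQ2 : 2 ≤ Q := by linarith
    have hinv0 : 0 < Q⁻¹ + (n : ℝ)⁻¹ := by positivity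
    refine ⟨(Q⁻¹ + (n : ℝ)⁻¹)⁻¹, Q, ?_, ?_, ?_, hQps, ?_⟩
    · rw [one_le_inv₀ hinv0]
      have a1 : Q⁻¹ ≤ 2⁻¹ := inv_anti₀ two_pos hQ2
      have a2 : (n : ℝ)⁻¹ ≤ 2⁻¹ := inv_anti₀ two_pos hn2
      linarith
    · rw [inv_le_comm₀ hinv0 hp0, heq]
      linarith [inv_pos.2 hQ0]
    · rw [inv_inv]; ring
    · have h3 : (p + 1) / (1 - 1 / s) ≤ Q := le_max_right _ _
      rw [div_le_iff₀ h1s] at h3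
      linarith

theorem integrable_rpow_of_le_exponent {X : Type*} [MeasurableSpace X] {μ : Measure X}
    [IsFiniteMeasure μ] {U : X → ℝ} (hU : AEMeasurable U μ) (hU0 : ∀ x, 0 ≤ U x) {r Q : ℝ}
    (hr : 0 < r) (hrQ : r ≤ Q) (h : Integrable (fun x => U x ^ Q) μ) :
    Integrable (fun x => U x ^ r) μ := by
  refine (h.add (integrable_const 1)).mono' (hU.pow_const r).aestronglyMeasurable
    (Eventually.of_forall fun x => ?_)
  rw [Real.norm_of_nonneg (Real.rpow_nonneg (hU0 x) _), Pi.add_apply]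
  rcases le_total (U x) 1 with h1 | h1
  · have := Real.rpow_le_one (hU0 x) h1 hr.le
    have := Real.rpow_nonneg (hU0 x) Q
    linarith
  · have := Real.rpow_le_rpow_of_exponent_le h1 hrQ
    linarith

/-- The Sobolev inequality with r = 1, Q = n/(n - 1) has the measure factor |A_k|^{(1-1/p)Q}, whose
exponent exceeds 1 exactly because p > n. Bounding the gradient integral by its value on all of Ω
already yields a superlinear recursion. -/
theorem memLp_top_of_lt {n : ℕ} (hn : 2 ≤ n) {Ω : Set (EuclideanSpace ℝ (Fin n))}
    (hΩ : MeasurableSet Ω) [IsFiniteMeasure (volume.restrict Ω)] {p k₀ : ℝ} (hpn : n < p)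
    {u : EuclideanSpace ℝ (Fin n) → ℝ} {Du : EuclideanSpace ℝ (Fin n) → EuclideanSpace ℝ (Fin n)}
    (hum : AEStronglyMeasurable u (volume.restrict Ω))
    (hDu : MemLp Du (ENNReal.ofReal p) (volume.restrict Ω)) (hk₀ : 0 ≤ k₀)
    (h : ∀ k, k₀ ≤ k →
      MemW10 Ω (ENNReal.ofReal p) (fun x => excess k (u x)) (fun x => levelInd k (u x) • Du x)) :
    MemLp u ⊤ (volume.restrict Ω) := by
  have hn2 : (2 : ℝ) ≤ n := by exact_mod_cast hn
  have hn0 : (0 : ℝ) < n := by linarith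
  have hn1 : (0 : ℝ) < n - 1 := by linarith
  have hp0 : 0 < p := by linarith
  set Q : ℝ := n / (n - 1) with hQ
  have hQ0 : 0 < Q := by positivity
  obtain ⟨hUQ, C, hC0, hC⟩ := exists_setIntegral_superlevel_le (by omega) hΩ (p := p) (r := 1)
    (Q := Q) (k₀ := k₀) le_rfl (by linarith) hQ0 (by rw [hQ]; field_simp) hk₀ hum hDu h
  set μ := volume.restrict Ω with hμ
  have hU : AEMeasurable (fun x => |u x|) μ := hum.norm.aemeasurable
  have hi : Integrable (fun x => ‖Du x‖ ^ p) μ := by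
    have := (integrable_norm_rpow_iff hDu.1 (by simpa using hp0) ENNReal.ofReal_ne_top).2 hDu
    rwa [ENNReal.toReal_ofReal hp0.le] at this
  have hθ : 1 < (1 - 1 / p) * (Q / 1) := by
    have h1 : 1 / p < 1 / n := one_div_lt_one_div_of_lt hn0 hpn
    have h2 : (1 - 1 / (n : ℝ)) * Q = 1 := by rw [hQ]; field_simp
    have h3 : (1 - 1 / (n : ℝ)) * Q < (1 - 1 / p) * Q := by gcongr
    rw [div_one]
    linarith
  set J : ℝ := (∫ x, ‖Du x‖ ^ p ∂μ) ^ (Q / p) with hJ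
  have hJ0 : 0 ≤ J := by positivity
  obtain ⟨K, hK⟩ := exists_measure_superlevel_eq_zero hU (C := C * (J + 1)) (Q := Q)
    (α := (1 - 1 / p) * (Q / 1) - 1) (k₀ := k₀) (by positivity) hQ0 (by linarith) hUQ
    (fun K hK hK1 k h hKk hkh _ _ => by
      have hkk₀ : k₀ ≤ k := hK.trans hKk
      have hk0 : 0 ≤ k := hk₀.trans hkk₀
      have hTi : IntegrableOn (fun x => (|u x| - k) ^ Q) {x | k < |u x|} μ := by
        refine hUQ.integrableOn.mono' (((hU.sub_const k).pow_const Q).aestronglyMeasurable.restrict)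
          ?_
        filter_upwards [ae_restrict_mem₀ (nullMeasurableSet_lt aemeasurable_const hU)] with x hx
        have : k < |u x| := hx
        rw [Real.norm_of_nonneg (Real.rpow_nonneg (by linarith) _)]
        exact Real.rpow_le_rpow (by linarith) (by linarith) hQ0.le
      refine (rpow_mul_measureReal_superlevel_le hU hQ0 hkh hTi).trans ((hC k hkk₀).trans ?_)
      have e1 : (∫ x in {x | k < |u x|}, ‖Du x‖ ^ p ∂μ) ^ (Q / p) ≤ J + 1 := by
        have : (∫ x in {x | k < |u x|}, ‖Du x‖ ^ p ∂μ) ^ (Q / p) ≤ J :=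
          Real.rpow_le_rpow (by positivity) (setIntegral_le_integral hi
            (Eventually.of_forall fun x => by positivity)) (by positivity)
        linarith
      have e2 : μ.real {x | k < |u x|} ≤ K ^ Q * μ.real {x | k < |u x|} :=
        le_mul_of_one_le_left measureReal_nonneg (Real.one_le_rpow hK1 hQ0.le)
      have e3 := Real.rpow_le_rpow measureReal_nonneg e2 (by linarith : 0 ≤ (1 - 1 / p) * (Q / 1))
      rw [add_sub_cancel, mul_assoc]
      exact mul_le_mul_of_nonneg_left (mul_le_mul e1 e3 (by positivity) (by positivity)) hC0.le)
  exact memLp_top_of_measure_superlevel_eq_zero hum hK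

end BoundedSolutions

/-! ### Assembly of the proof. -/

theorem mainTheorem1 {n : ℕ} (hn : 2 ≤ n)
    {Ω : Set (EuclideanSpace ℝ (Fin n))} (hΩ_open : IsOpen Ω) (hΩ_bdd : Bornology.IsBounded Ω)
    {p ps : ℝ} (hp : 1 < p) (hps : BoundedSolutions.IsSobolevExponent n p ps)
    {f : EuclideanSpace ℝ (Fin n) → ℝ → EuclideanSpace ℝ (Fin n) → ℝ}
    (hf : BoundedSolutions.IsConvexEnergyIntegrand Ω f)
    (hf_delta : BoundedSolutions.TwoSidedDeltaTwo Ω f)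
    (hf_coercive : BoundedSolutions.Coercive Ω p f)
    (hf_mono : BoundedSolutions.QuasiMonotone Ω f)
    (hf_zero : IntegrableOn (fun x => f x 0 0) Ω volume)
    {a : EuclideanSpace ℝ (Fin n) → ℝ → EuclideanSpace ℝ (Fin n) → EuclideanSpace ℝ (Fin n)}
    (ha : BoundedSolutions.IsCaratheodory Ω a)
    (ha_comp : BoundedSolutions.ComparisonInequalities Ω p ps f a)
    {b : EuclideanSpace ℝ (Fin n) → ℝ → EuclideanSpace ℝ (Fin n) → ℝ}
    (hb : BoundedSolutions.IsCaratheodory Ω b)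
    (hb_growth : BoundedSolutions.UnilateralGrowth Ω p ps f b ∨
      BoundedSolutions.AbsGrowth Ω p ps f b)
    {u₀ : EuclideanSpace ℝ (Fin n) → ℝ}
    {Du₀ : EuclideanSpace ℝ (Fin n) → EuclideanSpace ℝ (Fin n)}
    (hu₀_bdd : MemLp u₀ ⊤ (volume.restrict Ω))
    (hu₀ : BoundedSolutions.MemW1F Ω f u₀ Du₀)
    {u : EuclideanSpace ℝ (Fin n) → ℝ}
    {Du : EuclideanSpace ℝ (Fin n) → EuclideanSpace ℝ (Fin n)}
    (hu : BoundedSolutions.IsWeakSolution Ω p f a b u₀ Du₀ u Du) :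
    MemLp u ⊤ (volume.restrict Ω) := by
  open BoundedSolutions in
  have hΩ : MeasurableSet Ω := hΩ_open.measurableSet
  have hfin : IsFiniteMeasure (volume.restrict Ω) :=
    isFiniteMeasure_restrict.2 hΩ_bdd.measure_lt_top.ne
  have hp0 : 0 < p := by linarith
  have hq : 1 ≤ ENNReal.ofReal p := by simpa using hp.le
  have um := hu.memW1F.memW11.memLp.1
  have hFi := hu.memW1F.integrable_energy hΩ hf
  have hDu := hu.memW1F.memLp_grad hΩ hf hp0 hf_coercive
  have hu₀W : MemW1 Ω (ENNReal.ofReal p) u₀ Du₀ :=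
    ⟨hu₀.memW11.isWeakGradient, hu₀_bdd.mono_exponent le_top,
      hu₀.memLp_grad hΩ hf hp0 hf_coercive⟩
  obtain ⟨k₀, hk₀, hk₀u⟩ := exists_ae_abs_le_of_memLp_top hu₀_bdd
  have hexc : ∀ k, k₀ ≤ k → MemW10 Ω (ENNReal.ofReal p) (fun x => excess k (u x))
      (fun x => levelInd k (u x) • Du x) := fun k hk =>
    memW10_excess hΩ_open hq ENNReal.ofReal_ne_top hu₀W hu.boundary.memW10 (hk₀.trans hk)
      (hk₀u.mono fun x hx => hx.trans hk)
  rcases lt_or_ge (n : ℝ) p with hpn | hpn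
  · exact memLp_top_of_lt hn hΩ hpn um hDu hk₀ hexc
  obtain ⟨c₁, c₂, c₃, c₄, s₁, b₁, b₂, hc₁, hc₂, hc₃, hc₄, hs₁, hs₁', hb₁, hb₂, hcomp⟩ := ha_comp
  -- The exponents are first chosen with s₁ alone, only to learn ps > 1. The final s involves ε,
  -- which comes from the growth bounds, and these already need ps > 1.
  have hps1 : 1 < ps :=
    hp.trans (exists_sobolev_exponents hn hp hpn hps hs₁ hs₁').1
  obtain ⟨c, ε, b₃, b₄, hc, hε, hb₃0, hb₄0, hb₃, hb₄, hgrowth⟩ :=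
    exists_growth_bounds hps1 hΩ hf hf_coercive hb_growth
  have hnp : 1 ≤ n / p := (one_le_div hp0).2 hpn
  set s : ℝ := min s₁ (n / p + ε) with hs
  have hs1 : 1 < s := lt_min hs₁ (by linarith)
  have hs0 : 0 < s := by linarith
  obtain ⟨hpps, r, Q, hr, hrp, hrQ, hpsQ, hsQ⟩ :=
    exists_sobolev_exponents hn hp hpn hps hs1 (lt_min hs₁' (by linarith))
  have hQ0 : 0 < Q := by linarith
  obtain ⟨hUQ, C₂, hC₂, hSob⟩ := exists_setIntegral_superlevel_le (by omega) hΩ hr hrp hQ0 hrQ hk₀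
    um hDu hexc
  have hU : AEMeasurable (fun x => |u x|) (volume.restrict Ω) := um.norm.aemeasurable
  have hups := integrable_rpow_of_le_exponent hU (fun x => abs_nonneg _) (by linarith) hpsQ hUQ
  have hb₁s : MemLp b₁ (ENNReal.ofReal s) (volume.restrict Ω) :=
    hb₁.mono_exponent (ENNReal.ofReal_le_ofReal (min_le_left _ _))
  have hb₃s : MemLp b₃ (ENNReal.ofReal s) (volume.restrict Ω) :=
    hb₃.mono_exponent (ENNReal.ofReal_le_ofReal (min_le_right _ _))
  have hs1' : 1 ≤ ENNReal.ofReal s := by simpa using hs1.le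
  have hBs : MemLp (fun x => |b₁ x| + b₃ x) (ENNReal.ofReal s) (volume.restrict Ω) :=
    hb₁s.norm.add hb₃s
  have hB0 : ∀ᵐ x ∂(volume.restrict Ω), 0 ≤ |b₁ x| + b₃ x :=
    hb₃0.mono fun x hx => add_nonneg (abs_nonneg _) hx
  have hBi : Integrable (fun x => (|b₁ x| + b₃ x) ^ s) (volume.restrict Ω) := by
    have h1 := (integrable_norm_rpow_iff hBs.1 (by simpa using hs0) ENNReal.ofReal_ne_top).2 hBs
    rw [ENNReal.toReal_ofReal hs0.le] at h1
    refine h1.congr ?_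
    filter_upwards [hB0] with x hx
    rw [Real.norm_of_nonneg hx]
  have hBu : Integrable (fun x => (|b₁ x| + b₃ x) * |u x|) (volume.restrict Ω) := by
    have hcj : s.HolderConjugate (Real.conjExponent s) := Real.HolderConjugate.conjExponent hs1
    have hs'0 : 0 < Real.conjExponent s := hcj.symm.pos
    -- From 1 < p < (1 - 1/s)Q one gets s' ≤ Q, so u ∈ L^{s'} and its product with B ∈ L^s is
    -- integrable.
    have hs'Q : Real.conjExponent s ≤ Q := by
      have h1s : (Real.conjExponent s)⁻¹ = 1 - 1 / s := by
        have := hcj.inv_add_inv_eq_one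
        rw [one_div]; linarith
      have h2 : 1 ≤ (Real.conjExponent s)⁻¹ * Q := by rw [h1s]; linarith
      rwa [inv_mul_eq_div, one_le_div hs'0] at h2
    have hum' : MemLp (fun x => |u x|) (ENNReal.ofReal (Real.conjExponent s))
        (volume.restrict Ω) := by
      rw [← integrable_norm_rpow_iff hU.aestronglyMeasurable (by simpa using hs'0) ENNReal.ofReal_ne_top,
        ENNReal.toReal_ofReal hs'0.le]
      simpa using integrable_rpow_of_le_exponent hU (fun x => abs_nonneg _) hs'0 hs'Q hUQ
    have : ENNReal.HolderConjugate (ENNReal.ofReal s) (ENNReal.ofReal (Real.conjExponent s)) :=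
      hcj.ennrealOfReal
    exact hBs.integrable_mul hum'
  obtain ⟨C₁, hC₁, hCacc⟩ := hu.exists_caccioppoli hΩ hp hps1 hf hf_delta hf_mono ha hb hc₁ hc₂ hc₃
    hc₄ hc (hb₁s.integrable hs1') hb₂ (hb₃s.integrable hs1') hb₄ hb₃0 hb₄0 hcomp hgrowth hups hBu
    hk₀ hexc
  obtain ⟨c₅, hc₅, hco⟩ := hf_coercive
  have hF0 : ∀ᵐ x ∂(volume.restrict Ω), 0 ≤ f x (u x) (Du x) := by
    filter_upwards [ae_restrict_mem hΩ] with x hx using hf.nonneg x hx _ _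
  -- For p ≤ n the measure factor in the Sobolev inequality is dispensable and is bounded by its
  -- value on Ω; the decay comes from the Caccioppoli inequality.
  set D : ℝ := (volume.restrict Ω).real Set.univ ^ ((1 - r / p) * (Q / r)) with hD
  have hrp' : 0 ≤ (1 - r / p) * (Q / r) :=
    mul_nonneg (by linarith [(div_le_one hp0).2 hrp]) (by positivity)
  obtain ⟨K, hK⟩ := exists_measure_superlevel_eq_zero_of_caccioppoli hU
    (C₂ := C₂ * ((c₅⁻¹) ^ (Q / p) * D) + 1) (k₀ := k₀) hp hpps hpsQ hs1 hsQ hC₁ (by positivity) hUQ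
    hups hF0 hBs.1 hB0 hBi hCacc (fun k hk => by
      have hΦ0 : 0 ≤ ∫ x in {x | k < |u x|}, f x (u x) (Du x) ∂(volume.restrict Ω) :=
        integral_nonneg_of_ae (ae_restrict_of_ae hF0)
      have e1 : ∫ x in {x | k < |u x|}, ‖Du x‖ ^ p ∂(volume.restrict Ω) ≤
          c₅⁻¹ * ∫ x in {x | k < |u x|}, f x (u x) (Du x) ∂(volume.restrict Ω) := by
        rw [← integral_const_mul]
        have h1 := (integrable_norm_rpow_iff hDu.1 (by simpa using hp0) ENNReal.ofReal_ne_top).2 hDu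
        rw [ENNReal.toReal_ofReal hp0.le] at h1
        refine integral_mono_ae h1.integrableOn (hFi.const_mul _).integrableOn ?_
        filter_upwards [ae_restrict_of_ae hco] with x hx
        rw [inv_mul_eq_div, le_div_iff₀' hc₅]
        exact hx _ _
      have e2 := Real.rpow_le_rpow (by positivity) e1 (by positivity : 0 ≤ Q / p)
      rw [Real.mul_rpow (by positivity) hΦ0] at e2
      have e3 : (volume.restrict Ω).real {x | k < |u x|} ^ ((1 - r / p) * (Q / r)) ≤ D :=
        Real.rpow_le_rpow measureReal_nonneg (measureReal_mono (subset_univ _)) hrp'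
      have hΦQ := Real.rpow_nonneg hΦ0 (Q / p)
      have e4 := mul_le_mul e2 e3 (by positivity) (by positivity)
      have e5 := (hSob k hk).trans (mul_le_mul_of_nonneg_left e4 hC₂.le)
      linarith)
  exact memLp_top_of_measure_superlevel_eq_zero um hK
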